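/- **Conventions.** All $C^*$-algebras and $*$-homomorphisms are unital (the zero algebra is allowed). $B$ is a commutative unital $C^*$-algebra with a left action of a discrete group $\Gamma$ by $*$-automorphisms. The enveloping $C^*$-algebra $C^*(A)$ of a $*$-algebra $A$ with $|a|:=\sup_\pi\|\pi(a)\|<\infty$ for all $a$ (the supremum over all $*$-homomorphisms $\pi$ into $C^*$-algebras) is its separated completion with respect to $|\cdot|$. $A\hat\otimes C$ is the maximal tensor product, the enveloping $C^*$-algebra of the algebraic tensor product $A\otimes C$. $C^*(\Gamma)$ is the full group $C^*$-algebra, with comultiplication $\Delta_\Gamma(\gamma)=\gamma\otimes\gamma$. Completely positive (c.p.) maps are linear and need not be unital; for c.p. maps $\phi,\psi$, $\phi\hat\otimes\psi$ is the continuous linear map with $a\otimes c\mapsto\phi(a)\otimes\psi(c)$. A *$(\mathbb C,\Gamma)$-$C^*$-algebra* is a $C^*$-algebra $A$ with injective $*$-homomorphisms $\delta_A\colon A\to C^*(\Gamma)\hat\otimes A$ and $\bar\delta_A\colon A\to A\hat\otimes C^*(\Gamma)$ such that $(\mathrm{id}\hat\otimes\delta_A)\delta_A=(\Delta_\Gamma\hat\otimes\mathrm{id})\delta_A$,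 $(\bar\delta_A\hat\otimes\mathrm{id})\bar\delta_A=(\mathrm{id}\hat\otimes\Delta_\Gamma)\bar\delta_A$ and $(\delta_A\hat\otimes\mathrm{id})\bar\delta_A=(\mathrm{id}\hat\otimes\bar\delta_A)\delta_A$. Put $A_{\gamma,\gamma'}=\{a:\delta_A(a)=\gamma\otimes a,\ \bar\delta_A(a)=a\otimes\gamma'\}$. A *$(B,\Gamma)$-$C^*$-algebra* is a $(\mathbb C,\Gamma)$-$C^*$-algebra $A$ with $*$-homomorphisms $r_A,s_A\colon B\to A_{e,e}$ with commuting images such that $a\,r_A(b)=r_A(\gamma(b))\,a$ and $a\,s_A(b)=s_A(\gamma'(b))\,a$ for all $a\in A_{\gamma,\gamma'}$, $b\in B$. A *morphism* (resp. *c.p. map*) of $(B,\Gamma)$-$C^*$-algebras $A\to C$ is a $*$-homomorphism (resp. c.p. map) $\phi$ such that $\delta_C\phi=(\mathrm{id}\hat\otimes\phi)\delta_A$, $\bar\delta_C\phi=(\phi\hat\otimes\mathrm{id})\bar\delta_A$ and $\phi(r_A(b)s_A(b')a)=r_C(b)s_C(b')\phi(a)$. For $(\mathbb C,\Gamma)$-$C^*$-algebras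 $A,C$, the *cotensor product* is $A\hat\otimes^\Gamma C=\{x\in A\hat\otimes C:(\bar\delta_A\hat\otimes\mathrm{id})(x)=(\mathrm{id}\hat\otimes\delta_C)(x)\}$, with the restrictions of $\delta_A\hat\otimes\mathrm{id}$ and $\mathrm{id}\hat\otimes\bar\delta_C$; $\phi\hat\otimes^\Gamma\psi$ denotes the restriction of $\phi\hat\otimes\psi$. For $(B,\Gamma)$-$C^*$-algebras $A,C$ it also carries $r(b)=r_A(b)\otimes1$ and $s(b)=1\otimes s_C(b)$. Let $t_{A,C}(b)=s_A(b)\otimes1-1\otimes r_C(b)$ and $$A\,\tilde\otimes\,C:=(A\hat\otimes^\Gamma C)/(t_{A,C}(B)),$$ the quotient by the closed two-sided ideal generated by $t_{A,C}(B)$, with the induced structure maps and quotient map $q_{A,C}$; $\phi\tilde\otimes\psi$ denotes the map induced by $\phi\hat\otimes^\Gamma\psi$. The full crossed product $B\hat\rtimes\Gamma$ is the enveloping $C^*$-algebra of the algebraic crossed product $B\rtimes\Gamma$ (finite sums $\sum_\gamma b_\gamma\gamma$ with $\gamma b=\gamma(b)\gamma$, $\gamma^*=\gamma^{-1}$), with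 $\delta(b\gamma)=\gamma\otimes b\gamma$, $\bar\delta(b\gamma)=b\gamma\otimes\gamma$ and $r=s$ the canonical map $B\to B\hat\rtimes\Gamma$; $\iota_\Gamma\colon C^*(\Gamma)\to B\hat\rtimes\Gamma$ is the canonical map $\gamma\mapsto\gamma$. **Theorem.** Let $A,C,D$ be $(B,\Gamma)$-$C^*$-algebras. 1. *(The product.)* $A\hat\otimes^\Gamma C$ and $A\tilde\otimes C$ are well-defined $(B,\Gamma)$-$C^*$-algebras: the structure maps exist and are the unique ones described above, $t_{A,C}(B)\subseteq A\hat\otimes^\Gamma C$, and $q_{A,C}$ is a morphism. Morphisms are c.p. maps of $(B,\Gamma)$-$C^*$-algebras. For c.p. maps $\phi\colon A\to A'$, $\psi\colon C\to C'$ of $(B,\Gamma)$-$C^*$-algebras, the maps $\phi\hat\otimes^\Gamma\psi$ and $\phi\tilde\otimes\psi$ are well-defined c.p. maps of $(B,\Gamma)$-$C^*$-algebras; $\phi\tilde\otimes\psi$ is a morphism if $\phi$ and $\psi$ are; and $\tilde\otimes$ respects identities and compositions. 2. *(Unit.)* $B\hat\rtimes\Gamma$ is a $(B,\Gamma)$-$C^*$-algebra,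 and the maps $$L_A\colon A\xrightarrow{\delta_A}C^*(\Gamma)\hat\otimes^\Gamma A\xrightarrow{\iota_\Gamma\hat\otimes^\Gamma\mathrm{id}}(B\hat\rtimes\Gamma)\hat\otimes^\Gamma A\xrightarrow{q}(B\hat\rtimes\Gamma)\tilde\otimes A,$$ $$R_A\colon A\xrightarrow{\bar\delta_A}A\hat\otimes^\Gamma C^*(\Gamma)\xrightarrow{\mathrm{id}\hat\otimes^\Gamma\iota_\Gamma}A\hat\otimes^\Gamma(B\hat\rtimes\Gamma)\xrightarrow{q}A\tilde\otimes(B\hat\rtimes\Gamma)$$ are isomorphisms of $(B,\Gamma)$-$C^*$-algebras. They are natural with respect to all c.p. maps of $(B,\Gamma)$-$C^*$-algebras: $(\mathrm{id}\tilde\otimes\phi)L_A=L_{A'}\phi$ and $(\phi\tilde\otimes\mathrm{id})R_A=R_{A'}\phi$ for every such $\phi\colon A\to A'$. 3. *(Associativity.)* The associativity isomorphism of $\hat\otimes$ restricts to an isomorphism of $(B,\Gamma)$-$C^*$-algebras $a_{A,C,D}\colon(A\hat\otimes^\Gamma C)\hat\otimes^\Gamma D\to A\hat\otimes^\Gamma(C\hat\otimes^\Gamma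 D)$. Let $\Phi_{A,C,D}=q_{A\tilde\otimes C,D}\circ(q_{A,C}\hat\otimes^\Gamma\mathrm{id})$ and $\Psi_{A,C,D}=q_{A,C\tilde\otimes D}\circ(\mathrm{id}\hat\otimes^\Gamma q_{C,D})$, as maps from these two algebras to $(A\tilde\otimes C)\tilde\otimes D$ and $A\tilde\otimes(C\tilde\otimes D)$. - (i) $\ker\Phi_{A,C,D}$ and $\ker\Psi_{A,C,D}$ are the closed two-sided ideals generated by $t_{A,C}(B)\otimes1_D+t_{A\hat\otimes^\Gamma C,D}(B)$ and $1_A\otimes t_{C,D}(B)+t_{A,C\hat\otimes^\Gamma D}(B)$, respectively. - (ii) There is a unique isomorphism of $(B,\Gamma)$-$C^*$-algebras $\tilde a_{A,C,D}\colon(A\tilde\otimes C)\tilde\otimes D\to A\tilde\otimes(C\tilde\otimes D)$ with $\tilde a_{A,C,D}\circ\Phi_{A,C,D}=\Psi_{A,C,D}\circ a_{A,C,D}$. - (iii) The family $(\tilde a_{A,C,D})$ is natural with respect to c.p. maps of $(B,\Gamma)$-$C^*$-algebras: $(\phi\tilde\otimes(\psi\tilde\otimes\chi))\circ\tilde a_{A,C,D}=\tilde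 a_{A',C',D'}\circ((\phi\tilde\otimes\psi)\tilde\otimes\chi)$ for all c.p. maps $\phi\colon A\to A'$, $\psi\colon C\to C'$, $\chi\colon D\to D'$ of $(B,\Gamma)$-$C^*$-algebras. -/

import Mathlib

open scoped TensorProduct

namespace DynQG

universe u v

set_option linter.unusedSectionVars false

/-! ### Enveloping C*-algebras -/

section Enveloping

variable {A : Type u} [Ring A] [StarRing A] [Algebra ℂ A]

/-- A C*-seminorm on a unital `*`-algebra. -/
structure IsCStarSeminorm (p : A → ℝ) : Prop where
  add_le : ∀ a b, p (a + b) ≤ p a + p b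
  smul : ∀ (c : ℂ) a, p (c • a) = ‖c‖ * p a
  mul_le : ∀ a b, p (a * b) ≤ p a * p b
  star_mul_self : ∀ a, p (star a * a) = p a * p a

namespace IsCStarSeminorm

variable {p : A → ℝ}

theorem zero (hp : IsCStarSeminorm p) : p 0 = 0 := by
  have := hp.smul 0 0
  simpa using this

theorem neg (hp : IsCStarSeminorm p) (a : A) : p (-a) = p a := by
  have := hp.smul (-1) a
  simpa using this

theorem nonneg (hp : IsCStarSeminorm p) (a : A) : 0 ≤ p a := by
  have h := hp.add_le a (-a)
  rw [add_neg_cancel, hp.zero, hp.neg] at h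
  linarith

theorem le_star (hp : IsCStarSeminorm p) (a : A) : p a ≤ p (star a) := by
  rcases (hp.nonneg a).eq_or_lt with h | h
  · rw [← h]; exact hp.nonneg _
  · have h1 := hp.mul_le (star a) a
    rw [hp.star_mul_self] at h1
    exact le_of_mul_le_mul_right h1 h

theorem star_eq (hp : IsCStarSeminorm p) (a : A) : p (star a) = p a :=
  le_antisymm (by simpa using hp.le_star (star a)) (hp.le_star a)

theorem one_le (hp : IsCStarSeminorm p) : p 1 ≤ 1 := by
  have h := hp.star_mul_self 1
  rw [star_one, one_mul] at h
  nlinarith [hp.nonneg 1]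

end IsCStarSeminorm

/-- A copy of `A`, seminormed by the C*-seminorm `p`. -/
def WithCStarSeminorm (p : A → ℝ) (_hp : IsCStarSeminorm p) : Type u := A

namespace WithCStarSeminorm

variable (p : A → ℝ) (hp : IsCStarSeminorm p)

instance : Ring (WithCStarSeminorm p hp) := inferInstanceAs (Ring A)
instance : StarRing (WithCStarSeminorm p hp) := inferInstanceAs (StarRing A)
instance : Algebra ℂ (WithCStarSeminorm p hp) := inferInstanceAs (Algebra ℂ A)
instance [StarModule ℂ A] : StarModule ℂ (WithCStarSeminorm p hp) :=
  inferInstanceAs (StarModule ℂ A)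

noncomputable instance : SeminormedRing (WithCStarSeminorm p hp) where
  toRing := inferInstance
  __ := AddGroupSeminorm.toSeminormedAddCommGroup (E := WithCStarSeminorm p hp)
    { toFun := p
      map_zero' := hp.zero
      add_le' := hp.add_le
      neg' := hp.neg }
  norm_mul_le := hp.mul_le

theorem norm_def (a : WithCStarSeminorm p hp) : ‖a‖ = p a := rfl

instance : NormedAlgebra ℂ (WithCStarSeminorm p hp) where
  norm_smul_le c a := (hp.smul c a).le

instance : NormedStarGroup (WithCStarSeminorm p hp) where
  norm_star_le a := (hp.star_eq a).le

end WithCStarSeminorm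

/-- The separated completion of a `*`-algebra with respect to a C*-seminorm. -/
def CStarCompletion (p : A → ℝ) (hp : IsCStarSeminorm p) : Type u :=
  UniformSpace.Completion (WithCStarSeminorm p hp)

end Enveloping

section Completion

open UniformSpace

variable {A : Type u} [Ring A] [StarRing A] [Algebra ℂ A]
  (p : A → ℝ) (hp : IsCStarSeminorm p)

noncomputable instance : NormedRing (CStarCompletion p hp) :=
  inferInstanceAs (NormedRing (Completion (WithCStarSeminorm p hp)))

noncomputable instance : CompleteSpace (CStarCompletion p hp) :=
  inferInstanceAs (CompleteSpace (Completion (WithCStarSeminorm p hp)))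

noncomputable instance : Algebra ℂ (CStarCompletion p hp) :=
  inferInstanceAs (Algebra ℂ (Completion (WithCStarSeminorm p hp)))

noncomputable instance : NormedAlgebra ℂ (CStarCompletion p hp) where
  norm_smul_le c x :=
    (inferInstance : NormedSpace ℂ (Completion (WithCStarSeminorm p hp))).norm_smul_le c x

/-- The canonical map from a `*`-algebra to its completion. -/
noncomputable def CStarCompletion.of (a : A) : CStarCompletion p hp :=
  Completion.coe' (α := WithCStarSeminorm p hp) a

namespace CStarCompletion

theorem norm_of (a : A) : ‖of p hp a‖ = p a :=
  Completion.norm_coe (E := WithCStarSeminorm p hp) a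

theorem denseRange_of : DenseRange (of p hp) :=
  Completion.denseRange_coe (α := WithCStarSeminorm p hp)

theorem induction {P : CStarCompletion p hp → Prop} (hP : IsClosed {x | P x})
    (h : ∀ a, P (of p hp a)) (x) : P x :=
  (denseRange_of p hp).induction_on x hP h

theorem of_add (a b : A) : of p hp (a + b) = of p hp a + of p hp b :=
  Completion.coe_add (α := WithCStarSeminorm p hp) a b
theorem of_mul (a b : A) : of p hp (a * b) = of p hp a * of p hp b :=
  Completion.coe_mul (α := WithCStarSeminorm p hp) a b
theorem of_smul (c : ℂ) (a : A) : of p hp (c • a) = c • of p hp a :=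
  Completion.coe_smul (X := WithCStarSeminorm p hp) c a
theorem of_one : of p hp 1 = 1 := rfl

noncomputable instance : Star (CStarCompletion p hp) where
  star := Completion.map (star : WithCStarSeminorm p hp → WithCStarSeminorm p hp)

theorem continuous_star : Continuous (star : CStarCompletion p hp → CStarCompletion p hp) :=
  Completion.continuous_map

theorem of_star [StarModule ℂ A] (a : A) : of p hp (star a) = star (of p hp a) :=
  (Completion.map_coe (starₗᵢ ℂ (E := WithCStarSeminorm p hp)).isometry.uniformContinuous
    (a : WithCStarSeminorm p hp)).symm

instance : ContinuousStar (CStarCompletion p hp) := ⟨continuous_star p hp⟩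

noncomputable instance [StarModule ℂ A] : StarRing (CStarCompletion p hp) where
  star_involutive x := by
    induction x using induction with
    | hP => exact isClosed_eq (by fun_prop) (by fun_prop)
    | h a => rw [← of_star, ← of_star, star_star]
  star_mul x y := by
    induction x using induction with
    | hP => exact isClosed_eq (by fun_prop) (by fun_prop)
    | h a =>
      induction y using induction with
      | hP => exact isClosed_eq (by fun_prop) (by fun_prop)
      | h b => simp only [← of_star, ← of_mul, star_mul]
  star_add x y := by
    induction x using induction with
    | hP => exact isClosed_eq (by fun_prop) (by fun_prop)
    | h a =>
      induction y using induction with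
      | hP => exact isClosed_eq (by fun_prop) (by fun_prop)
      | h b => simp only [← of_star, ← of_add, star_add]

instance [StarModule ℂ A] : StarModule ℂ (CStarCompletion p hp) where
  star_smul c x := by
    induction x using induction with
    | hP =>
      exact isClosed_eq ((continuous_star p hp).comp (continuous_const_smul c))
        ((continuous_const_smul (star c)).comp (continuous_star p hp))
    | h a => simp only [← of_star, ← of_smul, star_smul]

instance [StarModule ℂ A] : CStarRing (CStarCompletion p hp) where
  norm_mul_self_le x := by
    induction x using induction with
    | hP => exact isClosed_le (by fun_prop) (by fun_prop)
    | h a => simp only [← of_star, ← of_mul, norm_of, hp.star_mul_self, le_refl]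

noncomputable instance [StarModule ℂ A] : CStarAlgebra (CStarCompletion p hp) where
  norm_smul_le := norm_smul_le
  star_smul := star_smul

/-- The canonical `*`-homomorphism from a `*`-algebra to its completion. -/
noncomputable def ofHom [StarModule ℂ A] : A →⋆ₐ[ℂ] CStarCompletion p hp where
  toFun := of p hp
  map_one' := of_one p hp
  map_mul' := of_mul p hp
  map_zero' := Completion.coe_zero (α := WithCStarSeminorm p hp)
  map_add' := of_add p hp
  commutes' _ := rfl
  map_star' := of_star p hp

end CStarCompletion
end Completion

section Universal

variable {A : Type u} [Ring A] [StarRing A] [Algebra ℂ A]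
  {D : Type v} [CStarAlgebra D]

theorem isCStarSeminorm_comp (π : A →⋆ₐ[ℂ] D) : IsCStarSeminorm fun a => ‖π a‖ where
  add_le a b := by rw [map_add]; exact norm_add_le _ _
  smul c a := by rw [map_smul]; exact norm_smul _ _
  mul_le a b := by rw [map_mul]; exact norm_mul_le _ _
  star_mul_self a := by rw [map_mul, map_star]; exact CStarRing.norm_star_mul_self

theorem IsCStarSeminorm.comp [StarModule ℂ A] {p : A → ℝ} (hp : IsCStarSeminorm p)
    {A' : Type v} [Ring A'] [StarRing A'] [Algebra ℂ A'] (π : A' →⋆ₐ[ℂ] A) :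
    IsCStarSeminorm fun a => p (π a) where
  add_le a b := by rw [map_add]; exact hp.add_le _ _
  smul c a := by rw [map_smul]; exact hp.smul _ _
  mul_le a b := by rw [map_mul]; exact hp.mul_le _ _
  star_mul_self a := by rw [map_mul, map_star]; exact hp.star_mul_self _

theorem IsCStarSeminorm.le_norm {p : D → ℝ} (hp : IsCStarSeminorm p) (d : D) : p d ≤ ‖d‖ := by
  rw [← CStarCompletion.norm_of p hp d]
  exact NonUnitalStarAlgHom.norm_apply_le (CStarCompletion.ofHom p hp) d

/-- The values at `a` of all C*-seminorms on `A`. These are exactly the numbers `‖π a‖`, where `π`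
is a `*`-homomorphism of `A` into some C*-algebra (see `mem_seminormValues_iff`). -/
def seminormValues (a : A) : Set ℝ := {t | ∃ p : A → ℝ, IsCStarSeminorm p ∧ t = p a}

theorem mem_seminormValues_iff [StarModule ℂ A] (a : A) (t : ℝ) :
    t ∈ seminormValues a ↔
      ∃ (D : Type u) (_ : CStarAlgebra D) (π : A →⋆ₐ[ℂ] D), t = ‖π a‖ := by
  constructor
  · rintro ⟨p, hp, rfl⟩
    exact ⟨CStarCompletion p hp, inferInstance, CStarCompletion.ofHom p hp,
      (CStarCompletion.norm_of p hp a).symm⟩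
  · rintro ⟨D, _, π, rfl⟩
    exact ⟨_, isCStarSeminorm_comp π, rfl⟩

variable (A) in
/-- `A` has an enveloping C*-algebra: `|a| = sup {‖π a‖}` is finite for every `a`. -/
class HasEnvelopingCStar : Prop where
  bdd : ∀ a : A, BddAbove (seminormValues a)

/-- The maximal C*-seminorm `|a| = sup {‖π a‖}`. -/
noncomputable def maxSeminorm (a : A) : ℝ := sSup (seminormValues a)

theorem seminormValues_nonempty (a : A) : (seminormValues a).Nonempty :=
  ⟨0, fun _ => 0, ⟨by simp, by simp, by simp, by simp⟩, rfl⟩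

theorem le_maxSeminorm [h : HasEnvelopingCStar A] {p : A → ℝ} (hp : IsCStarSeminorm p) (a : A) :
    p a ≤ maxSeminorm a :=
  le_csSup (h.bdd a) ⟨p, hp, rfl⟩

theorem maxSeminorm_le {a : A} {t : ℝ} (h : ∀ p : A → ℝ, IsCStarSeminorm p → p a ≤ t) :
    maxSeminorm a ≤ t :=
  csSup_le (seminormValues_nonempty a) (by rintro _ ⟨p, hp, rfl⟩; exact h p hp)

theorem maxSeminorm_nonneg [HasEnvelopingCStar A] (a : A) : 0 ≤ maxSeminorm a :=
  le_maxSeminorm (p := fun _ => 0) ⟨by simp, by simp, by simp, by simp⟩ a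

variable (A) in
theorem isCStarSeminorm_maxSeminorm [HasEnvelopingCStar A] :
    IsCStarSeminorm (maxSeminorm : A → ℝ) where
  add_le a b := maxSeminorm_le fun p hp =>
    (hp.add_le a b).trans (add_le_add (le_maxSeminorm hp a) (le_maxSeminorm hp b))
  smul c a := by
    have key : ∀ (c : ℂ) (a : A), maxSeminorm (c • a) ≤ ‖c‖ * maxSeminorm a := fun c a =>
      maxSeminorm_le fun p hp => by
        rw [hp.smul]; exact mul_le_mul_of_nonneg_left (le_maxSeminorm hp a) (norm_nonneg c)
    refine le_antisymm (key c a) ?_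
    rcases eq_or_ne c 0 with rfl | hc
    · simpa using maxSeminorm_nonneg _
    · have h := key c⁻¹ (c • a)
      rw [smul_smul, inv_mul_cancel₀ hc, one_smul, norm_inv] at h
      rwa [← le_inv_mul_iff₀ (norm_pos_iff.2 hc)]
  mul_le a b := maxSeminorm_le fun p hp =>
    (hp.mul_le a b).trans (mul_le_mul (le_maxSeminorm hp a) (le_maxSeminorm hp b)
      (hp.nonneg b) (maxSeminorm_nonneg a))
  star_mul_self a := by
    apply le_antisymm
    · refine maxSeminorm_le fun p hp => ?_
      rw [hp.star_mul_self]
      exact mul_le_mul (le_maxSeminorm hp a) (le_maxSeminorm hp a) (hp.nonneg a)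
        (maxSeminorm_nonneg a)
    · have h : maxSeminorm a ≤ √(maxSeminorm (star a * a)) := by
        refine maxSeminorm_le fun p hp => Real.le_sqrt_of_sq_le ?_
        rw [sq, ← hp.star_mul_self]
        exact le_maxSeminorm hp _
      calc maxSeminorm a * maxSeminorm a
          ≤ √(maxSeminorm (star a * a)) * √(maxSeminorm (star a * a)) :=
            mul_le_mul h h (maxSeminorm_nonneg a) (Real.sqrt_nonneg _)
        _ = _ := Real.mul_self_sqrt (maxSeminorm_nonneg _)

variable (A) in
/-- The enveloping C*-algebra `C*(A)`: the separated completion of `A` with respect to the maximal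
C*-seminorm. -/
def Envelope [HasEnvelopingCStar A] : Type u :=
  CStarCompletion (maxSeminorm : A → ℝ) (isCStarSeminorm_maxSeminorm A)

noncomputable instance [HasEnvelopingCStar A] [StarModule ℂ A] : CStarAlgebra (Envelope A) :=
  inferInstanceAs (CStarAlgebra (CStarCompletion (maxSeminorm : A → ℝ) _))

namespace Envelope

variable [HasEnvelopingCStar A] [StarModule ℂ A]

variable (A) in
/-- The universal representation `A → C*(A)`. -/
noncomputable def of : A →⋆ₐ[ℂ] Envelope A :=
  CStarCompletion.ofHom (maxSeminorm : A → ℝ) (isCStarSeminorm_maxSeminorm A)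

theorem norm_of (a : A) : ‖of A a‖ = maxSeminorm a :=
  CStarCompletion.norm_of _ _ a

variable (A) in
theorem denseRange_of : DenseRange (of A) :=
  CStarCompletion.denseRange_of _ (isCStarSeminorm_maxSeminorm A)

theorem norm_apply_le (π : A →⋆ₐ[ℂ] D) (a : A) : ‖π a‖ ≤ ‖of A a‖ := by
  rw [norm_of]; exact le_maxSeminorm (isCStarSeminorm_comp π) a

theorem continuous_hom {E : Type*} [CStarAlgebra E] (f : E →⋆ₐ[ℂ] D) : Continuous f :=
  AddMonoidHomClass.continuous_of_bound f 1 fun x => by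
    simpa using NonUnitalStarAlgHom.norm_apply_le f x

theorem hom_ext {f g : Envelope A →⋆ₐ[ℂ] D} (h : ∀ a, f (of A a) = g (of A a)) : f = g := by
  ext x
  induction x using (denseRange_of A).induction_on with
  | hp => exact isClosed_eq (continuous_hom f) (continuous_hom g)
  | ih a => exact h a

theorem continuous_ofWith (π : A →⋆ₐ[ℂ] D) :
    Continuous fun a : WithCStarSeminorm (maxSeminorm : A → ℝ) (isCStarSeminorm_maxSeminorm A) =>
      π a :=
  AddMonoidHomClass.continuous_of_bound
    (show WithCStarSeminorm (maxSeminorm : A → ℝ) (isCStarSeminorm_maxSeminorm A) →+* D from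
      (π : A →+* D)) 1 fun a => by
    rw [one_mul]; exact le_maxSeminorm (isCStarSeminorm_comp π) a

/-- The ring homomorphism underlying `Envelope.lift`. -/
noncomputable def liftRingHom (π : A →⋆ₐ[ℂ] D) : Envelope A →+* D :=
  UniformSpace.Completion.extensionHom
    (show WithCStarSeminorm (maxSeminorm : A → ℝ) (isCStarSeminorm_maxSeminorm A) →+* D from
      (π : A →+* D)) (continuous_ofWith π)

theorem liftRingHom_of (π : A →⋆ₐ[ℂ] D) (a : A) : liftRingHom π (of A a) = π a :=
  UniformSpace.Completion.extensionHom_coe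
    (show WithCStarSeminorm (maxSeminorm : A → ℝ) (isCStarSeminorm_maxSeminorm A) →+* D from
      (π : A →+* D)) (continuous_ofWith π) a

theorem continuous_liftRingHom (π : A →⋆ₐ[ℂ] D) : Continuous (liftRingHom π) :=
  UniformSpace.Completion.continuous_extension

/-- Every `*`-homomorphism of `A` into a C*-algebra factors through the universal
representation. -/
noncomputable def lift (π : A →⋆ₐ[ℂ] D) : Envelope A →⋆ₐ[ℂ] D where
  toFun := liftRingHom π
  map_one' := map_one _
  map_mul' := map_mul _
  map_zero' := map_zero _
  map_add' := map_add _
  commutes' c := by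
    rw [← AlgHomClass.commutes (of A) c, liftRingHom_of, AlgHomClass.commutes]
  map_star' x := by
    induction x using (denseRange_of A).induction_on with
    | hp =>
      exact isClosed_eq ((continuous_liftRingHom π).comp continuous_star)
        (continuous_star.comp (continuous_liftRingHom π))
    | ih a => rw [← map_star, liftRingHom_of, liftRingHom_of, map_star]

@[simp] theorem lift_of (π : A →⋆ₐ[ℂ] D) (a : A) : lift π (of A a) = π a :=
  liftRingHom_of π a

end Envelope
end Universal

/-! ### The maximal tensor product -/

section MaxTensor

universe w

variable {A A' : Type u} {C C' : Type v} {D : Type w} [CStarAlgebra A] [CStarAlgebra A']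
  [CStarAlgebra C] [CStarAlgebra C'] [CStarAlgebra D]

/-- The `*`-homomorphism `a ↦ a ⊗ 1` into the algebraic tensor product. -/
noncomputable def algInl : A →⋆ₐ[ℂ] A ⊗[ℂ] C where
  toAlgHom := Algebra.TensorProduct.includeLeft
  map_star' a := by simp [TensorProduct.star_tmul]

/-- The `*`-homomorphism `c ↦ 1 ⊗ c` into the algebraic tensor product. -/
noncomputable def algInr : C →⋆ₐ[ℂ] A ⊗[ℂ] C where
  toAlgHom := Algebra.TensorProduct.includeRight
  map_star' a := by simp [TensorProduct.star_tmul]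

theorem algInl_mul_algInr (a : A) (c : C) :
    (algInl a * algInr c : A ⊗[ℂ] C) = a ⊗ₜ c := by
  change (a ⊗ₜ[ℂ] (1 : C)) * ((1 : A) ⊗ₜ[ℂ] c) = _
  simp

instance : HasEnvelopingCStar (A ⊗[ℂ] C) where
  bdd x := by
    suffices h : ∃ M, ∀ p : A ⊗[ℂ] C → ℝ, IsCStarSeminorm p → p x ≤ M by
      obtain ⟨M, hM⟩ := h
      exact ⟨M, by rintro _ ⟨p, hp, rfl⟩; exact hM p hp⟩
    induction x with
    | zero => exact ⟨0, fun p hp => hp.zero.le⟩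
    | add x y hx hy =>
      obtain ⟨M, hM⟩ := hx
      obtain ⟨N, hN⟩ := hy
      exact ⟨M + N, fun p hp => (hp.add_le x y).trans (add_le_add (hM p hp) (hN p hp))⟩
    | tmul a c =>
      refine ⟨‖a‖ * ‖c‖, fun p hp => ?_⟩
      rw [← algInl_mul_algInr]
      exact (hp.mul_le _ _).trans (mul_le_mul ((hp.comp algInl).le_norm a)
        ((hp.comp algInr).le_norm c) (hp.nonneg _) (norm_nonneg _))

variable (A C) in
/-- The maximal tensor product of C*-algebras: the enveloping C*-algebra of the algebraic tensor
product. -/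
def MaxTensor : Type (max u v) := Envelope (A ⊗[ℂ] C)

noncomputable instance : CStarAlgebra (MaxTensor A C) :=
  inferInstanceAs (CStarAlgebra (Envelope (A ⊗[ℂ] C)))

namespace MaxTensor

variable (A C) in
/-- The canonical map from the algebraic to the maximal tensor product. -/
noncomputable def ofAlg : A ⊗[ℂ] C →⋆ₐ[ℂ] MaxTensor A C := Envelope.of (A ⊗[ℂ] C)

variable (C) in
/-- `a ↦ a ⊗ 1`. -/
noncomputable def inl : A →⋆ₐ[ℂ] MaxTensor A C := (ofAlg A C).comp algInl

variable (A) in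
/-- `c ↦ 1 ⊗ c`. -/
noncomputable def inr : C →⋆ₐ[ℂ] MaxTensor A C := (ofAlg A C).comp algInr

/-- The elementary tensor `a ⊗ c`. -/
noncomputable def tmul (a : A) (c : C) : MaxTensor A C := ofAlg A C (a ⊗ₜ c)

theorem tmul_eq (a : A) (c : C) : tmul a c = inl C a * inr A c := by
  rw [tmul, ← algInl_mul_algInr, map_mul]; rfl

theorem inl_eq (a : A) : inl C a = tmul a 1 := rfl

theorem inr_eq (c : C) : inr A c = tmul 1 c := rfl

theorem commute_inl_inr (a : A) (c : C) : Commute (inl C a) (inr A c) := by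
  have h : Commute (algInl a : A ⊗[ℂ] C) (algInr c) := by
    change (a ⊗ₜ[ℂ] (1 : C)) * ((1 : A) ⊗ₜ[ℂ] c) = ((1 : A) ⊗ₜ[ℂ] c) * (a ⊗ₜ[ℂ] (1 : C))
    simp
  exact h.map (ofAlg A C)

theorem tmul_mul_tmul (a a' : A) (c c' : C) :
    tmul a c * tmul a' c' = tmul (a * a') (c * c') := by
  rw [tmul, tmul, tmul, ← map_mul, Algebra.TensorProduct.tmul_mul_tmul]

theorem star_tmul (a : A) (c : C) : star (tmul a c) = tmul (star a) (star c) := by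
  rw [tmul, tmul, ← map_star, TensorProduct.star_tmul]

theorem one_tmul_one : tmul (1 : A) (1 : C) = 1 := by
  rw [tmul, ← Algebra.TensorProduct.one_def, map_one]

theorem induction {P : MaxTensor A C → Prop} (hP : IsClosed {x | P x})
    (add : ∀ x y, P x → P y → P (x + y)) (tmul : ∀ a c, P (tmul a c)) (x) : P x := by
  refine (Envelope.denseRange_of (A ⊗[ℂ] C)).induction_on x hP fun y => ?_
  induction y with
  | zero => simpa [MaxTensor.tmul] using! tmul (0 : A) (0 : C)
  | add y z hy hz => rw [map_add]; exact add _ _ hy hz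
  | tmul a c => exact tmul a c

theorem hom_ext {f g : MaxTensor A C →⋆ₐ[ℂ] D} (hl : ∀ a, f (inl C a) = g (inl C a))
    (hr : ∀ c, f (inr A c) = g (inr A c)) : f = g := by
  ext x
  induction x using induction with
  | hP => exact isClosed_eq (Envelope.continuous_hom f) (Envelope.continuous_hom g)
  | add x y hx hy => rw [map_add, map_add, hx, hy]
  | tmul a c => rw [tmul_eq, map_mul, map_mul, hl, hr]

/-- Commuting `*`-homomorphisms `f`, `g` induce a `*`-homomorphism `a ⊗ c ↦ f a * g c` on the
algebraic tensor product. -/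
noncomputable def algLift (f : A →⋆ₐ[ℂ] D) (g : C →⋆ₐ[ℂ] D) (h : ∀ a c, Commute (f a) (g c)) :
    A ⊗[ℂ] C →⋆ₐ[ℂ] D where
  toAlgHom := Algebra.TensorProduct.lift (f : A →ₐ[ℂ] D) (g : C →ₐ[ℂ] D) h
  map_star' x := by
    change Algebra.TensorProduct.lift (f : A →ₐ[ℂ] D) (g : C →ₐ[ℂ] D) h (star x) =
      star (Algebra.TensorProduct.lift (f : A →ₐ[ℂ] D) (g : C →ₐ[ℂ] D) h x)
    induction x with
    | zero => simp
    | add x y hx hy => simp only [star_add, map_add, hx, hy]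
    | tmul a c =>
      rw [TensorProduct.star_tmul, Algebra.TensorProduct.lift_tmul,
        Algebra.TensorProduct.lift_tmul, star_mul]
      change f (star a) * g (star c) = star (g c) * star (f a)
      rw [map_star, map_star]
      exact ((h a c).star_star)

/-- Commuting `*`-homomorphisms `f`, `g` induce a `*`-homomorphism `a ⊗ c ↦ f a * g c` on the
maximal tensor product. -/
noncomputable def lift (f : A →⋆ₐ[ℂ] D) (g : C →⋆ₐ[ℂ] D) (h : ∀ a c, Commute (f a) (g c)) :
    MaxTensor A C →⋆ₐ[ℂ] D :=
  Envelope.lift (algLift f g h)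

@[simp] theorem lift_tmul (f : A →⋆ₐ[ℂ] D) (g : C →⋆ₐ[ℂ] D) (h : ∀ a c, Commute (f a) (g c))
    (a : A) (c : C) : lift f g h (tmul a c) = f a * g c :=
  (Envelope.lift_of _ _).trans (Algebra.TensorProduct.lift_tmul _ _ h a c)

@[simp] theorem lift_inl (f : A →⋆ₐ[ℂ] D) (g : C →⋆ₐ[ℂ] D) (h : ∀ a c, Commute (f a) (g c))
    (a : A) : lift f g h (inl C a) = f a := by
  rw [inl_eq, lift_tmul, map_one, mul_one]

@[simp] theorem lift_inr (f : A →⋆ₐ[ℂ] D) (g : C →⋆ₐ[ℂ] D) (h : ∀ a c, Commute (f a) (g c))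
    (c : C) : lift f g h (inr A c) = g c := by
  rw [inr_eq, lift_tmul, map_one, one_mul]

theorem commute_of {f : MaxTensor A C →⋆ₐ[ℂ] D} {d : D} (hl : ∀ a, Commute (f (inl C a)) d)
    (hr : ∀ c, Commute (f (inr A c)) d) (x) : Commute (f x) d := by
  induction x using induction with
  | hP =>
    have hf := Envelope.continuous_hom f
    exact isClosed_eq (hf.mul continuous_const) (continuous_const.mul hf)
  | add x y hx hy => rw [map_add]; exact hx.add_left hy
  | tmul a c => rw [tmul_eq, map_mul]; exact (hl a).mul_left (hr c)

theorem commute_comp (f : A →⋆ₐ[ℂ] A') (g : C →⋆ₐ[ℂ] C') (a : A) (c : C) :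
    Commute (((inl C').comp f) a) (((inr A').comp g) c) :=
  commute_inl_inr (f a) (g c)

/-- The `*`-homomorphism `f ⊗ g`. -/
noncomputable def map (f : A →⋆ₐ[ℂ] A') (g : C →⋆ₐ[ℂ] C') : MaxTensor A C →⋆ₐ[ℂ] MaxTensor A' C' :=
  lift ((inl C').comp f) ((inr A').comp g) (commute_comp f g)

@[simp] theorem map_tmul (f : A →⋆ₐ[ℂ] A') (g : C →⋆ₐ[ℂ] C') (a : A) (c : C) :
    map f g (tmul a c) = tmul (f a) (g c) :=
  (lift_tmul _ _ _ a c).trans (tmul_eq _ _).symm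

theorem commute_inl_inr_inl (a : A) (c : C) :
    Commute (inl (MaxTensor C D) a) (((inr A).comp (inl D)) c) :=
  commute_inl_inr a (inl D c)

variable (A C D) in
/-- `a ⊗ c ↦ a ⊗ (c ⊗ 1)`. -/
noncomputable def assocL : MaxTensor A C →⋆ₐ[ℂ] MaxTensor A (MaxTensor C D) :=
  lift (inl (MaxTensor C D)) ((inr A).comp (inl D)) commute_inl_inr_inl

theorem commute_assocL (x : MaxTensor A C) (d : D) :
    Commute (assocL A C D x) (((inr A).comp (inr C)) d) :=
  commute_of (fun a => by rw [assocL, lift_inl]; exact commute_inl_inr a (inr C d))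
    (fun c => by rw [assocL, lift_inr]; exact (commute_inl_inr c d).map (inr A)) x

variable (A C D) in
/-- The associativity map `(a ⊗ c) ⊗ d ↦ a ⊗ (c ⊗ d)`. -/
noncomputable def assoc :
    MaxTensor (MaxTensor A C) D →⋆ₐ[ℂ] MaxTensor A (MaxTensor C D) :=
  lift (assocL A C D) ((inr A).comp (inr C)) commute_assocL

@[simp] theorem assoc_tmul (a : A) (c : C) (d : D) :
    assoc A C D (tmul (tmul a c) d) = tmul a (tmul c d) := by
  rw [assoc, lift_tmul, assocL, lift_tmul, tmul_eq a, tmul_eq c, map_mul, mul_assoc]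
  rfl

end MaxTensor
end MaxTensor

/-! ### Group C*-algebras and crossed products -/

section GroupCStar

variable {Γ : Type u} [Group Γ]

open MonoidAlgebra

/-- The involution of the group algebra, `γ* = γ⁻¹`. -/
noncomputable def groupStar : MonoidAlgebra ℂ Γ →+ MonoidAlgebra ℂ Γ where
  toFun f := f.coeff.sum fun γ c => single γ⁻¹ (star c)
  map_zero' := by simp
  map_add' f g := by
    rw [coeff_add]
    exact Finsupp.sum_add_index' (by simp) (by simp [single_add])

theorem groupStar_single (γ : Γ) (c : ℂ) : groupStar (single γ c) = single γ⁻¹ (star c) := by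
  change (single γ c : MonoidAlgebra ℂ Γ).coeff.sum
    (fun γ c => (single γ⁻¹ (star c) : MonoidAlgebra ℂ Γ)) = _
  rw [coeff_single]
  exact Finsupp.sum_single_index (by simp)

noncomputable instance : StarRing (MonoidAlgebra ℂ Γ) where
  star := groupStar
  star_involutive x := by
    induction x using MonoidAlgebra.induction_linear with
    | zero => simp
    | single γ b => simp [groupStar_single]
    | add f g hf hg => rw [map_add, map_add, hf, hg]
  star_mul x y := by
    change groupStar (x * y) = groupStar y * groupStar x
    induction x using MonoidAlgebra.induction_linear with
    | zero => simp
    | add f g hf hg => rw [add_mul, map_add, map_add, mul_add, hf, hg]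
    | single γ b =>
      induction y using MonoidAlgebra.induction_linear with
      | zero => simp
      | add f g hf hg => rw [mul_add, map_add, map_add, add_mul, hf, hg]
      | single γ' b' =>
        rw [single_mul_single, groupStar_single, groupStar_single, groupStar_single,
          single_mul_single, star_mul, mul_inv_rev]
  star_add := map_add groupStar

theorem groupAlgebra_star_single (γ : Γ) (c : ℂ) :
    star (single γ c : MonoidAlgebra ℂ Γ) = single γ⁻¹ (star c) :=
  groupStar_single γ c

instance : StarModule ℂ (MonoidAlgebra ℂ Γ) where
  star_smul c x := by
    induction x using MonoidAlgebra.induction_linear with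
    | zero => simp
    | add f g hf hg => simp only [smul_add, star_add, hf, hg]
    | single γ b =>
      rw [smul_single, groupAlgebra_star_single, groupAlgebra_star_single, smul_single, star_smul]

theorem IsCStarSeminorm.le_one_of_unitary {A : Type v} [Ring A] [StarRing A] [Algebra ℂ A]
    {p : A → ℝ} (hp : IsCStarSeminorm p) {u : A} (hu : star u * u = 1) : p u ≤ 1 := by
  have h := hp.star_mul_self u
  rw [hu] at h
  nlinarith [hp.one_le, hp.nonneg u]

instance : HasEnvelopingCStar (MonoidAlgebra ℂ Γ) where
  bdd x := by
    suffices h : ∃ M, ∀ p : MonoidAlgebra ℂ Γ → ℝ, IsCStarSeminorm p → p x ≤ M by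
      obtain ⟨M, hM⟩ := h
      exact ⟨M, by rintro _ ⟨p, hp, rfl⟩; exact hM p hp⟩
    induction x using MonoidAlgebra.induction_linear with
    | zero => exact ⟨0, fun p hp => hp.zero.le⟩
    | add x y hx hy =>
      obtain ⟨M, hM⟩ := hx
      obtain ⟨N, hN⟩ := hy
      exact ⟨M + N, fun p hp => (hp.add_le x y).trans (add_le_add (hM p hp) (hN p hp))⟩
    | single γ c =>
      refine ⟨‖c‖ * 1, fun p hp => ?_⟩
      have h : (single γ c : MonoidAlgebra ℂ Γ) = c • single γ 1 := by simp
      rw [h, hp.smul]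
      refine mul_le_mul_of_nonneg_left (hp.le_one_of_unitary ?_) (norm_nonneg c)
      rw [groupAlgebra_star_single, single_mul_single, one_def]
      simp

variable (Γ) in
/-- The full group C*-algebra `C*(Γ)`. -/
abbrev GroupCStar : Type u := Envelope (MonoidAlgebra ℂ Γ)

/-- A unitary representation of `Γ` in a C*-algebra induces a `*`-homomorphism on `C*(Γ)`. -/
noncomputable def GroupCStar.lift {D : Type v} [CStarAlgebra D] (u : Γ →* unitary D) :
    GroupCStar Γ →⋆ₐ[ℂ] D :=
  Envelope.lift
    { toAlgHom := MonoidAlgebra.lift ℂ D Γ ((unitary D).subtype.comp u)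
      map_star' := fun x => by
        change MonoidAlgebra.lift ℂ D Γ ((unitary D).subtype.comp u) (star x) =
          star (MonoidAlgebra.lift ℂ D Γ ((unitary D).subtype.comp u) x)
        induction x using MonoidAlgebra.induction_linear with
        | zero => simp
        | add f g hf hg => simp only [star_add, map_add, hf, hg]
        | single γ c =>
          rw [groupAlgebra_star_single, MonoidAlgebra.lift_single, MonoidAlgebra.lift_single,
            star_smul]
          change star c • ((u γ⁻¹ : unitary D) : D) = star c • star ((u γ : unitary D) : D)
          rw [map_inv]
          rfl }

variable (Γ) in
/-- The canonical unitaries `γ ∈ C*(Γ)`. -/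
noncomputable def GroupCStar.u : Γ →* unitary (GroupCStar Γ) where
  toFun γ := ⟨Envelope.of (MonoidAlgebra ℂ Γ) (single γ 1), by
    rw [Unitary.mem_iff, ← map_star, ← map_mul, ← map_mul, groupAlgebra_star_single,
      single_mul_single, single_mul_single]
    simp [← one_def]⟩
  map_one' := Subtype.ext (by change Envelope.of _ _ = 1; rw [← one_def, map_one])
  map_mul' γ γ' := Subtype.ext (by
    change Envelope.of _ _ = Envelope.of _ _ * Envelope.of _ _
    rw [← map_mul, single_mul_single, mul_one])

theorem GroupCStar.lift_u {D : Type v} [CStarAlgebra D] (w : Γ →* unitary D) (γ : Γ) :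
    GroupCStar.lift w (GroupCStar.u Γ γ : GroupCStar Γ) = w γ := by
  change Envelope.lift _ (Envelope.of _ _) = _
  rw [Envelope.lift_of]
  change MonoidAlgebra.lift ℂ D Γ ((unitary D).subtype.comp w) (single γ 1) = _
  simp

/-- `γ ↦ u γ ⊗ w γ`. -/
noncomputable def unitaryTmul {D : Type v} {E : Type*} [CStarAlgebra D] [CStarAlgebra E]
    (u : Γ →* unitary D) (w : Γ →* unitary E) : Γ →* unitary (MaxTensor D E) where
  toFun γ := ⟨MaxTensor.tmul (u γ : D) (w γ : E), by
    rw [Unitary.mem_iff, MaxTensor.star_tmul, MaxTensor.tmul_mul_tmul, MaxTensor.tmul_mul_tmul]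
    simp [MaxTensor.one_tmul_one]⟩
  map_one' := Subtype.ext (by simp [MaxTensor.one_tmul_one])
  map_mul' γ γ' := Subtype.ext (by simp [MaxTensor.tmul_mul_tmul])

variable (Γ) in
/-- The comultiplication `γ ↦ γ ⊗ γ` of `C*(Γ)`. -/
noncomputable def GroupCStar.comul : GroupCStar Γ →⋆ₐ[ℂ] MaxTensor (GroupCStar Γ) (GroupCStar Γ) :=
  GroupCStar.lift (unitaryTmul (GroupCStar.u Γ) (GroupCStar.u Γ))

end GroupCStar

section Crossed

variable {B : Type v} {Γ : Type u} [Group Γ] [CommCStarAlgebra B]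

variable (B Γ) in
/-- An action of a group by `*`-automorphisms of a commutative C*-algebra. -/
class CStarAction extends MulSemiringAction Γ B, SMulCommClass Γ ℂ B where
  smul_star : ∀ (γ : Γ) (b : B), γ • star b = star (γ • b)

variable [CStarAction B Γ]

open SkewMonoidAlgebra

/-- The involution `(b γ)* = γ⁻¹ b*` of the crossed product. -/
noncomputable def crossedStar : SkewMonoidAlgebra B Γ →+ SkewMonoidAlgebra B Γ where
  toFun f := f.sum fun γ b => single γ⁻¹ (γ⁻¹ • star b)
  map_zero' := sum_zero_index
  map_add' f g := sum_add_index' (by simp) (by simp [single_add])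

theorem crossedStar_single (γ : Γ) (b : B) :
    crossedStar (single γ b) = single γ⁻¹ (γ⁻¹ • star b) := by
  change (single γ b : SkewMonoidAlgebra B Γ).sum
    (fun γ b => (single γ⁻¹ (γ⁻¹ • star b) : SkewMonoidAlgebra B Γ)) = _
  exact sum_single_index (by simp)

noncomputable instance : StarRing (SkewMonoidAlgebra B Γ) where
  star := crossedStar
  star_involutive x := by
    change crossedStar (crossedStar x) = x
    induction x using SkewMonoidAlgebra.induction_on with
    | zero => simp
    | single γ b => simp [crossedStar_single, CStarAction.smul_star]
    | add f g hf hg => rw [map_add, map_add, hf, hg]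
  star_mul x y := by
    change crossedStar (x * y) = crossedStar y * crossedStar x
    induction x using SkewMonoidAlgebra.induction_on with
    | zero => simp
    | add f g hf hg => rw [add_mul, map_add, map_add, mul_add, hf, hg]
    | single γ b =>
      induction y using SkewMonoidAlgebra.induction_on with
      | zero => simp
      | add f g hf hg => rw [mul_add, map_add, map_add, add_mul, hf, hg]
      | single γ' b' =>
        simp only [single_mul_single, crossedStar_single, star_mul, mul_inv_rev, smul_mul',
          ← CStarAction.smul_star, mul_smul, inv_smul_smul]
  star_add := map_add crossedStar

theorem star_single (γ : Γ) (b : B) :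
    star (single γ b : SkewMonoidAlgebra B Γ) = single γ⁻¹ (γ⁻¹ • star b) :=
  crossedStar_single γ b

instance : StarModule ℂ (SkewMonoidAlgebra B Γ) where
  star_smul c x := by
    induction x using SkewMonoidAlgebra.induction_on with
    | zero => simp
    | add f g hf hg => simp only [smul_add, star_add, hf, hg]
    | single γ b =>
      rw [smul_single, star_single, star_single, smul_single, star_smul, smul_comm]

/-- The embedding of `B` in the algebraic crossed product. -/
noncomputable def crossedIncl : B →⋆ₐ[ℂ] SkewMonoidAlgebra B Γ where
  toFun b := single 1 b
  map_one' := rfl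
  map_mul' b b' := by simp [single_mul_single]
  map_zero' := single_zero_right 1
  map_add' := single_add 1
  commutes' _ := rfl
  map_star' b := by rw [star_single]; simp

instance : HasEnvelopingCStar (SkewMonoidAlgebra B Γ) where
  bdd x := by
    suffices h : ∃ M, ∀ p : SkewMonoidAlgebra B Γ → ℝ, IsCStarSeminorm p → p x ≤ M by
      obtain ⟨M, hM⟩ := h
      exact ⟨M, by rintro _ ⟨p, hp, rfl⟩; exact hM p hp⟩
    induction x using SkewMonoidAlgebra.induction_on with
    | zero => exact ⟨0, fun p hp => hp.zero.le⟩
    | add x y hx hy =>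
      obtain ⟨M, hM⟩ := hx
      obtain ⟨N, hN⟩ := hy
      exact ⟨M + N, fun p hp => (hp.add_le x y).trans (add_le_add (hM p hp) (hN p hp))⟩
    | single γ b =>
      refine ⟨‖b‖ * 1, fun p hp => ?_⟩
      have h : (single γ b : SkewMonoidAlgebra B Γ) = crossedIncl b * single γ 1 := by
        change _ = single 1 b * single γ 1
        simp [single_mul_single]
      rw [h]
      refine (hp.mul_le _ _).trans (mul_le_mul ((hp.comp crossedIncl).le_norm b)
        (hp.le_one_of_unitary ?_) (hp.nonneg _) (norm_nonneg _))
      rw [star_single, single_mul_single]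
      simp

variable (B Γ) in
/-- The full crossed product: the enveloping C*-algebra of the algebraic crossed product, in which
`single γ b` is `b γ`. -/
abbrev FullCrossed : Type (max u v) := Envelope (SkewMonoidAlgebra B Γ)

namespace FullCrossed

/-- A covariant representation induces a `*`-homomorphism `b γ ↦ π b * u γ` on the full crossed
product. -/
noncomputable def lift {D : Type*} [CStarAlgebra D] (π : B →⋆ₐ[ℂ] D) (u : Γ →* unitary D)
    (h : ∀ γ b, π (γ • b) * (u γ : D) = u γ * π b) : FullCrossed B Γ →⋆ₐ[ℂ] D :=
  Envelope.lift
    { toAlgHom := SkewMonoidAlgebra.liftNCAlgHom (π : B →ₐ[ℂ] D) ((unitary D).subtype.comp u)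
        fun {b γ} => h γ b
      map_star' := fun x => by
        change SkewMonoidAlgebra.liftNC (π : B →+ D) ((unitary D).subtype.comp u) (star x) =
          star (SkewMonoidAlgebra.liftNC (π : B →+ D) ((unitary D).subtype.comp u) x)
        induction x using SkewMonoidAlgebra.induction_on with
        | zero => simp
        | add f g hf hg => simp only [star_add, map_add, hf, hg]
        | single γ b =>
          rw [star_single, SkewMonoidAlgebra.liftNC_single, SkewMonoidAlgebra.liftNC_single,
            star_mul]
          change π (γ⁻¹ • star b) * (u γ⁻¹ : D) = star (u γ : D) * star (π b)
          rw [h, map_star, map_inv]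
          rfl }

variable (B Γ) in
/-- The canonical map `B → B ⋊ Γ`. -/
noncomputable def incl : B →⋆ₐ[ℂ] FullCrossed B Γ :=
  (Envelope.of (SkewMonoidAlgebra B Γ)).comp crossedIncl

variable (B Γ) in
/-- The canonical unitaries `γ ∈ B ⋊ Γ`. -/
noncomputable def u : Γ →* unitary (FullCrossed B Γ) where
  toFun γ := ⟨Envelope.of (SkewMonoidAlgebra B Γ) (single γ 1), by
    rw [Unitary.mem_iff, ← map_star, ← map_mul, ← map_mul, star_single,
      single_mul_single, single_mul_single]
    simp⟩
  map_one' := Subtype.ext (by change Envelope.of _ _ = 1; rw [← one_def, map_one])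
  map_mul' γ γ' := Subtype.ext (by
    change Envelope.of _ _ = Envelope.of _ _ * Envelope.of _ _
    rw [← map_mul, single_mul_single, smul_one, mul_one])

theorem covariance (γ : Γ) (b : B) :
    incl B Γ (γ • b) * (u B Γ γ : FullCrossed B Γ) = u B Γ γ * incl B Γ b := by
  change Envelope.of _ (single 1 (γ • b)) * Envelope.of _ (single γ 1) =
    Envelope.of _ (single γ 1) * Envelope.of _ (single 1 b)
  rw [← map_mul, ← map_mul, single_mul_single, single_mul_single]
  simp

variable (B Γ) in
/-- The natural map `C*(Γ) → B ⋊ Γ`, `γ ↦ γ`. -/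
noncomputable def ofGroup : GroupCStar Γ →⋆ₐ[ℂ] FullCrossed B Γ := GroupCStar.lift (u B Γ)

variable (B Γ) in
/-- The coaction `b γ ↦ γ ⊗ b γ`. -/
noncomputable def coactL : FullCrossed B Γ →⋆ₐ[ℂ] MaxTensor (GroupCStar Γ) (FullCrossed B Γ) :=
  lift ((MaxTensor.inr (GroupCStar Γ)).comp (incl B Γ)) (unitaryTmul (GroupCStar.u Γ) (u B Γ))
    fun γ b => by
      change MaxTensor.tmul 1 (incl B Γ (γ • b)) * MaxTensor.tmul _ _ =
        MaxTensor.tmul _ _ * MaxTensor.tmul 1 (incl B Γ b)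
      rw [MaxTensor.tmul_mul_tmul, MaxTensor.tmul_mul_tmul, covariance, one_mul, mul_one]

variable (B Γ) in
/-- The coaction `b γ ↦ b γ ⊗ γ`. -/
noncomputable def coactR : FullCrossed B Γ →⋆ₐ[ℂ] MaxTensor (FullCrossed B Γ) (GroupCStar Γ) :=
  lift ((MaxTensor.inl (GroupCStar Γ)).comp (incl B Γ)) (unitaryTmul (u B Γ) (GroupCStar.u Γ))
    fun γ b => by
      change MaxTensor.tmul (incl B Γ (γ • b)) 1 * MaxTensor.tmul _ _ =
        MaxTensor.tmul _ _ * MaxTensor.tmul (incl B Γ b) 1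
      rw [MaxTensor.tmul_mul_tmul, MaxTensor.tmul_mul_tmul, covariance, one_mul, mul_one]

end FullCrossed

end Crossed

/-! ### Quotients of C*-algebras -/

section Quotient

variable {A : Type u} [CStarAlgebra A]

/-- The closed two-sided ideal generated by `S`. -/
def closedIdeal (S : Set A) : Ideal A :=
  sInf {I : Ideal A | I.IsTwoSided ∧ IsClosed (I : Set A) ∧ S ⊆ I}

theorem mem_closedIdeal {S : Set A} {x : A} : x ∈ closedIdeal S ↔
    ∀ I : Ideal A, I.IsTwoSided → IsClosed (I : Set A) → S ⊆ I → x ∈ I := by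
  simp only [closedIdeal, Submodule.mem_sInf, Set.mem_ofPred_eq]
  exact ⟨fun h I h1 h2 h3 => h I ⟨h1, h2, h3⟩, fun h I hI => h I hI.1 hI.2.1 hI.2.2⟩

instance (S : Set A) : (closedIdeal S).IsTwoSided where
  mul_mem_of_left b h := mem_closedIdeal.2 fun I h1 h2 h3 =>
    h1.mul_mem_of_left b (mem_closedIdeal.1 h I h1 h2 h3)

instance (S : Set A) : IsClosed (closedIdeal S : Set A) := by
  have : (closedIdeal S : Set A) =
      ⋂ I ∈ {I : Ideal A | I.IsTwoSided ∧ IsClosed (I : Set A) ∧ S ⊆ I}, (I : Set A) := by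
    rw [closedIdeal, Submodule.coe_sInf]
  rw [this]
  exact isClosed_biInter fun I hI => hI.2.1

/-- Approximate units in ideals. -/
theorem exists_approx (I : Ideal A) [I.IsTwoSided] (a : A) (ha : star a * a ∈ I) {ε : ℝ}
    (hε : 0 < ε) :
    ∃ e ∈ I, star e = e ∧ ‖1 - e‖ ≤ 1 ∧ ‖a * (1 - e)‖ ≤ ε := by
  set h := star a * a with hh
  have hsa : IsSelfAdjoint h := IsSelfAdjoint.star_mul_self a
  let n : ℝ := (ε ^ 2)⁻¹
  have hn : 0 < n := by positivity
  have hspec : ∀ t ∈ spectrum ℝ h, 0 ≤ t := spectrum_star_mul_self_nonneg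
  let g : ℝ → ℝ := fun t => (1 + n * t)⁻¹
  have hg : ContinuousOn g (spectrum ℝ h) := by
    refine ContinuousOn.inv₀ (by fun_prop) fun t ht => ?_
    have := hspec t ht
    positivity
  have hprod : (n • cfc g h) * h = cfc (fun t => n * g t * t) h := by
    rw [cfc_mul (fun t => n * g t) (fun t => t) h, cfc_id' ℝ h, cfc_const_mul n g h]
  have key : 1 - (n • cfc g h) * h = cfc g h := by
    rw [hprod, ← cfc_one ℝ h, ← cfc_sub _ _ h]
    refine cfc_congr fun t ht => ?_
    have h1 := hspec t ht
    have h2 : 1 + n * t ≠ 0 := by positivity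
    simp only [Pi.one_apply, g]
    field_simp
    ring
  have hgsa : IsSelfAdjoint (cfc g h) := cfc_predicate g h
  have hstar : star ((n • cfc g h) * h) = (n • cfc g h) * h := by
    have : (n • cfc g h) * h = 1 - cfc g h := by rw [eq_sub_iff_add_eq', ← eq_sub_iff_add_eq, key]
    rw [this, star_sub, star_one, hgsa.star_eq]
  refine ⟨(n • cfc g h) * h, I.mul_mem_left _ ha, hstar, ?_, ?_⟩
  · rw [key]
    refine norm_cfc_le zero_le_one fun t ht => ?_
    have := hspec t ht
    rw [Real.norm_eq_abs, abs_inv, abs_of_nonneg (by positivity)]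
    exact inv_le_one_of_one_le₀ (by nlinarith [mul_nonneg hn.le this])
  · rw [key]
    have h2 : ‖a * cfc g h‖ * ‖a * cfc g h‖ ≤ ε * ε := by
      rw [← CStarRing.norm_star_mul_self, star_mul, hgsa.star_eq, mul_assoc, ← mul_assoc (star a),
        ← hh]
      have h3 : cfc g h * (h * cfc g h) = cfc (fun t => g t * (t * g t)) h := by
        rw [cfc_mul g (fun t => t * g t) h, cfc_mul (fun t => t) g h, cfc_id' ℝ h]
      rw [h3]
      refine norm_cfc_le (by positivity) fun t ht => ?_
      have h1 := hspec t ht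
      have h4 : 0 < 1 + n * t := by positivity
      have h5 : n * (ε * ε) = 1 := by
        change (ε ^ 2)⁻¹ * (ε * ε) = 1
        field_simp
      rw [Real.norm_eq_abs, abs_of_nonneg (by positivity)]
      change (1 + n * t)⁻¹ * (t * (1 + n * t)⁻¹) ≤ ε * ε
      have h6 : t ≤ (ε * ε) * ((1 + n * t) * (1 + n * t)) := by
        have : t = (ε * ε) * (n * t) := by rw [← mul_assoc, mul_comm (ε * ε), h5, one_mul]
        rw [this]
        refine mul_le_mul_of_nonneg_left ?_ (by positivity)
        rw [← this]
        nlinarith [mul_nonneg hn.le h1]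
      calc (1 + n * t)⁻¹ * (t * (1 + n * t)⁻¹)
          = t / ((1 + n * t) * (1 + n * t)) := by field_simp
        _ ≤ ε * ε := (div_le_iff₀ (by positivity)).2 h6
    exact abs_le_of_sq_le_sq' (by nlinarith) hε.le |>.2

variable (I : Ideal A) [I.IsTwoSided] [IsClosed (I : Set A)]

theorem star_mem_of_isClosed {a : A} (ha : a ∈ I) : star a ∈ I := by
  have hI : IsClosed (I : Set A) := inferInstance
  change star a ∈ (I : Set A)
  rw [← hI.closure_eq, Metric.mem_closure_iff]
  intro ε hε
  obtain ⟨e, he, -, -, h⟩ := exists_approx I (star a)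
    (by rw [star_star]; exact I.mul_mem_right _ ha) (half_pos hε)
  refine ⟨star a * e, I.mul_mem_left _ he, ?_⟩
  rw [dist_eq_norm]
  rw [mul_sub, mul_one] at h
  linarith

noncomputable instance : NormedRing (A ⧸ I) where
  toRing := inferInstance
  __ := (inferInstance : NormedAddCommGroup (A ⧸ I))
  norm_mul_le x y := by
    refine le_of_forall_gt_imp_ge_of_dense fun t ht => ?_
    have hlim : Filter.Tendsto (fun δ : ℝ => (‖x‖ + δ) * (‖y‖ + δ)) (nhdsWithin 0 (Set.Ioi 0))
        (nhds ((‖x‖ + 0) * (‖y‖ + 0))) :=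
      (Continuous.tendsto (by fun_prop) 0).mono_left nhdsWithin_le_nhds
    rw [add_zero, add_zero] at hlim
    obtain ⟨δ, hδ1, hδ2⟩ := ((hlim.eventually_lt_const ht).and self_mem_nhdsWithin).exists
    obtain ⟨a, rfl, ha⟩ := QuotientAddGroup.exists_norm_mk_lt x hδ2
    obtain ⟨b, rfl, hb⟩ := QuotientAddGroup.exists_norm_mk_lt y hδ2
    refine le_trans ?_ hδ1.le
    calc _ ≤ ‖a * b‖ := Submodule.Quotient.norm_mk_le I (a * b)
      _ ≤ ‖a‖ * ‖b‖ := norm_mul_le a b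
      _ ≤ _ := mul_le_mul ha.le hb.le (norm_nonneg b) (add_nonneg (norm_nonneg _) (le_of_lt hδ2))

noncomputable instance : NormedAlgebra ℂ (A ⧸ I) where
  norm_smul_le c x := norm_smul_le c x

noncomputable instance : StarRing (A ⧸ I) where
  star := Quotient.map' star fun a b h => by
    rw [Submodule.quotientRel_def] at h ⊢
    rw [← star_sub]
    exact star_mem_of_isClosed I h
  star_involutive x := by
    obtain ⟨a, rfl⟩ := Ideal.Quotient.mk_surjective x
    exact congrArg (Ideal.Quotient.mk I) (star_star a)
  star_mul x y := by
    obtain ⟨a, rfl⟩ := Ideal.Quotient.mk_surjective x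
    obtain ⟨b, rfl⟩ := Ideal.Quotient.mk_surjective y
    exact congrArg (Ideal.Quotient.mk I) (star_mul a b)
  star_add x y := by
    obtain ⟨a, rfl⟩ := Ideal.Quotient.mk_surjective x
    obtain ⟨b, rfl⟩ := Ideal.Quotient.mk_surjective y
    exact congrArg (Ideal.Quotient.mk I) (star_add a b)

instance : StarModule ℂ (A ⧸ I) where
  star_smul c x := by
    obtain ⟨a, rfl⟩ := Ideal.Quotient.mk_surjective x
    exact congrArg (Ideal.Quotient.mk I) (star_smul c a)

instance : CStarRing (A ⧸ I) where
  norm_mul_self_le x := by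
    obtain ⟨a, rfl⟩ := Ideal.Quotient.mk_surjective x
    refine le_of_forall_pos_le_add fun ε hε => ?_
    obtain ⟨b, hb, hbn⟩ := QuotientAddGroup.exists_norm_mk_lt
      (star (Ideal.Quotient.mk I a) * Ideal.Quotient.mk I a) (half_pos hε)
    have hj : star a * a - b ∈ I := by
      rw [← Ideal.Quotient.eq]
      exact hb.symm
    set j := star a * a - b with hjd
    obtain ⟨e, he, hes, he1, hje⟩ := exists_approx I j (I.mul_mem_left _ hj) (half_pos hε)
    have h1 : ‖Ideal.Quotient.mk I a‖ ≤ ‖a * (1 - e)‖ := by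
      have : Ideal.Quotient.mk I a = Ideal.Quotient.mk I (a * (1 - e)) := by
        rw [Ideal.Quotient.eq, mul_sub, mul_one, sub_sub_cancel]
        exact I.mul_mem_left _ he
      rw [this]
      exact Submodule.Quotient.norm_mk_le I _
    calc ‖Ideal.Quotient.mk I a‖ * ‖Ideal.Quotient.mk I a‖
        ≤ ‖a * (1 - e)‖ * ‖a * (1 - e)‖ := mul_self_le_mul_self (norm_nonneg _) h1
      _ = ‖(1 - e) * ((star a * a) * (1 - e))‖ := by
          rw [← CStarRing.norm_star_mul_self, star_mul, star_sub, star_one, hes]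
          simp only [mul_assoc]
      _ ≤ ‖1 - e‖ * ‖(star a * a) * (1 - e)‖ := norm_mul_le _ _
      _ ≤ ‖(star a * a) * (1 - e)‖ := mul_le_of_le_one_left (norm_nonneg _) he1
      _ = ‖b * (1 - e) + j * (1 - e)‖ := by rw [← add_mul, hjd, add_sub_cancel]
      _ ≤ ‖b‖ * ‖1 - e‖ + ε / 2 :=
          (norm_add_le _ _).trans (add_le_add (norm_mul_le _ _) hje)
      _ ≤ ‖b‖ + ε / 2 :=
          add_le_add_left (mul_le_of_le_one_right (norm_nonneg _) he1) _
      _ ≤ _ := (add_le_add hbn.le le_rfl).trans (by rw [add_assoc, add_halves]; exact le_rfl)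

noncomputable instance : CStarAlgebra (A ⧸ I) where

/-- The quotient map. -/
noncomputable def quotMk : A →⋆ₐ[ℂ] A ⧸ I where
  toAlgHom := Ideal.Quotient.mkₐ ℂ I
  map_star' _ := rfl

end Quotient

/-! ### (ℂ,Γ)-C*-algebras and (B,Γ)-C*-algebras -/

/-- A linear map between C*-algebras is completely positive. -/
def IsCP {A C : Type*} [CStarAlgebra A] [CStarAlgebra C] (φ : A →ₗ[ℂ] C) : Prop :=
  letI := CStarAlgebra.spectralOrder A
  letI := CStarAlgebra.spectralOrder C
  haveI := CStarAlgebra.spectralOrderedRing A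
  haveI := CStarAlgebra.spectralOrderedRing C
  ∃ Φ : CompletelyPositiveMap A C, Φ.toLinearMap = φ

/-- The linear map underlying a `*`-homomorphism. -/
abbrev lin {A C : Type*} [CStarAlgebra A] [CStarAlgebra C] (f : A →⋆ₐ[ℂ] C) : A →ₗ[ℂ] C :=
  f.toAlgHom.toLinearMap

/-- The continuous linear extension `φ ⊗ ψ` of the algebraic tensor product of two linear maps to
the maximal tensor products (it is unique, and it exists for completely positive `φ`, `ψ`). -/
noncomputable def tensorMap {A A' C C' : Type*} [CStarAlgebra A] [CStarAlgebra A']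
    [CStarAlgebra C] [CStarAlgebra C'] (φ : A →ₗ[ℂ] A') (ψ : C →ₗ[ℂ] C') :
    MaxTensor A C →L[ℂ] MaxTensor A' C' :=
  Classical.epsilon fun F => ∀ a c, F (MaxTensor.tmul a c) = MaxTensor.tmul (φ a) (ψ c)

instance {X Y : Type*} [CStarAlgebra X] [CStarAlgebra Y] : Nonempty (X →⋆ₐ[ℂ] MaxTensor Y X) :=
  ⟨MaxTensor.inr Y⟩

instance {X Y : Type*} [CStarAlgebra X] [CStarAlgebra Y] : Nonempty (X →⋆ₐ[ℂ] MaxTensor X Y) :=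
  ⟨MaxTensor.inl Y⟩

/-- The data of a `(ℂ,Γ)`-C*-algebra, without the axioms. -/
structure CGData (Γ : Type u) [Group Γ] where
  carrier : Type u
  [alg : CStarAlgebra carrier]
  δ : carrier →⋆ₐ[ℂ] MaxTensor (GroupCStar Γ) carrier
  δbar : carrier →⋆ₐ[ℂ] MaxTensor carrier (GroupCStar Γ)

attribute [instance] CGData.alg

namespace CGData

variable {Γ : Type u} [Group Γ]

/-- The axioms of a `(ℂ,Γ)`-C*-algebra. -/
structure IsCG (A : CGData Γ) : Prop where
  δ_injective : Function.Injective A.δ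
  δbar_injective : Function.Injective A.δbar
  coassoc : ∀ a, MaxTensor.map (StarAlgHom.id ℂ _) A.δ (A.δ a) =
    MaxTensor.assoc _ _ _ (MaxTensor.map (GroupCStar.comul Γ) (StarAlgHom.id ℂ _) (A.δ a))
  coassoc_bar : ∀ a, MaxTensor.assoc _ _ _ (MaxTensor.map A.δbar (StarAlgHom.id ℂ _) (A.δbar a)) =
    MaxTensor.map (StarAlgHom.id ℂ _) (GroupCStar.comul Γ) (A.δbar a)
  comm : ∀ a, MaxTensor.assoc _ _ _ (MaxTensor.map A.δ (StarAlgHom.id ℂ _) (A.δbar a)) =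
    MaxTensor.map (StarAlgHom.id ℂ _) A.δbar (A.δ a)

/-- The spectral subspaces `A_{γ,γ'}`. -/
def comp (A : CGData Γ) (γ γ' : Γ) : Set A.carrier :=
  {a | A.δ a = MaxTensor.tmul (GroupCStar.u Γ γ : GroupCStar Γ) a ∧
    A.δbar a = MaxTensor.tmul a (GroupCStar.u Γ γ' : GroupCStar Γ)}

variable (Γ) in
/-- `C*(Γ)` with both coactions given by the comultiplication. -/
noncomputable def group : CGData Γ := ⟨GroupCStar Γ, GroupCStar.comul Γ, GroupCStar.comul Γ⟩

/-- The underlying C*-algebra of the cotensor product: the C*-subalgebra of all `x ∈ A ⊗ C` with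
`(δbar_A ⊗ id) x = (id ⊗ δ_C) x`. -/
noncomputable def cotAlg (A C : CGData Γ) : StarSubalgebra ℂ (MaxTensor A.carrier C.carrier) :=
  StarAlgHom.equalizer
    ((MaxTensor.assoc A.carrier (GroupCStar Γ) C.carrier).comp
      (MaxTensor.map A.δbar (StarAlgHom.id ℂ _)))
    (MaxTensor.map (StarAlgHom.id ℂ _) C.δ)

instance (A C : CGData Γ) : IsClosed (cotAlg A C : Set (MaxTensor A.carrier C.carrier)) :=
  isClosed_eq (Envelope.continuous_hom _) (Envelope.continuous_hom _)

/-- The inclusion of the cotensor product in the maximal tensor product. -/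
noncomputable def cotSubtype (A C : CGData Γ) : cotAlg A C →⋆ₐ[ℂ] MaxTensor A.carrier C.carrier :=
  (cotAlg A C).subtype

/-- `f` is the restriction of `δ_A ⊗ id` to the cotensor product. -/
def IsCotδ (A C : CGData Γ) (f : cotAlg A C →⋆ₐ[ℂ] MaxTensor (GroupCStar Γ) (cotAlg A C)) : Prop :=
  ∀ x, MaxTensor.map (StarAlgHom.id ℂ _) (cotSubtype A C) (f x) =
    MaxTensor.assoc _ _ _ (MaxTensor.map A.δ (StarAlgHom.id ℂ _) (cotSubtype A C x))

/-- `f` is the restriction of `id ⊗ δbar_C` to the cotensor product. -/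
def IsCotδbar (A C : CGData Γ) (f : cotAlg A C →⋆ₐ[ℂ] MaxTensor (cotAlg A C) (GroupCStar Γ)) :
    Prop :=
  ∀ x, MaxTensor.assoc _ _ _ (MaxTensor.map (cotSubtype A C) (StarAlgHom.id ℂ _) (f x)) =
    MaxTensor.map (StarAlgHom.id ℂ _) C.δbar (cotSubtype A C x)

/-- The cotensor product. -/
noncomputable def cot (A C : CGData Γ) : CGData Γ where
  carrier := cotAlg A C
  δ := Classical.epsilon (IsCotδ A C)
  δbar := Classical.epsilon (IsCotδbar A C)

/-- The inclusion of the cotensor product in the maximal tensor product. -/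
noncomputable def incl (A C : CGData Γ) :
    (cot A C).carrier →⋆ₐ[ℂ] MaxTensor A.carrier C.carrier :=
  cotSubtype A C

/-- The restriction of `φ ⊗ ψ` to the cotensor products. -/
noncomputable def cotMap (A A' C C' : CGData Γ) (φ : A.carrier →ₗ[ℂ] A'.carrier)
    (ψ : C.carrier →ₗ[ℂ] C'.carrier) : (cot A C).carrier →ₗ[ℂ] (cot A' C').carrier :=
  Classical.epsilon fun F => ∀ x, incl A' C' (F x) = tensorMap φ ψ (incl A C x)

/-- The canonical map from `(A ⊗^Γ C) ⊗^Γ D` to `A ⊗^Γ (C ⊗^Γ D)`: the restriction of the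
associativity map of the maximal tensor product. -/
noncomputable def cotAssoc (A C D : CGData Γ) :
    (cot (cot A C) D).carrier →ₗ[ℂ] (cot A (cot C D)).carrier :=
  Classical.epsilon fun F => ∀ x,
    MaxTensor.map (StarAlgHom.id ℂ _) (incl C D) (incl A (cot C D) (F x)) =
      MaxTensor.assoc _ _ _ (MaxTensor.map (incl A C) (StarAlgHom.id ℂ _) (incl (cot A C) D x))

/-- The coaction `δ_A` as a map from `A` to `C*(Γ) ⊗^Γ A`. -/
noncomputable def toCotL (A : CGData Γ) (hA : A.IsCG) :
    A.carrier →⋆ₐ[ℂ] (cot (group Γ) A).carrier :=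
  StarAlgHom.codRestrict A.δ (cotAlg (group Γ) A) fun a => (hA.coassoc a).symm

/-- The coaction `δbar_A` as a map from `A` to `A ⊗^Γ C*(Γ)`. -/
noncomputable def toCotR (A : CGData Γ) (hA : A.IsCG) :
    A.carrier →⋆ₐ[ℂ] (cot A (group Γ)).carrier :=
  StarAlgHom.codRestrict A.δbar (cotAlg A (group Γ)) fun a => hA.coassoc_bar a

end CGData

theorem nonempty_hom {B X Y : Type*} [CommCStarAlgebra B] [CStarAlgebra X] [CStarAlgebra Y]
    (f : B →⋆ₐ[ℂ] X) (h : Subsingleton X → Subsingleton Y) : Nonempty (B →⋆ₐ[ℂ] Y) := by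
  cases subsingleton_or_nontrivial B with
  | inl hB =>
    have hX : Subsingleton X := by
      rw [← subsingleton_iff_zero_eq_one, ← map_zero f, ← map_one f, Subsingleton.elim (0 : B) 1]
    have hY := h hX
    exact ⟨{ toFun := fun _ => 0
             map_one' := Subsingleton.elim _ _
             map_mul' := fun _ _ => Subsingleton.elim _ _
             map_zero' := Subsingleton.elim _ _
             map_add' := fun _ _ => Subsingleton.elim _ _
             commutes' := fun _ => Subsingleton.elim _ _
             map_star' := fun _ => Subsingleton.elim _ _ }⟩
  | inr hB =>
    obtain ⟨χ⟩ := (inferInstance : Nonempty (WeakDual.characterSpace ℂ B))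
    let g : B →⋆ₐ[ℂ] ℂ :=
      { toAlgHom := WeakDual.CharacterSpace.toAlgHom χ
        map_star' := fun b => map_star χ b }
    exact ⟨(StarAlgHom.ofId ℂ Y).comp g⟩

/-- The data of a `(B,Γ)`-C*-algebra, without the axioms. -/
structure BGData (B Γ : Type u) [CommCStarAlgebra B] [Group Γ] extends CGData Γ where
  r : B →⋆ₐ[ℂ] carrier
  s : B →⋆ₐ[ℂ] carrier

namespace BGData

open CGData

variable {B Γ : Type u} [CommCStarAlgebra B] [Group Γ]

/-- The axioms of a `(B,Γ)`-C*-algebra. -/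
structure IsBG [CStarAction B Γ] (A : BGData B Γ) : Prop extends A.toCGData.IsCG where
  r_mem : ∀ b, A.r b ∈ A.comp 1 1
  s_mem : ∀ b, A.s b ∈ A.comp 1 1
  r_comm_s : ∀ b b', A.r b * A.s b' = A.s b' * A.r b
  mul_r : ∀ γ γ', ∀ a ∈ A.comp γ γ', ∀ b, a * A.r b = A.r (γ • b) * a
  mul_s : ∀ γ γ', ∀ a ∈ A.comp γ γ', ∀ b, a * A.s b = A.s (γ' • b) * a

/-- Morphisms of `(B,Γ)`-C*-algebras. -/
structure IsMor (A C : BGData B Γ) (φ : A.carrier →⋆ₐ[ℂ] C.carrier) : Prop where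
  δ : ∀ a, C.δ (φ a) = MaxTensor.map (StarAlgHom.id ℂ _) φ (A.δ a)
  δbar : ∀ a, C.δbar (φ a) = MaxTensor.map φ (StarAlgHom.id ℂ _) (A.δbar a)
  linear : ∀ b b' a, φ (A.r b * A.s b' * a) = C.r b * C.s b' * φ a

/-- Isomorphisms of `(B,Γ)`-C*-algebras. -/
def IsIso (A C : BGData B Γ) (φ : A.carrier →⋆ₐ[ℂ] C.carrier) : Prop :=
  IsMor A C φ ∧ ∃ ψ : C.carrier →⋆ₐ[ℂ] A.carrier, IsMor C A ψ ∧
    (∀ a, ψ (φ a) = a) ∧ ∀ c, φ (ψ c) = c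

/-- Completely positive maps of `(B,Γ)`-C*-algebras. -/
structure IsCPMor (A C : BGData B Γ) (φ : A.carrier →ₗ[ℂ] C.carrier) : Prop where
  cp : IsCP φ
  δ : ∀ a, C.δ (φ a) = tensorMap LinearMap.id φ (A.δ a)
  δbar : ∀ a, C.δbar (φ a) = tensorMap φ LinearMap.id (A.δbar a)
  linear : ∀ b b' a, φ (A.r b * A.s b' * a) = C.r b * C.s b' * φ a

instance (A C : BGData B Γ) : Nonempty (B →⋆ₐ[ℂ] (CGData.cot A.toCGData C.toCGData).carrier) :=
  nonempty_hom A.r fun h => by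
    rw [← subsingleton_iff_zero_eq_one]
    refine Subtype.ext ?_
    change (0 : MaxTensor A.carrier C.carrier) = 1
    rw [← map_zero (MaxTensor.inl C.carrier), ← map_one (MaxTensor.inl C.carrier),
      Subsingleton.elim (0 : A.carrier) 1]

/-- The cotensor product of `(B,Γ)`-C*-algebras, with `r b = r_A b ⊗ 1` and `s b = 1 ⊗ s_C b`. -/
noncomputable def cot (A C : BGData B Γ) : BGData B Γ where
  toCGData := CGData.cot A.toCGData C.toCGData
  r := Classical.epsilon fun f => ∀ b, incl A.toCGData C.toCGData (f b) = MaxTensor.tmul (A.r b) 1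
  s := Classical.epsilon fun f => ∀ b, incl A.toCGData C.toCGData (f b) = MaxTensor.tmul 1 (C.s b)

/-- The set `t_{A,C}(B)` of all elements `s_A b ⊗ 1 - 1 ⊗ r_C b` of the cotensor product. -/
def tSet (A C : BGData B Γ) : Set (cot A C).carrier :=
  {x | ∃ b : B, incl A.toCGData C.toCGData x =
    MaxTensor.tmul (A.s b) 1 - MaxTensor.tmul 1 (C.r b)}

/-- The quotient of the cotensor product by the closed ideal generated by `t_{A,C}(B)`. -/
abbrev ProdAlg (A C : BGData B Γ) : Type u := (cot A C).carrier ⧸ closedIdeal (tSet A C)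

/-- The quotient map. -/
noncomputable def prodMk (A C : BGData B Γ) : (cot A C).carrier →⋆ₐ[ℂ] ProdAlg A C :=
  quotMk (closedIdeal (tSet A C))

/-- The product of `(B,Γ)`-C*-algebras, with the structure maps induced by those of the cotensor
product. -/
noncomputable def prod (A C : BGData B Γ) : BGData B Γ where
  carrier := ProdAlg A C
  δ := Classical.epsilon fun f => ∀ x,
    f (prodMk A C x) = MaxTensor.map (StarAlgHom.id ℂ _) (prodMk A C) ((cot A C).δ x)
  δbar := Classical.epsilon fun f => ∀ x,
    f (prodMk A C x) = MaxTensor.map (prodMk A C) (StarAlgHom.id ℂ _) ((cot A C).δbar x)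
  r := (prodMk A C).comp (cot A C).r
  s := (prodMk A C).comp (cot A C).s

/-- The quotient map `q_{A,C}` from the cotensor product to the product. -/
noncomputable def q (A C : BGData B Γ) : (cot A C).carrier →⋆ₐ[ℂ] (prod A C).carrier :=
  prodMk A C

/-- The map between products induced by `φ` and `ψ`. -/
noncomputable def prodMap (A A' C C' : BGData B Γ) (φ : A.carrier →ₗ[ℂ] A'.carrier)
    (ψ : C.carrier →ₗ[ℂ] C'.carrier) : (prod A C).carrier →ₗ[ℂ] (prod A' C').carrier :=
  Classical.epsilon fun F => ∀ x, F (q A C x) =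
    q A' C' (cotMap A.toCGData A'.toCGData C.toCGData C'.toCGData φ ψ x)

variable (B Γ) in
/-- The unit object: the full crossed product. -/
noncomputable def unit [CStarAction B Γ] : BGData B Γ where
  carrier := FullCrossed B Γ
  δ := FullCrossed.coactL B Γ
  δbar := FullCrossed.coactR B Γ
  r := FullCrossed.incl B Γ
  s := FullCrossed.incl B Γ

/-- The map `A → (B ⋊ Γ) ⊗^Γ A → (B ⋊ Γ) ⊗~ A`, the composition of `δ_A`, `ι_Γ ⊗^Γ id` and the
quotient map. -/
noncomputable def L [CStarAction B Γ] (A : BGData B Γ) (hA : A.IsBG) :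
    A.carrier →ₗ[ℂ] (prod (unit B Γ) A).carrier :=
  lin (q (unit B Γ) A) ∘ₗ
    cotMap (group Γ) ((unit B Γ).toCGData) A.toCGData A.toCGData
      (lin (FullCrossed.ofGroup B Γ)) LinearMap.id ∘ₗ
    lin (toCotL A.toCGData hA.toIsCG)

/-- The map `A → A ⊗^Γ (B ⋊ Γ) → A ⊗~ (B ⋊ Γ)`, the composition of `δbar_A`, `id ⊗^Γ ι_Γ` and the
quotient map. -/
noncomputable def R [CStarAction B Γ] (A : BGData B Γ) (hA : A.IsBG) :
    A.carrier →ₗ[ℂ] (prod A (unit B Γ)).carrier :=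
  lin (q A (unit B Γ)) ∘ₗ
    cotMap A.toCGData A.toCGData (group Γ) ((unit B Γ).toCGData)
      LinearMap.id (lin (FullCrossed.ofGroup B Γ)) ∘ₗ
    lin (toCotR A.toCGData hA.toIsCG)

/-- `Φ = q ∘ (q_{A,C} ⊗^Γ id)`. -/
noncomputable def Φ (A C D : BGData B Γ) :
    (cot (cot A C) D).carrier →ₗ[ℂ] (prod (prod A C) D).carrier :=
  lin (q (prod A C) D) ∘ₗ
    cotMap ((cot A C).toCGData) ((prod A C).toCGData) D.toCGData D.toCGData (lin (q A C)) LinearMap.id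

/-- `Ψ = q ∘ (id ⊗^Γ q_{C,D})`. -/
noncomputable def Ψ (A C D : BGData B Γ) :
    (cot A (cot C D)).carrier →ₗ[ℂ] (prod A (prod C D)).carrier :=
  lin (q A (prod C D)) ∘ₗ
    cotMap A.toCGData A.toCGData ((cot C D).toCGData) ((prod C D).toCGData) LinearMap.id (lin (q C D))

/-- The canonical isomorphism `a_{A,C,D}` from `(A ⊗^Γ C) ⊗^Γ D` to `A ⊗^Γ (C ⊗^Γ D)`. -/
noncomputable def a (A C D : BGData B Γ) :
    (cot (cot A C) D).carrier →ₗ[ℂ] (cot A (cot C D)).carrier :=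
  cotAssoc A.toCGData C.toCGData D.toCGData

/-- The set `t_{A,C}(B) ⊗ 1_D + t_{A ⊗^Γ C,D}(B)`. -/
def genΦ (A C D : BGData B Γ) : Set (cot (cot A C) D).carrier :=
  {x | ∃ y ∈ tSet A C, ∃ z ∈ tSet (cot A C) D,
    incl (cot A C).toCGData D.toCGData x =
      MaxTensor.tmul y 1 + incl (cot A C).toCGData D.toCGData z}

/-- The set `1_A ⊗ t_{C,D}(B) + t_{A,C ⊗^Γ D}(B)`. -/
def genΨ (A C D : BGData B Γ) : Set (cot A (cot C D)).carrier :=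
  {x | ∃ y ∈ tSet C D, ∃ z ∈ tSet A (cot C D),
    incl A.toCGData (cot C D).toCGData x =
      MaxTensor.tmul 1 y + incl A.toCGData (cot C D).toCGData z}

/-- The cotensor product and the product of `A` and `C` are well defined: the structure maps exist,
are the unique ones with the defining properties, and satisfy the axioms. -/
structure ProdWellDefined [CStarAction B Γ] (A C : BGData B Γ) : Prop where
  cot_δ : IsCotδ A.toCGData C.toCGData (cot A C).δ
  cot_δ_unique : ∀ f, IsCotδ A.toCGData C.toCGData f → f = (cot A C).δ
  cot_δbar : IsCotδbar A.toCGData C.toCGData (cot A C).δbar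
  cot_δbar_unique : ∀ f, IsCotδbar A.toCGData C.toCGData f → f = (cot A C).δbar
  cot_r : ∀ b, incl A.toCGData C.toCGData ((cot A C).r b) = MaxTensor.tmul (A.r b) 1
  cot_s : ∀ b, incl A.toCGData C.toCGData ((cot A C).s b) = MaxTensor.tmul 1 (C.s b)
  cot_isBG : (cot A C).IsBG
  t_mem : ∀ b, MaxTensor.tmul (A.s b) 1 - MaxTensor.tmul 1 (C.r b) ∈
    cotAlg A.toCGData C.toCGData
  prod_isBG : (prod A C).IsBG
  q_isMor : IsMor (cot A C) (prod A C) (q A C)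

/-- The maps `φ ⊗ ψ`, `φ ⊗^Γ ψ` and `φ ⊗~ ψ` have their defining properties, and the latter two are
completely positive maps of `(B,Γ)`-C*-algebras. -/
structure MapWellDefined (A A' C C' : BGData B Γ) (φ : A.carrier →ₗ[ℂ] A'.carrier)
    (ψ : C.carrier →ₗ[ℂ] C'.carrier) : Prop where
  tensor_spec : ∀ a c, tensorMap φ ψ (MaxTensor.tmul a c) = MaxTensor.tmul (φ a) (ψ c)
  cot_spec : ∀ x, incl A'.toCGData C'.toCGData (cotMap A.toCGData A'.toCGData C.toCGData C'.toCGData φ ψ x) =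
    tensorMap φ ψ (incl A.toCGData C.toCGData x)
  cot_isCPMor : IsCPMor (cot A C) (cot A' C') (cotMap A.toCGData A'.toCGData C.toCGData C'.toCGData φ ψ)
  prod_spec : ∀ x, prodMap A A' C C' φ ψ (q A C x) = q A' C' (cotMap A.toCGData A'.toCGData C.toCGData C'.toCGData φ ψ x)
  prod_isCPMor : IsCPMor (prod A C) (prod A' C') (prodMap A A' C C' φ ψ)

end BGData

end DynQG

open DynQG DynQG.BGData

universe u

/-! Everything rests on one completely positive map. The indicator function of the diagonal is
positive definite on `Γ × Γ`, so `γ ⊗ γ' ↦ δ_{γ,γ'}` is a state on `C*(Γ) ⊗ C*(Γ)`, and tensoring it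
with the identity gives a slice map `S` (`exists_slice`). For a left coaction `δ` of `C*(Γ)` on `A`,
put `recon = S (id ⊗ δ)`. Injectivity and coassociativity force the counit identity, whence `recon ∘
δ = id` (`IsCoaction.recon`): a coaction has a completely positive left inverse, and `recon (γ ⊗ a)`
is the spectral component `P_γ a`. It follows that `A` is the closed span of its homogeneous
elements (`IsCG.clspan_homog`). Conversely, the axioms hold as soon as homogeneous elements span a
dense subspace (`isCG_of_clspan`). Amenability of `Γ` plays no role.

The map `(id ⊗ recon)(δbar ⊗ id)` is a completely positive projection of `A ⊗ C` onto the cotensor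
product (`cotProj`). Therefore the cotensor product is the closed span of the tensors `a ⊗ c` with
matching middle degrees (`clspan_of_homog`), and its inclusion remains injective after tensoring
with another algebra (`map_id_incl_injective`), which maximal tensor products do not grant in
general. Structure maps can thus be defined on elementary tensors, and iterated cotensor products
embed in triple tensor products.

If `x = a ⊗ c` has middle degree `γ`, then `x t(b) = t(γ b) x`. Hence the closed ideal generated by
`t(B)` is the closed span of the products `t(b) w` (`closedIdeal_tSet_le`). A completely positive
map of `(B,Γ)`-C*-algebras is not multiplicative, but it is left linear over `r` and `s`, so it
sends `t(b) w` to `t(b)` times the image of `w` and preserves these ideals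
(`mapCot_mem_closedIdeal`).

For the unit, the map `b γ ⊗ a ↦ r(b) P_γ a` (`crossedExp`) vanishes on the ideal and recovers `a`
from the lift of `L a`; so `L` is injective. It is surjective because `b γ ⊗ a` and `γ ⊗ r(b) a`
agree modulo `t(b)`. The right unit follows by flipping. Boundedness of such maps, known only on
algebraic tensor products, comes from `exists_extension`: a positive map on a `*`-algebra of bounded
elements is continuous for the C*-seminorm of an order cone attached to it.

For associativity, exactness of the maximal tensor product, compressed by `cotProj`, computes the
kernel of `q ⊗^Γ id` and so those of `Φ` and `Ψ` (`exists_homΦ`, `exists_homΨ`). Both iterated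
cotensor products have the same image in the triple tensor product, where the two generating sets
coincide as well (`mem_genΦ`, `mem_genΨ`); so the associativity map descends to an isomorphism.
Naturality is checked in the triple tensor product and transferred by surjectivity of `Φ`. -/

namespace DynQG

universe v w

set_option linter.unusedSectionVars false

attribute [local instance] CStarAlgebra.spectralOrder CStarAlgebra.spectralOrderedRing

/-! ### Positive maps on `*`-algebras -/

section Cone

variable {R : Type u} [Ring R] [StarRing R] [Algebra ℂ R]

variable (R) in
/-- The cone of finite sums of hermitian squares. -/
def sumSq : AddSubmonoid R := AddSubmonoid.closure (Set.range fun x : R => star x * x)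

theorem star_mul_self_mem_sumSq (x : R) : star x * x ∈ sumSq R :=
  AddSubmonoid.subset_closure ⟨x, rfl⟩

theorem conj_mem_sumSq {h : R} (hh : h ∈ sumSq R) (x : R) : star x * h * x ∈ sumSq R := by
  induction hh using AddSubmonoid.closure_induction with
  | mem h hh =>
    obtain ⟨y, rfl⟩ := hh
    simpa [mul_assoc] using star_mul_self_mem_sumSq (y * x)
  | zero => simp [zero_mem]
  | add a b _ _ ha hb => rw [mul_add, add_mul]; exact add_mem ha hb

/-- The element `x` is bounded with respect to the cone of sums of hermitian squares. -/
def IsArch (x : R) : Prop := ∃ M : ℝ, 0 ≤ M ∧ (M : ℂ) • (1 : R) - star x * x ∈ sumSq R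

variable [StarModule ℂ R]

theorem star_sqrt_smul (c : ℝ) (x : R) : star ((√c : ℂ) • x) = (√c : ℂ) • star x := by
  rw [star_smul, Complex.star_def, Complex.conj_ofReal]

theorem sqrt_smul_conj {c : ℝ} (hc : 0 ≤ c) (x h : R) :
    star ((√c : ℂ) • x) * h * ((√c : ℂ) • x) = (c : ℂ) • (star x * h * x) := by
  rw [star_sqrt_smul, smul_mul_assoc, smul_mul_assoc, mul_smul_comm, smul_smul,
    ← Complex.ofReal_mul, Real.mul_self_sqrt hc]

theorem smul_mem_sumSq {c : ℝ} (hc : 0 ≤ c) {h : R} (hh : h ∈ sumSq R) :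
    (c : ℂ) • h ∈ sumSq R := by
  have := conj_mem_sumSq hh ((√c : ℂ) • (1 : R))
  rwa [sqrt_smul_conj hc, star_one, one_mul, mul_one] at this

/-- Parallelogram identity: `(x + y)⋆(x + y) + (x - y)⋆(x - y) = 2 x⋆x + 2 y⋆y`, hence the bound `2
(M + N)`. -/
theorem IsArch.add {x y : R} (hx : IsArch x) (hy : IsArch y) : IsArch (x + y) := by
  obtain ⟨M, hM, hx⟩ := hx
  obtain ⟨N, hN, hy⟩ := hy
  refine ⟨2 * (M + N), by positivity, ?_⟩
  have h := add_mem (add_mem (smul_mem_sumSq zero_le_two hx) (smul_mem_sumSq zero_le_two hy))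
    (star_mul_self_mem_sumSq (x - y))
  convert h using 1
  push_cast
  simp only [star_add, star_sub, mul_sub, sub_mul, add_mul, mul_add, smul_sub, mul_smul, add_smul,
    two_smul]
  abel

/-- `M N - y⋆x⋆x y = M (N - y⋆y) + y⋆(M - x⋆x) y`. -/
theorem IsArch.mul {x y : R} (hx : IsArch x) (hy : IsArch y) : IsArch (x * y) := by
  obtain ⟨M, hM, hx⟩ := hx
  obtain ⟨N, hN, hy⟩ := hy
  refine ⟨M * N, by positivity, ?_⟩
  have h := add_mem (smul_mem_sumSq hM hy) (conj_mem_sumSq hx y)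
  convert h using 1
  simp only [star_mul, mul_sub, sub_mul, smul_sub, mul_assoc, Complex.ofReal_mul, mul_smul,
    mul_smul_comm, smul_mul_assoc, mul_one]
  abel

theorem isArch_of_star_mul_self {x : R} (hx : star x * x = 1) : IsArch x :=
  ⟨1, zero_le_one, by simp [hx, zero_mem]⟩

theorem isArch_zero : IsArch (0 : R) := ⟨0, le_rfl, by simp [zero_mem]⟩

theorem IsArch.map {R' : Type v} [Ring R'] [StarRing R'] [Algebra ℂ R'] {x : R} (hx : IsArch x)
    (f : R →⋆ₐ[ℂ] R') : IsArch (f x) := by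
  obtain ⟨M, hM, hx⟩ := hx
  refine ⟨M, hM, ?_⟩
  have : f ((M : ℂ) • 1 - star x * x) = (M : ℂ) • 1 - star (f x) * f x := by
    rw [map_sub, map_mul, map_star, map_smul, map_one]
  rw [← this]
  generalize (M : ℂ) • 1 - star x * x = h at hx
  induction hx using AddSubmonoid.closure_induction with
  | mem h hh =>
    obtain ⟨y, rfl⟩ := hh
    simpa [map_mul, map_star] using star_mul_self_mem_sumSq (f y)
  | zero => simp [zero_mem]
  | add a b _ _ ha hb => rw [map_add]; exact add_mem ha hb

theorem isArch_of_cstar {A : Type v} [CStarAlgebra A] (x : A) : IsArch x := by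
  refine ⟨‖x‖ ^ 2, by positivity, ?_⟩
  have h : star x * x ≤ algebraMap ℝ A (‖x‖ ^ 2) := CStarAlgebra.star_mul_le_algebraMap_norm_sq
  rw [← sub_nonneg, CStarAlgebra.nonneg_iff_eq_star_mul_self] at h
  obtain ⟨b, hb⟩ := h
  have e : algebraMap ℝ A (‖x‖ ^ 2) = ((‖x‖ ^ 2 : ℝ) : ℂ) • (1 : A) := by
    rw [Algebra.algebraMap_eq_smul_one]; exact (Complex.coe_smul _ _).symm
  rw [← e, hb]
  exact star_mul_self_mem_sumSq b

/-- An archimedean cone in a `*`-algebra. -/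
structure IsArchCone (Q : AddSubmonoid R) : Prop where
  sumSq_le : sumSq R ≤ Q
  conj : ∀ h ∈ Q, ∀ x, star x * h * x ∈ Q
  arch : ∀ x : R, ∃ M : ℝ, 0 ≤ M ∧ (M : ℂ) • (1 : R) - star x * x ∈ Q

/-- The seminorm of an archimedean cone. -/
noncomputable def coneNorm (Q : AddSubmonoid R) (z : R) : ℝ :=
  sInf {t : ℝ | 0 ≤ t ∧ ((t ^ 2 : ℝ) : ℂ) • (1 : R) - star z * z ∈ Q}

namespace IsArchCone

variable {Q : AddSubmonoid R} (hQ : IsArchCone Q)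

include hQ

theorem smul {c : ℝ} (hc : 0 ≤ c) {h : R} (hh : h ∈ Q) : (c : ℂ) • h ∈ Q := by
  have := hQ.conj h hh ((√c : ℂ) • (1 : R))
  rwa [sqrt_smul_conj hc, star_one, one_mul, mul_one] at this

theorem sq_mem (x : R) : star x * x ∈ Q := hQ.sumSq_le (star_mul_self_mem_sumSq x)

theorem nonempty (z : R) :
    {t : ℝ | 0 ≤ t ∧ ((t ^ 2 : ℝ) : ℂ) • (1 : R) - star z * z ∈ Q}.Nonempty := by
  obtain ⟨M, hM, h⟩ := hQ.arch z
  exact ⟨√M, Real.sqrt_nonneg _, by rwa [Real.sq_sqrt hM]⟩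

omit hQ [StarModule ℂ R] in
theorem bddBelow (z : R) :
    BddBelow {t : ℝ | 0 ≤ t ∧ ((t ^ 2 : ℝ) : ℂ) • (1 : R) - star z * z ∈ Q} :=
  ⟨0, fun _ h => h.1⟩

omit hQ [StarModule ℂ R] in
theorem coneNorm_nonneg (z : R) : 0 ≤ coneNorm Q z := Real.sInf_nonneg fun _ h => h.1

omit hQ [StarModule ℂ R] in
theorem coneNorm_le {z : R} {t : ℝ} (ht : 0 ≤ t)
    (h : ((t ^ 2 : ℝ) : ℂ) • (1 : R) - star z * z ∈ Q) : coneNorm Q z ≤ t :=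
  csInf_le (bddBelow z) ⟨ht, h⟩

/-- Admissible bounds form an up-set, since `(t² - s²) 1` lies in the cone for `s ≤ t`; so every
number strictly above the infimum is admissible. -/
theorem mem_of_coneNorm_lt {z : R} {t : ℝ} (h : coneNorm Q z < t) :
    ((t ^ 2 : ℝ) : ℂ) • (1 : R) - star z * z ∈ Q := by
  obtain ⟨s, ⟨hs0, hs⟩, hst⟩ := (csInf_lt_iff (bddBelow z) (hQ.nonempty z)).1 h
  have h1 : (0 : ℝ) ≤ t ^ 2 - s ^ 2 := by nlinarith
  have h2 := add_mem hs (hQ.smul h1 (by simpa using hQ.sq_mem 1))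
  convert h2 using 1
  push_cast
  rw [sub_smul]
  abel

/-- For bounds `s` of `z` and `t` of `w`, `s² t² - (z w)⋆(z w) = s² (t² - w⋆w) + w⋆(s² - z⋆z) w`. -/
theorem coneNorm_mul_le (z w : R) : coneNorm Q (z * w) ≤ coneNorm Q z * coneNorm Q w := by
  refine le_mul_of_forall_lt₀ fun s hs t ht => ?_
  have hs0 := (coneNorm_nonneg z).trans_lt hs
  have ht0 := (coneNorm_nonneg w).trans_lt ht
  refine coneNorm_le (by positivity) ?_
  have h := add_mem (hQ.smul (sq_nonneg s) (hQ.mem_of_coneNorm_lt ht))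
    (hQ.conj _ (hQ.mem_of_coneNorm_lt hs) w)
  convert h using 1
  simp only [star_mul, mul_sub, sub_mul, smul_sub, mul_assoc, mul_pow, Complex.ofReal_mul, mul_smul,
    mul_smul_comm, smul_mul_assoc, mul_one]
  abel

theorem coneNorm_add_le (z w : R) : coneNorm Q (z + w) ≤ coneNorm Q z + coneNorm Q w := by
  refine le_of_forall_pos_le_add fun ε hε => ?_
  obtain ⟨s, hs, hs'⟩ : ∃ s, coneNorm Q z < s ∧ s = coneNorm Q z + ε / 2 := ⟨_, by linarith, rfl⟩
  obtain ⟨t, ht, ht'⟩ : ∃ t, coneNorm Q w < t ∧ t = coneNorm Q w + ε / 2 := ⟨_, by linarith, rfl⟩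
  have hs0 := (coneNorm_nonneg z).trans_lt hs
  have ht0 := (coneNorm_nonneg w).trans_lt ht
  refine (coneNorm_le (t := s + t) (by positivity) ?_).trans (by linarith)
  -- These three elements add up to `(s + t)² - (z + w)⋆(z + w)`: the square of `t z - s w` supplies
  -- the cross terms, and the weights `t / s` and `s / t` compensate its diagonal terms.
  have h1 := hQ.smul (c := 1 + t / s) (by positivity) (hQ.mem_of_coneNorm_lt hs)
  have h2 := hQ.smul (c := 1 + s / t) (by positivity) (hQ.mem_of_coneNorm_lt ht)
  have h3 := hQ.smul (c := (s * t)⁻¹) (by positivity) (hQ.sq_mem ((t : ℂ) • z - (s : ℂ) • w))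
  convert add_mem (add_mem h1 h2) h3 using 1
  have hsC : (s : ℂ) ≠ 0 := by exact_mod_cast hs0.ne'
  have htC : (t : ℂ) ≠ 0 := by exact_mod_cast ht0.ne'
  simp only [star_add, star_sub, star_smul, Complex.star_def, Complex.conj_ofReal, mul_sub, sub_mul,
    add_mul, mul_add, smul_sub, smul_smul, smul_mul_assoc, mul_smul_comm]
  push_cast
  match_scalars <;> field_simp <;> ring

theorem coneNorm_smul_le (c : ℂ) (z : R) : coneNorm Q (c • z) ≤ ‖c‖ * coneNorm Q z := by
  refine le_of_forall_pos_le_add fun ε hε => ?_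
  -- The `+ 1` keeps the denominator nonzero when `c = 0`.
  have hδ : 0 < ε / (‖c‖ + 1) := by positivity
  have h := hQ.mem_of_coneNorm_lt (z := z) (t := coneNorm Q z + ε / (‖c‖ + 1)) (by linarith)
  have h0 := coneNorm_nonneg (Q := Q) z
  refine (coneNorm_le (t := ‖c‖ * (coneNorm Q z + ε / (‖c‖ + 1))) (by positivity) ?_).trans ?_
  · convert hQ.smul (sq_nonneg ‖c‖) h using 1
    rw [smul_sub, smul_smul, star_smul, smul_mul_smul_comm, mul_pow, Complex.ofReal_mul,
      Complex.star_def, Complex.conj_mul', Complex.ofReal_pow ‖c‖]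
  · have : ‖c‖ * (ε / (‖c‖ + 1)) ≤ ε := by
      rw [mul_div_assoc', div_le_iff₀ (by positivity)]
      nlinarith [norm_nonneg c]
    linarith

theorem isCStarSeminorm : IsCStarSeminorm (coneNorm Q) where
  add_le := hQ.coneNorm_add_le
  mul_le := hQ.coneNorm_mul_le
  smul c z := by
    refine le_antisymm (hQ.coneNorm_smul_le c z) ?_
    rcases eq_or_ne c 0 with rfl | hc
    · simpa using coneNorm_nonneg _
    · have h := hQ.coneNorm_smul_le c⁻¹ (c • z)
      rw [smul_smul, inv_mul_cancel₀ hc, one_smul, norm_inv] at h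
      rwa [← le_inv_mul_iff₀ (norm_pos_iff.2 hc)]
  star_mul_self z := by
    have key : ∀ z, coneNorm Q z * coneNorm Q z ≤ coneNorm Q (star z * z) := fun z => by
      refine le_of_forall_gt_imp_ge_of_dense fun t ht => ?_
      have ht0 := (coneNorm_nonneg _).trans_lt ht
      have h1 := hQ.mem_of_coneNorm_lt ht
      -- With `h = z⋆z`, the identity `t - h = (2 t)⁻¹ ((t² - h²) + (t - h)²)` puts `t - z⋆z` in the
      -- cone, so `√t` is a bound for `z`.
      have h2 := hQ.sq_mem ((t : ℂ) • 1 - star z * z)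
      have h3 := hQ.smul (c := (2 * t)⁻¹) (by positivity) (add_mem h1 h2)
      have h4 : coneNorm Q z ≤ √t := by
        refine coneNorm_le (Real.sqrt_nonneg _) ?_
        rw [Real.sq_sqrt ht0.le]
        convert h3 using 1
        have htC : (t : ℂ) ≠ 0 := by exact_mod_cast ht0.ne'
        simp only [star_sub, star_smul, star_mul, star_star, star_one, Complex.star_def,
          Complex.conj_ofReal, mul_sub, sub_mul, smul_sub, smul_add, smul_smul, smul_mul_assoc,
          mul_smul_comm, one_mul, mul_one]
        push_cast
        match_scalars <;> field_simp <;> ring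
      calc _ ≤ √t * √t := mul_self_le_mul_self (coneNorm_nonneg z) h4
        _ = t := Real.mul_self_sqrt ht0.le
    have hle : ∀ z, coneNorm Q z ≤ coneNorm Q (star z) := fun z => by
      rcases (coneNorm_nonneg (Q := Q) z).eq_or_lt with h | h
      · rw [← h]; exact coneNorm_nonneg _
      · exact le_of_mul_le_mul_right ((key z).trans (hQ.coneNorm_mul_le _ _)) h
    refine le_antisymm ((hQ.coneNorm_mul_le _ _).trans ?_) (key z)
    exact mul_le_mul_of_nonneg_right (by simpa using hle (star z)) (coneNorm_nonneg z)

end IsArchCone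

end Cone

/-! ### Extending positive maps to a C*-completion -/

section Extension

variable {R : Type u} [Ring R] [StarRing R] [Algebra ℂ R] [StarModule ℂ R]
  {D : Type v} [CStarAlgebra D]

/-- The cone of a positive map. -/
def mapCone (Θ : R →ₗ[ℂ] D) : AddSubmonoid R where
  carrier := {h | ∀ y, 0 ≤ Θ (star y * h * y)}
  zero_mem' y := by simp
  add_mem' {a b} ha hb y := by
    rw [mul_add, add_mul, map_add]; exact add_nonneg (ha y) (hb y)

theorem isArchCone_mapCone (hR : ∀ x : R, IsArch x) {Θ : R →ₗ[ℂ] D}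
    (hΘ : ∀ x, 0 ≤ Θ (star x * x)) : IsArchCone (mapCone Θ) := by
  have hle : sumSq R ≤ mapCone Θ := by
    refine AddSubmonoid.closure_le.2 ?_
    rintro _ ⟨x, rfl⟩ y
    simpa [mul_assoc] using hΘ (x * y)
  refine ⟨hle, fun h hh x y => ?_, fun x => ?_⟩
  · simpa [mul_assoc] using hh (x * y)
  · obtain ⟨M, hM, h⟩ := hR x
    exact ⟨M, hM, hle h⟩

theorem norm_apply_star_mul_self_le (hR : ∀ x : R, IsArch x) {Θ : R →ₗ[ℂ] D}
    (hΘ : ∀ x, 0 ≤ Θ (star x * x)) {z : R} {t : ℝ} (hz : coneNorm (mapCone Θ) z < t) :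
    ‖Θ (star z * z)‖ ≤ t ^ 2 * ‖Θ 1‖ := by
  have h := (isArchCone_mapCone hR hΘ).mem_of_coneNorm_lt hz 1
  rw [star_one, one_mul, mul_one, map_sub, map_smul, sub_nonneg] at h
  refine (CStarAlgebra.norm_le_norm_of_nonneg_of_le (hΘ z) h).trans ?_
  rw [norm_smul, Complex.norm_real, Real.norm_of_nonneg (sq_nonneg t)]

/-- Only hermitian squares are controlled directly; a general `z` is reached by polarizing against
`1`: `4 z` is the sum of `c (c + z)⋆(c + z)` over `c = 1, i, -1, -i`. If `z` has seminorm below `1`,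
each term contributes at most `2² ‖Θ 1‖`, which gives the constant `4`; rescaling does the rest. -/
theorem norm_apply_le_coneNorm (hR : ∀ x : R, IsArch x) {Θ : R →ₗ[ℂ] D}
    (hΘ : ∀ x, 0 ≤ Θ (star x * x)) (z : R) :
    ‖Θ z‖ ≤ 4 * ‖Θ 1‖ * coneNorm (mapCone Θ) z := by
  have hQ := isArchCone_mapCone hR hΘ
  have hp := hQ.isCStarSeminorm
  have h1 : ∀ z, coneNorm (mapCone Θ) z < 1 → ‖Θ z‖ ≤ 4 * ‖Θ 1‖ := fun z hz => by
    have h2 : ∀ c : ℂ, ‖c‖ = 1 → ‖Θ (star (c • 1 + z) * (c • 1 + z))‖ ≤ 2 ^ 2 * ‖Θ 1‖ :=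
      fun c hc => by
        refine norm_apply_star_mul_self_le hR hΘ ?_
        have h3 := hp.add_le (c • 1) z
        rw [hp.smul, hc, one_mul] at h3
        linarith [hp.one_le]
    have e : (4 : ℂ) • z = star ((1 : ℂ) • 1 + z) * ((1 : ℂ) • 1 + z)
        + Complex.I • (star (Complex.I • 1 + z) * (Complex.I • 1 + z))
        - (star ((-1 : ℂ) • 1 + z) * ((-1 : ℂ) • 1 + z))
        - Complex.I • (star ((-Complex.I) • 1 + z) * ((-Complex.I) • 1 + z)) := by
      simp only [star_add, star_smul, star_one, add_mul, mul_add, smul_add, smul_smul,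
        smul_mul_assoc, mul_smul_comm, one_mul, mul_one, Complex.star_def, Complex.conj_I,
        map_neg, map_one]
      match_scalars <;> simp [Complex.I_mul_I] <;> ring_nf
    have h4 : ‖(4 : ℂ) • Θ z‖ ≤ 4 * (2 ^ 2 * ‖Θ 1‖) := by
      rw [← map_smul, e, map_sub, map_sub, map_add, map_smul, map_smul]
      refine (norm_sub_le _ _).trans ?_
      refine (add_le_add_left (norm_sub_le _ _) _).trans ?_
      refine (add_le_add_left (add_le_add_left (norm_add_le _ _) _) _).trans ?_
      rw [norm_smul, norm_smul, Complex.norm_I, one_mul, one_mul]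
      linarith [h2 1 (by simp), h2 Complex.I (by simp), h2 (-1) (by simp), h2 (-Complex.I) (by simp)]
    rw [norm_smul] at h4
    norm_num at h4
    linarith
  refine le_of_forall_pos_le_add fun ε hε => ?_
  obtain ⟨δ, hδ, hδε⟩ : ∃ δ > 0, 4 * ‖Θ 1‖ * δ ≤ ε := by
    refine ⟨ε / (4 * ‖Θ 1‖ + 1), by positivity, ?_⟩
    rw [mul_div_assoc', div_le_iff₀ (by positivity)]
    nlinarith [norm_nonneg (Θ 1)]
  set t := coneNorm (mapCone Θ) z + δ with ht
  have ht0 : 0 < t := by linarith [hp.nonneg z]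
  have h5 := h1 (((t⁻¹ : ℝ) : ℂ) • z) (by
    rw [hp.smul, Complex.norm_real, Real.norm_of_nonneg (by positivity), inv_mul_lt_iff₀ ht0]
    linarith)
  rw [map_smul, norm_smul, Complex.norm_real, Real.norm_of_nonneg (by positivity),
    inv_mul_le_iff₀ ht0] at h5
  linarith

/-- A positive linear map on a `*`-algebra that is spanned by bounded elements factors through a
C*-algebra. -/
theorem exists_extension (hR : ∀ x : R, IsArch x) (Θ : R →ₗ[ℂ] D)
    (hΘ : ∀ x, 0 ≤ Θ (star x * x)) :
    ∃ (E : Type u) (_ : CStarAlgebra E) (j : R →⋆ₐ[ℂ] E) (F : E →L[ℂ] D), ∀ x, F (j x) = Θ x := by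
  have hp := (isArchCone_mapCone hR hΘ).isCStarSeminorm
  -- The C*-seminorm is the one of the cone attached to `Θ` itself, so that `Θ` is bounded for it
  -- and extends to the completion.
  let T : WithCStarSeminorm _ hp →L[ℂ] D := LinearMap.mkContinuous
    (show WithCStarSeminorm _ hp →ₗ[ℂ] D from Θ) (4 * ‖Θ 1‖) (norm_apply_le_coneNorm hR hΘ)
  let e : WithCStarSeminorm _ hp →L[ℂ] UniformSpace.Completion (WithCStarSeminorm _ hp) :=
    UniformSpace.Completion.toComplL
  refine ⟨CStarCompletion _ hp, inferInstance, CStarCompletion.ofHom _ hp, ?_, ?_⟩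
  · exact T.extend e
  · exact T.extend_eq UniformSpace.Completion.denseRange_coe
      (UniformSpace.Completion.isUniformInducing_coe _)

end Extension

/-! ### Completely positive maps -/

section Positivity

variable {A : Type u} [CStarAlgebra A]

/-- Because `h⁻ h⁺ = 0`, compressing `h` by its negative part leaves a negative element. If the
compression is known to be positive too, `h⁻` must vanish; this is the positivity test used below.
-/
theorem negPart_conj {h : A} (hh : IsSelfAdjoint h) : h⁻ * h * h⁻ = -(h⁻ * h⁻ * h⁻) := by
  nth_rw 2 [← CFC.posPart_sub_negPart h hh]
  rw [mul_sub, CFC.negPart_mul_posPart, zero_sub, neg_mul]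

theorem nonneg_of_negPart_cube {h : A} (hh : IsSelfAdjoint h) (h0 : h⁻ * h⁻ * h⁻ = 0) : 0 ≤ h := by
  have hn : IsSelfAdjoint h⁻ := (CFC.negPart_nonneg h).isSelfAdjoint
  have h2 : h⁻ * h⁻ = 0 := by
    rw [← CStarRing.star_mul_self_eq_zero_iff, star_mul, hn.star_eq, ← mul_assoc, h0, zero_mul]
  have h1 : h⁻ = 0 := by
    rw [← CStarRing.star_mul_self_eq_zero_iff, hn.star_eq, h2]
  rw [← CFC.posPart_sub_negPart h hh, h1, sub_zero]
  exact CFC.posPart_nonneg h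

theorem exists_negPart {h : A} (hh : IsSelfAdjoint h) :
    ∃ m : A, star m = m ∧ m * h * m = -(m * m * m) ∧ (∃ y, m * m * m = star y * y) ∧
      (m * m * m = 0 → 0 ≤ h) := by
  have hn := CFC.negPart_nonneg h
  refine ⟨h⁻, hn.isSelfAdjoint, negPart_conj hh, ?_, nonneg_of_negPart_cube hh⟩
  rw [← CStarAlgebra.nonneg_iff_eq_star_mul_self]
  nth_rw 1 [← hn.isSelfAdjoint.star_eq]
  exact star_left_conjugate_nonneg hn _

theorem exists_star_mul_self {h : A} (hh : 0 ≤ h) : ∃ y, h = star y * y :=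
  CStarAlgebra.nonneg_iff_eq_star_mul_self.1 hh

/-- An injective `*`-homomorphism reflects positivity. -/
theorem nonneg_of_map_nonneg {C : Type v} [CStarAlgebra C] {f : A →⋆ₐ[ℂ] C}
    (hf : Function.Injective f) {h : A} (hh : 0 ≤ f h) : 0 ≤ h := by
  have hsa : IsSelfAdjoint h := hf (by rw [map_star, hh.isSelfAdjoint.star_eq])
  have hn : IsSelfAdjoint h⁻ := (CFC.negPart_nonneg h).isSelfAdjoint
  refine nonneg_of_negPart_cube hsa (hf ?_)
  rw [map_zero]
  refine le_antisymm ?_ ?_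
  · rw [← neg_nonneg, ← map_neg, ← negPart_conj hsa, map_mul, map_mul]
    nth_rw 1 [← hn.star_eq]
    rw [map_star]
    exact star_left_conjugate_nonneg hh _
  · refine map_nonneg f ?_
    nth_rw 1 [← hn.star_eq]
    exact star_left_conjugate_nonneg (CFC.negPart_nonneg h) _

theorem eq_zero_of_sum_star_mul_self {ι : Type*} [Fintype ι] {y : ι → A}
    (h : ∑ k, star (y k) * y k ≤ 0) (k : ι) : y k = 0 := by
  have h1 : ∑ k, star (y k) * y k = 0 :=
    le_antisymm h (Finset.sum_nonneg fun k _ => star_mul_self_nonneg _)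
  rw [Finset.sum_eq_zero_iff_of_nonneg fun k _ => star_mul_self_nonneg _] at h1
  exact (CStarRing.star_mul_self_eq_zero_iff _).1 (h1 k (Finset.mem_univ k))

end Positivity

/-! ### Positive matrices over a C*-algebra -/

section MatrixPos

variable {n : ℕ} {D : Type v} [CStarAlgebra D]

theorem conj_apply (X M : CStarMatrix (Fin n) (Fin n) D) (j : Fin n) :
    (star X * M * X) j j = ∑ i, ∑ k, star (X i j) * M i k * X k j := by
  simp only [CStarMatrix.mul_apply, CStarMatrix.star_apply, Finset.sum_mul]
  exact Finset.sum_comm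

theorem matrix_sum_sq {M : CStarMatrix (Fin n) (Fin n) D} (hM : 0 ≤ M) :
    ∃ b : Fin n → Fin n → D, ∀ i j, M i j = ∑ k, star (b k i) * b k j := by
  obtain ⟨N, rfl⟩ := exists_star_mul_self hM
  exact ⟨N, fun i j => by simp [CStarMatrix.mul_apply, CStarMatrix.star_apply]⟩

/-- The columns of the negative part `N` of `M` serve as test vectors. The hypothesis makes the
diagonal of `N M N` positive, while `N M N = -N³ = -Y⋆Y` has diagonal entries `-∑ k, (Y k j)⋆ (Y k
j)`. So `Y = 0`, and `M` has no negative part. -/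
theorem matrix_nonneg_of_isSelfAdjoint {M : CStarMatrix (Fin n) (Fin n) D} (hM : IsSelfAdjoint M)
    (h : ∀ d : Fin n → D, 0 ≤ ∑ i, ∑ j, star (d i) * M i j * d j) : 0 ≤ M := by
  obtain ⟨N, hN, hNM, ⟨Y, hY⟩, h0⟩ := exists_negPart hM
  refine h0 ?_
  have hY0 : Y = 0 := by
    ext k j
    refine eq_zero_of_sum_star_mul_self (y := fun k => Y k j) ?_ k
    have h1 : ∑ k, star (Y k j) * Y k j = (N * N * N) j j := by
      rw [hY]; simp [CStarMatrix.mul_apply, CStarMatrix.star_apply]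
    have h2 := h fun i => N i j
    rw [← conj_apply, hN, hNM, CStarMatrix.neg_apply] at h2
    rw [h1]
    exact neg_nonneg.1 h2
  rw [hY, hY0, mul_zero]

/-- Positive values of the form are self-adjoint, so the form of `M - M⋆` vanishes. Then `i (M -
M⋆)` and its negative are self-adjoint with zero form, hence both positive, hence zero;
self-adjointness of `M` is automatic. -/
theorem matrix_nonneg {M : CStarMatrix (Fin n) (Fin n) D}
    (h : ∀ d : Fin n → D, 0 ≤ ∑ i, ∑ j, star (d i) * M i j * d j) : 0 ≤ M := by
  refine matrix_nonneg_of_isSelfAdjoint ?_ h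
  have h0 : ∀ d : Fin n → D, ∑ i, ∑ j, star (d i) * (M - star M) i j * d j = 0 := fun d => by
    have e := (h d).isSelfAdjoint.star_eq
    simp only [star_sum, star_mul, star_star] at e
    rw [Finset.sum_comm] at e
    simp only [CStarMatrix.sub_apply, CStarMatrix.star_apply, mul_sub, sub_mul,
      Finset.sum_sub_distrib, ← mul_assoc] at e ⊢
    rw [e, sub_self]
  have hsa : IsSelfAdjoint (Complex.I • (M - star M)) := by
    rw [IsSelfAdjoint, star_smul, star_sub, star_star, Complex.star_def, Complex.conj_I, neg_smul,
      ← smul_neg, neg_sub]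
  have h1 : 0 ≤ Complex.I • (M - star M) := by
    refine matrix_nonneg_of_isSelfAdjoint hsa fun d => ?_
    simp only [CStarMatrix.smul_apply, mul_smul_comm, smul_mul_assoc, ← Finset.smul_sum, h0]
    simp
  have h2 : 0 ≤ -(Complex.I • (M - star M)) := by
    refine matrix_nonneg_of_isSelfAdjoint hsa.neg fun d => ?_
    simp only [CStarMatrix.neg_apply, CStarMatrix.smul_apply, mul_smul_comm, smul_mul_assoc,
      mul_neg, neg_mul, Finset.sum_neg_distrib, ← Finset.smul_sum, h0]
    simp
  have h3 : Complex.I • (M - star M) = 0 := le_antisymm (neg_nonneg.1 h2) h1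
  rw [smul_eq_zero_iff_right Complex.I_ne_zero, sub_eq_zero] at h3
  exact h3.symm

end MatrixPos

/-! ### Complete positivity through Gram matrices -/

section CP

/-- Complete positivity for linear maps from a `*`-algebra to a C*-algebra. -/
def IsCPAlg {R : Type u} [Ring R] [StarRing R] [Algebra ℂ R] {D : Type v} [CStarAlgebra D]
    (Θ : R →ₗ[ℂ] D) : Prop :=
  ∀ (n : ℕ) (x : Fin n → R) (d : Fin n → D),
    0 ≤ ∑ i, ∑ j, star (d i) * Θ (star (x i) * x j) * d j

variable {R : Type u} [Ring R] [StarRing R] [Algebra ℂ R] {D : Type v} [CStarAlgebra D]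
  {A : Type*} {C : Type*} [CStarAlgebra A] [CStarAlgebra C]

theorem IsCPAlg.nonneg {Θ : R →ₗ[ℂ] D} (h : IsCPAlg Θ) (x : R) : 0 ≤ Θ (star x * x) := by
  simpa using h 1 (fun _ => x) fun _ => 1

/-- The positive matrix `Θ (x i⋆ x j)` factors as `b⋆ b`. Unlike the inequality defining complete
positivity, such a factorization passes directly to tensor products of maps and to images under
`*`-homomorphisms. -/
theorem IsCPAlg.sum_sq {Θ : R →ₗ[ℂ] D} (h : IsCPAlg Θ) {ι : Type*} [Fintype ι] (x : ι → R) :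
    ∃ (n : ℕ) (b : Fin n → ι → D), ∀ i j,
      Θ (star (x i) * x j) = ∑ k, star (b k i) * b k j := by
  let e := Fintype.equivFin ι
  obtain ⟨b, hb⟩ := matrix_sum_sq (M := CStarMatrix.ofMatrix (Matrix.of fun i j =>
    Θ (star (x (e.symm i)) * x (e.symm j)))) (matrix_nonneg fun d => h _ (fun i => x (e.symm i)) d)
  exact ⟨_, fun k i => b k (e i), fun i j => by simpa using hb (e i) (e j)⟩

theorem nonneg_of_sum_sq {ι κ : Type*} [Fintype ι] [Fintype κ] {T : ι → ι → D} {b : κ → ι → D}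
    (h : ∀ i j, T i j = ∑ k, star (b k i) * b k j) (d : ι → D) :
    0 ≤ ∑ i, ∑ j, star (d i) * T i j * d j := by
  have e : ∑ i, ∑ j, star (d i) * T i j * d j =
      ∑ k, star (∑ i, b k i * d i) * ∑ i, b k i * d i := by
    simp only [h, star_sum, star_mul, Finset.sum_mul, Finset.mul_sum, mul_assoc]
    rw [Finset.sum_comm]
    refine (Finset.sum_congr rfl fun i _ => Finset.sum_comm).trans ?_
    rw [Finset.sum_comm]
  rw [e]
  exact Finset.sum_nonneg fun k _ => star_mul_self_nonneg _

/-- Matrices of the form `(x i⋆ x j)` are positive, and every positive matrix `N⋆N` is a sum of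
matrices of this form, one for each row of `N`; so these suffice as tests. -/
theorem isCP_iff {φ : A →ₗ[ℂ] C} : IsCP φ ↔ IsCPAlg φ := by
  constructor
  · rintro ⟨Φ, rfl⟩ n x d
    have h0 : 0 ≤ (CStarMatrix.ofMatrix (Matrix.of fun i j => star (x i) * x j) :
        CStarMatrix (Fin n) (Fin n) A) := by
      refine matrix_nonneg fun d => ?_
      exact nonneg_of_sum_sq (κ := Unit) (b := fun _ i => x i) (fun i j => by simp) d
    obtain ⟨b, hb⟩ := matrix_sum_sq (Φ.map_cstarMatrix_nonneg' n _ h0)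
    exact nonneg_of_sum_sq (fun i j => by simpa using hb i j) d
  · intro h
    refine ⟨⟨φ, fun k M hM => ?_⟩, rfl⟩
    obtain ⟨b, hb⟩ := matrix_sum_sq hM
    refine matrix_nonneg fun d => ?_
    have e : ∑ i, ∑ j, star (d i) * (M.map φ) i j * d j =
        ∑ l, ∑ i, ∑ j, star (d i) * φ (star (b l i) * b l j) * d j := by
      simp only [CStarMatrix.map_apply, hb, map_sum, Finset.mul_sum, Finset.sum_mul]
      refine (Finset.sum_congr rfl fun i _ => Finset.sum_comm).trans ?_
      rw [Finset.sum_comm]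
    exact e ▸ Finset.sum_nonneg fun l _ => h k (b l) d

theorem IsCPAlg.of_hom (f : R →⋆ₐ[ℂ] D) : IsCPAlg f.toAlgHom.toLinearMap := fun n x d =>
  nonneg_of_sum_sq (κ := Unit) (b := fun _ i => f (x i))
    (fun i j => by simp [map_mul, map_star]) d

theorem isCP_lin (f : A →⋆ₐ[ℂ] C) : IsCP (lin f) := isCP_iff.2 (.of_hom f)

theorem isCP_id : IsCP (LinearMap.id : A →ₗ[ℂ] A) := isCP_lin (StarAlgHom.id ℂ A)

theorem IsCP.comp {E : Type*} [CStarAlgebra E] {φ : A →ₗ[ℂ] C} {ψ : C →ₗ[ℂ] E} (hψ : IsCP ψ)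
    (hφ : IsCP φ) : IsCP (ψ ∘ₗ φ) := by
  obtain ⟨Φ, rfl⟩ := hφ
  obtain ⟨Ψ, rfl⟩ := hψ
  exact ⟨⟨Ψ.toLinearMap ∘ₗ Φ.toLinearMap, fun k M hM => Ψ.map_cstarMatrix_nonneg' k _ (Φ.map_cstarMatrix_nonneg' k M hM)⟩, rfl⟩

/-- A completely positive map descends to a quotient. -/
theorem IsCP.of_surjective {A' C' : Type*} [CStarAlgebra A'] [CStarAlgebra C'] {φ : A →ₗ[ℂ] C}
    (hφ : IsCP φ) {π : A →⋆ₐ[ℂ] A'} (hπ : Function.Surjective π) (ρ : C →⋆ₐ[ℂ] C')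
    {F : A' →ₗ[ℂ] C'} (h : ∀ x, F (π x) = ρ (φ x)) : IsCP F := by
  refine isCP_iff.2 fun n x d => ?_
  choose y hy using fun i => hπ (x i)
  obtain ⟨m, b, hb⟩ := (isCP_iff.1 hφ).sum_sq y
  refine nonneg_of_sum_sq (b := fun k i => ρ (b k i)) (fun i j => ?_) d
  rw [← hy i, ← hy j, ← map_star, ← map_mul, h, hb, map_sum]
  simp [map_mul, map_star]

/-- A completely positive map restricts to a C*-subalgebra. -/
theorem IsCP.of_injective {A' C' : Type*} [CStarAlgebra A'] [CStarAlgebra C'] {φ : A →ₗ[ℂ] C}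
    (hφ : IsCP φ) {ρ : C' →⋆ₐ[ℂ] C} (hρ : Function.Injective ρ) (π : A' →⋆ₐ[ℂ] A)
    {F : A' →ₗ[ℂ] C'} (h : ∀ x, ρ (F x) = φ (π x)) : IsCP F := by
  refine isCP_iff.2 fun n x d => nonneg_of_map_nonneg hρ ?_
  simpa [map_sum, map_mul, map_star, h] using
    isCP_iff.1 hφ n (fun i => π (x i)) fun i => ρ (d i)

theorem IsCP.continuous {φ : A →ₗ[ℂ] C} (h : IsCP φ) : Continuous φ := by
  obtain ⟨Φ, rfl⟩ := h
  let P : A →ₚ[ℂ] C := PositiveLinearMap.ofClass Φ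
  obtain ⟨K, hK⟩ := P.exists_norm_apply_le
  exact AddMonoidHomClass.continuous_of_bound Φ.toLinearMap K hK

/-- Complete positivity extends from a dense `*`-subalgebra. -/
theorem isCP_of_dense {j : R →⋆ₐ[ℂ] A} (hj : DenseRange j) {F : A →L[ℂ] D}
    (h : IsCPAlg ((F : A →ₗ[ℂ] D) ∘ₗ j.toAlgHom.toLinearMap)) : IsCP (F : A →ₗ[ℂ] D) := by
  refine isCP_iff.2 fun n x d => ?_
  have hd : DenseRange (Pi.map fun _ : Fin n => (j : R → A)) := DenseRange.piMap fun _ => hj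
  refine hd.induction_on x ?_ fun y => ?_
  · refine isClosed_le continuous_const ?_
    simp only [ContinuousLinearMap.coe_coe]
    fun_prop
  · simpa [map_mul, map_star] using h n y d

end CP

/-! ### Closed linear spans and `*`-homomorphisms -/

section ClosedSpan

variable {X : Type*} {Y : Type*} [NormedAddCommGroup X] [NormedSpace ℂ X] [NormedAddCommGroup Y]
  [NormedSpace ℂ Y]

/-- The closed linear span. -/
abbrev clspan (S : Set X) : Submodule ℂ X := (Submodule.span ℂ S).topologicalClosure

theorem subset_clspan {S : Set X} {x : X} (hx : x ∈ S) : x ∈ clspan S :=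
  Submodule.le_topologicalClosure _ (Submodule.subset_span hx)

theorem clspan_le {S : Set X} {K : Submodule ℂ X} (hK : IsClosed (K : Set X)) (h : S ⊆ K) :
    clspan S ≤ K :=
  Submodule.topologicalClosure_minimal _ (Submodule.span_le.2 h) hK

theorem isClosed_clspan (S : Set X) : IsClosed (clspan S : Set X) :=
  Submodule.isClosed_topologicalClosure _

theorem clspan_mono {S T : Set X} (h : S ⊆ T) : clspan S ≤ clspan T :=
  clspan_le (isClosed_clspan T) fun _ hx => subset_clspan (h hx)

theorem map_mem_of_mem_clspan {S : Set X} {K : Submodule ℂ Y} (hK : IsClosed (K : Set Y))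
    (f : X →L[ℂ] Y) (h : ∀ s ∈ S, f s ∈ K) {x : X} (hx : x ∈ clspan S) : f x ∈ K :=
  clspan_le (K := K.comap (f : X →ₗ[ℂ] Y)) (hK.preimage f.continuous) h hx

theorem map_mem_clspan {S : Set X} (T : Set Y) (f : X →L[ℂ] Y) (h : ∀ s ∈ S, f s ∈ clspan T)
    {x : X} (hx : x ∈ clspan S) : f x ∈ clspan T :=
  map_mem_of_mem_clspan (isClosed_clspan T) f h hx

theorem clspan_univ : clspan (Set.univ : Set X) = ⊤ :=
  eq_top_iff.2 fun _ _ => subset_clspan trivial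

theorem eqOn_clspan {S : Set X} {f g : X →L[ℂ] Y} (h : ∀ s ∈ S, f s = g s) {x : X}
    (hx : x ∈ clspan S) : f x = g x :=
  ContinuousLinearMap.eqOn_closure_span (s := S) h hx

theorem clm_ext_of_clspan {S : Set X} (hS : clspan S = ⊤) {f g : X →L[ℂ] Y}
    (h : ∀ s ∈ S, f s = g s) : f = g :=
  ContinuousLinearMap.ext fun _ => eqOn_clspan h (hS ▸ Submodule.mem_top)

end ClosedSpan

/-! ### Factorization, closed range and ideals for `*`-homomorphisms -/

section Homs

variable {X : Type*} {Y : Type*} {Z : Type*} [CStarAlgebra X] [CStarAlgebra Y] [CStarAlgebra Z]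

/-- A `*`-homomorphism of C*-algebras as a continuous linear map. -/
noncomputable def homL (f : X →⋆ₐ[ℂ] Y) : X →L[ℂ] Y := ⟨lin f, Envelope.continuous_hom f⟩

@[simp] theorem homL_apply (f : X →⋆ₐ[ℂ] Y) (x : X) : homL f x = f x := rfl

theorem hom_eq_of_clspan {S : Set X} (hS : clspan S = ⊤) {f g : X →⋆ₐ[ℂ] Y}
    (h : ∀ s ∈ S, f s = g s) (x : X) : f x = g x :=
  DFunLike.congr_fun (clm_ext_of_clspan (f := homL f) (g := homL g) hS h) x

theorem exists_factor_of_surjective {π : X →⋆ₐ[ℂ] Y} (hπ : Function.Surjective π)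
    {f : X →⋆ₐ[ℂ] Z} (h : ∀ x, π x = 0 → f x = 0) : ∃ g : Y →⋆ₐ[ℂ] Z, ∀ x, g (π x) = f x := by
  have key : ∀ x y, π x = π y → f x = f y := fun x y e => by
    rw [← sub_eq_zero, ← map_sub]
    exact h _ (by rw [map_sub, e, sub_self])
  choose σ hσ using hπ
  refine ⟨{ toFun := fun y => f (σ y)
            map_one' := ?_, map_mul' := fun a b => ?_, map_zero' := ?_, map_add' := fun a b => ?_
            commutes' := fun c => ?_, map_star' := fun a => ?_ }, fun x => key _ _ (hσ _)⟩
  · rw [← map_one f]; exact key _ _ (by rw [hσ, map_one])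
  · rw [← map_mul]; exact key _ _ (by rw [hσ, map_mul, hσ, hσ])
  · rw [← map_zero f]; exact key _ _ (by rw [hσ, map_zero])
  · rw [← map_add]; exact key _ _ (by rw [hσ, map_add, hσ, hσ])
  · rw [← AlgHomClass.commutes f c]; exact key _ _ (by rw [hσ, AlgHomClass.commutes])
  · rw [← map_star]; exact key _ _ (by rw [hσ, map_star, hσ])

theorem exists_factor_of_injective {g : Y →⋆ₐ[ℂ] Z} (hg : Function.Injective g)
    {f : X →⋆ₐ[ℂ] Z} (h : ∀ x, ∃ y, g y = f x) : ∃ k : X →⋆ₐ[ℂ] Y, ∀ x, g (k x) = f x := by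
  choose σ hσ using h
  exact ⟨{ toFun := σ
           map_one' := hg (by rw [hσ, map_one, map_one])
           map_mul' := fun a b => hg (by rw [hσ, map_mul, map_mul, hσ, hσ])
           map_zero' := hg (by rw [hσ, map_zero, map_zero])
           map_add' := fun a b => hg (by rw [hσ, map_add, map_add, hσ, hσ])
           commutes' := fun c => hg (by
            rw [hσ, AlgHomClass.commutes, AlgHomClass.commutes])
           map_star' := fun a => hg (by rw [hσ, map_star, map_star, hσ]) }, hσ⟩

theorem quotMk_surjective (I : Ideal X) [I.IsTwoSided] [IsClosed (I : Set X)] :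
    Function.Surjective (quotMk I) :=
  Ideal.Quotient.mk_surjective

theorem quotMk_eq_zero (I : Ideal X) [I.IsTwoSided] [IsClosed (I : Set X)] {x : X} :
    quotMk I x = 0 ↔ x ∈ I :=
  Ideal.Quotient.eq_zero_iff_mem

/-- The kernel of a `*`-homomorphism. -/
abbrev kerIdeal (f : X →⋆ₐ[ℂ] Y) : Ideal X := RingHom.ker (f : X →+* Y)

instance isClosed_kerIdeal (f : X →⋆ₐ[ℂ] Y) : IsClosed (kerIdeal f : Set X) :=
  isClosed_singleton.preimage (Envelope.continuous_hom f)

/-- Dividing out the kernel does not change the range and makes the map injective, hence isometric.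
-/
theorem isClosed_range_hom (f : X →⋆ₐ[ℂ] Y) : IsClosed (Set.range f) := by
  obtain ⟨g, hg⟩ := exists_factor_of_surjective (f := f) (quotMk_surjective (kerIdeal f))
    fun x hx => (quotMk_eq_zero _).1 hx
  have hinj : Function.Injective g := by
    refine (injective_iff_map_eq_zero g).2 fun y hy => ?_
    obtain ⟨x, rfl⟩ := quotMk_surjective (kerIdeal f) y
    exact (quotMk_eq_zero _).2 (by rwa [hg] at hy)
  have hr : Set.range f = Set.range g := by
    ext y
    constructor
    · rintro ⟨x, rfl⟩; exact ⟨_, hg x⟩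
    · rintro ⟨x', rfl⟩
      obtain ⟨x, rfl⟩ := quotMk_surjective (kerIdeal f) x'
      exact ⟨x, (hg x).symm⟩
  rw [hr]
  exact (NonUnitalStarAlgHom.isometry g hinj).isClosedEmbedding.isClosed_range

theorem range_of_clspan (f : X →⋆ₐ[ℂ] Y) {S : Set Y} (h : ∀ s ∈ S, ∃ x, f x = s) {y : Y}
    (hy : y ∈ clspan S) : ∃ x, f x = y := by
  refine clspan_le (K := LinearMap.range (lin f)) ?_ (fun s hs => h s hs) hy
  convert isClosed_range_hom f
  ext; simp

theorem surjective_of_clspan (f : X →⋆ₐ[ℂ] Y) {S : Set Y} (hS : clspan S = ⊤)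
    (h : ∀ s ∈ S, ∃ x, f x = s) : Function.Surjective f := fun y =>
  range_of_clspan f h (hS ▸ Submodule.mem_top (x := y))

/-- The range of `g` is a closed subspace, so it contains every `f x` once it contains the values on
a set with dense span. Structure maps prescribed on elementary tensors are shown to exist in this
way. -/
theorem exists_factor_of_injective_clspan {g : Y →⋆ₐ[ℂ] Z} (hg : Function.Injective g)
    {f : X →⋆ₐ[ℂ] Z} {S : Set X} (hS : clspan S = ⊤) (h : ∀ s ∈ S, ∃ y, g y = f s) :
    ∃ k : X →⋆ₐ[ℂ] Y, ∀ x, g (k x) = f x := by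
  refine exists_factor_of_injective hg fun x => range_of_clspan g (S := f '' S) ?_ ?_
  · rintro _ ⟨s, hs, rfl⟩; exact h s hs
  · exact map_mem_clspan (f '' S) (homL f)
      (fun s hs => subset_clspan ⟨s, hs, rfl⟩) (hS ▸ Submodule.mem_top (x := x))

theorem clspan_image_of_surjective {f : X →⋆ₐ[ℂ] Y} (hf : Function.Surjective f) {S : Set X}
    (hS : clspan S = ⊤) : clspan (f '' S) = ⊤ := by
  refine eq_top_iff.2 fun y _ => ?_
  obtain ⟨x, rfl⟩ := hf y
  exact map_mem_clspan (f '' S) (homL f)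
    (fun s hs => subset_clspan ⟨s, hs, rfl⟩) (hS ▸ Submodule.mem_top (x := x))

theorem subset_closedIdeal {S : Set X} {x : X} (hx : x ∈ S) : x ∈ closedIdeal S :=
  mem_closedIdeal.2 fun _ _ _ h => h hx

theorem closedIdeal_le {S : Set X} {I : Ideal X} [h1 : I.IsTwoSided] (h2 : IsClosed (I : Set X))
    (h : S ⊆ I) {x : X} (hx : x ∈ closedIdeal S) : x ∈ I :=
  mem_closedIdeal.1 hx I h1 h2 h

theorem map_eq_zero_of_mem_closedIdeal {S : Set X} {f : X →⋆ₐ[ℂ] Y} (h : ∀ s ∈ S, f s = 0)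
    {x : X} (hx : x ∈ closedIdeal S) : f x = 0 :=
  closedIdeal_le (I := kerIdeal f) (isClosed_kerIdeal f) h hx

end Homs

/-! ### Maps between maximal tensor products -/

namespace MaxTensor

section

variable {A : Type u} {C : Type v} [CStarAlgebra A] [CStarAlgebra C]

theorem tmul_sub (a : A) (c c' : C) : tmul a (c - c') = tmul a c - tmul a c' := by
  simp only [tmul_eq, map_sub, mul_sub]
theorem sub_tmul (a a' : A) (c : C) : tmul (a - a') c = tmul a c - tmul a' c := by
  simp only [tmul_eq, map_sub, sub_mul]
theorem tmul_zero (a : A) : tmul a (0 : C) = 0 := by simp only [tmul_eq, map_zero, mul_zero]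
theorem zero_tmul (c : C) : tmul (0 : A) c = 0 := by simp only [tmul_eq, map_zero, zero_mul]

/-- Tensoring with a fixed element on the left. -/
noncomputable def tmulLeft (a : A) : C →L[ℂ] MaxTensor A C :=
  ContinuousLinearMap.mul ℂ (MaxTensor A C) (inl C a) ∘L homL (inr A)

/-- Tensoring with a fixed element on the right. -/
noncomputable def tmulRight (c : C) : A →L[ℂ] MaxTensor A C :=
  (ContinuousLinearMap.mul ℂ (MaxTensor A C)).flip (inr A c) ∘L homL (inl C)

@[simp] theorem tmulLeft_apply (a : A) (c : C) : tmulLeft a c = tmul a c := (tmul_eq a c).symm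
@[simp] theorem tmulRight_apply (a : A) (c : C) : tmulRight c a = tmul a c := (tmul_eq a c).symm

end

variable {A C D : Type u} {E : Type*} [CStarAlgebra A] [CStarAlgebra C]
  [CStarAlgebra D] [CStarAlgebra E]

theorem tmul_mem_clspan {S : Set A} {T : Set C} {a : A} {c : C} (ha : a ∈ clspan S)
    (hc : c ∈ clspan T) : tmul a c ∈ clspan (Set.image2 tmul S T) := by
  have h1 : ∀ s ∈ S, tmul s c ∈ clspan (Set.image2 tmul S T) := fun s hs => by
    rw [← tmulLeft_apply]
    exact map_mem_clspan (Set.image2 tmul S T) (tmulLeft s)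
      (fun t ht => by rw [tmulLeft_apply]; exact subset_clspan ⟨s, hs, t, ht, rfl⟩) hc
  rw [← tmulRight_apply]
  exact map_mem_clspan (Set.image2 tmul S T) (tmulRight c)
    (fun s hs => by rw [tmulRight_apply]; exact h1 s hs) ha

theorem clspan_image2_tmul {S : Set A} {T : Set C} (hS : clspan S = ⊤) (hT : clspan T = ⊤) :
    clspan (Set.image2 tmul S T) = ⊤ := by
  suffices h : ∀ x, x ∈ clspan (Set.image2 tmul S T) from eq_top_iff.2 fun x _ => h x
  intro x
  induction x using induction with
  | hP => exact isClosed_clspan (Set.image2 tmul S T)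
  | add x y hx hy => exact add_mem hx hy
  | tmul a c =>
    exact tmul_mem_clspan (hS ▸ Submodule.mem_top (x := a)) (hT ▸ Submodule.mem_top (x := c))

theorem clm_ext {Y : Type*} [NormedAddCommGroup Y] [NormedSpace ℂ Y] {f g : MaxTensor A C →L[ℂ] Y}
    (h : ∀ a c, f (tmul a c) = g (tmul a c)) : f = g :=
  clm_ext_of_clspan (clspan_image2_tmul clspan_univ clspan_univ) (by
    rintro _ ⟨a, -, c, -, rfl⟩; exact h a c)

theorem hom_ext_tmul {f g : MaxTensor A C →⋆ₐ[ℂ] E} (h : ∀ a c, f (tmul a c) = g (tmul a c)) :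
    f = g :=
  hom_ext (fun a => h a 1) fun c => h 1 c

variable (A C) in
/-- The flip `a ⊗ c ↦ c ⊗ a`. -/
noncomputable def flip : MaxTensor A C →⋆ₐ[ℂ] MaxTensor C A :=
  lift (inr C) (inl A) fun a c => (commute_inl_inr c a).symm

@[simp] theorem flip_tmul (a : A) (c : C) : flip A C (tmul a c) = tmul c a := by
  rw [flip, lift_tmul, tmul_eq, (commute_inl_inr c a).eq]

theorem flip_flip (x : MaxTensor A C) : flip C A (flip A C x) = x :=
  DFunLike.congr_fun (hom_ext_tmul (f := (flip C A).comp (flip A C)) (g := StarAlgHom.id ℂ _)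
    fun a c => by simp) x

variable (A C D) in
/-- The inverse of the associativity map. -/
noncomputable def assocInv : MaxTensor A (MaxTensor C D) →⋆ₐ[ℂ] MaxTensor (MaxTensor A C) D :=
  lift ((inl D).comp (inl C)) (map (inr A) (StarAlgHom.id ℂ D)) fun a x => Commute.symm <|
    commute_of (fun c => by
        rw [inl_eq, map_tmul, map_one]
        exact ((commute_inl_inr a c).symm.map (inl D)))
      (fun d => by
        rw [inr_eq, map_tmul, map_one]
        exact (commute_inl_inr _ _).symm) x

@[simp] theorem assocInv_tmul (a : A) (c : C) (d : D) :
    assocInv A C D (tmul a (tmul c d)) = tmul (tmul a c) d := by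
  rw [assocInv, lift_tmul, map_tmul]
  change tmul (tmul a 1) 1 * tmul (tmul 1 c) d = _
  rw [tmul_mul_tmul, tmul_mul_tmul]
  simp

theorem clm_ext₃ {Y : Type*} [NormedAddCommGroup Y] [NormedSpace ℂ Y]
    {f g : MaxTensor (MaxTensor A C) D →L[ℂ] Y}
    (h : ∀ a c d, f (tmul (tmul a c) d) = g (tmul (tmul a c) d)) : f = g :=
  clm_ext_of_clspan
    (clspan_image2_tmul (clspan_image2_tmul clspan_univ clspan_univ) clspan_univ) (by
      rintro _ ⟨_, ⟨a, -, c, -, rfl⟩, d, -, rfl⟩; exact h a c d)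

theorem assocInv_assoc (x : MaxTensor (MaxTensor A C) D) : assocInv A C D (assoc A C D x) = x :=
  DFunLike.congr_fun (clm_ext₃ (f := homL (assocInv A C D) ∘L homL (assoc A C D))
    (g := ContinuousLinearMap.id ℂ _) fun a c d => by simp) x

theorem assoc_injective : Function.Injective (assoc A C D) :=
  Function.LeftInverse.injective assocInv_assoc

theorem isArch_tensor (x : A ⊗[ℂ] C) : IsArch x := by
  induction x with
  | zero => exact isArch_zero
  | add x y hx hy => exact hx.add hy
  | tmul a c =>
    rw [← algInl_mul_algInr]
    have h1 : IsArch (algInl a : A ⊗[ℂ] C) :=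
      IsArch.map (R := A) (R' := A ⊗[ℂ] C) (isArch_of_cstar a) algInl
    have h2 : IsArch (algInr c : A ⊗[ℂ] C) :=
      IsArch.map (R := C) (R' := A ⊗[ℂ] C) (isArch_of_cstar c) algInr
    exact h1.mul h2

/-- The C*-algebra through which `Θ` factors depends on `Θ`, but the maximal norm dominates its
norm, so the maximal tensor product maps to it. -/
theorem exists_clm_of_nonneg (Θ : A ⊗[ℂ] C →ₗ[ℂ] E) (hΘ : ∀ x, 0 ≤ Θ (star x * x)) :
    ∃ F : MaxTensor A C →L[ℂ] E, ∀ x, F (ofAlg A C x) = Θ x := by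
  obtain ⟨E', _, j, F, hF⟩ := exists_extension isArch_tensor Θ hΘ
  refine ⟨F ∘L homL (Envelope.lift j), fun x => ?_⟩
  change F (Envelope.lift j (Envelope.of _ x)) = _
  rw [Envelope.lift_of, hF]

variable {A' C' : Type*} [CStarAlgebra A'] [CStarAlgebra C']

/-- All elementary tensors occurring in the `x i` are indexed by one set `ι`. If `b` and `e` are the
Gram factorizations of `φ` and `ψ` over `ι`, then the tensors `b k p ⊗ e l p` factor the matrix `φ
(a_p⋆ a_q) ⊗ ψ (c_p⋆ c_q)`. The coefficient `d i` is repeated for all summands of `x i`. -/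
theorem isCPAlg_tensor {φ : A →ₗ[ℂ] A'} {ψ : C →ₗ[ℂ] C'} (hφ : IsCP φ) (hψ : IsCP ψ) :
    IsCPAlg ((ofAlg A' C').toAlgHom.toLinearMap ∘ₗ TensorProduct.map φ ψ) := by
  intro n x d
  choose S hS using fun i => TensorProduct.exists_finset (x i)
  let ι := Σ i : Fin n, S i
  obtain ⟨m, b, hb⟩ := (isCP_iff.1 hφ).sum_sq fun p : ι => (p.2 : A × C).1
  obtain ⟨l, e, he⟩ := (isCP_iff.1 hψ).sum_sq fun p : ι => (p.2 : A × C).2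
  have key := nonneg_of_sum_sq (κ := Fin m × Fin l)
    (T := fun p q : ι => tmul (φ (star (p.2 : A × C).1 * (q.2 : A × C).1))
      (ψ (star (p.2 : A × C).2 * (q.2 : A × C).2)))
    (b := fun k p => tmul (b k.1 p) (e k.2 p)) (fun p q => by
      rw [hb, he, Fintype.sum_prod_type]
      simp only [star_tmul, tmul_mul_tmul]
      rw [← tmulRight_apply, map_sum]
      refine Finset.sum_congr rfl fun i _ => ?_
      rw [tmulRight_apply, ← tmulLeft_apply, map_sum]
      simp only [tmulLeft_apply]) fun p => d p.1
  convert key using 1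
  rw [Fintype.sum_sigma]
  refine Finset.sum_congr rfl fun i _ => ?_
  simp only [ι, Fintype.sum_sigma]
  rw [Finset.sum_comm]
  refine Finset.sum_congr rfl fun j _ => ?_
  have hi : x i = ∑ p : S i, (p : A × C).1 ⊗ₜ[ℂ] (p : A × C).2 := by
    conv_lhs => rw [hS i]
    exact (Finset.sum_coe_sort (S i) fun p => p.1 ⊗ₜ[ℂ] p.2).symm
  have hj : x j = ∑ p : S j, (p : A × C).1 ⊗ₜ[ℂ] (p : A × C).2 := by
    conv_lhs => rw [hS j]
    exact (Finset.sum_coe_sort (S j) fun p => p.1 ⊗ₜ[ℂ] p.2).symm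
  rw [hi, hj]
  simp only [star_sum, TensorProduct.star_tmul, Finset.sum_mul, Finset.mul_sum, map_sum,
    Algebra.TensorProduct.tmul_mul_tmul, LinearMap.comp_apply, TensorProduct.map_tmul]
  rw [Finset.sum_comm]
  rfl

theorem exists_tensor {φ : A →ₗ[ℂ] A'} {ψ : C →ₗ[ℂ] C'} (hφ : IsCP φ) (hψ : IsCP ψ) :
    ∃ F : MaxTensor A C →L[ℂ] MaxTensor A' C', (∀ a c, F (tmul a c) = tmul (φ a) (ψ c)) ∧
      IsCP (F : MaxTensor A C →ₗ[ℂ] MaxTensor A' C') := by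
  have h := isCPAlg_tensor hφ hψ
  obtain ⟨F, hF⟩ := exists_clm_of_nonneg _ h.nonneg
  refine ⟨F, fun a c => hF _, isCP_of_dense (j := ofAlg A C) (Envelope.denseRange_of _) ?_⟩
  convert h
  exact LinearMap.ext hF

end MaxTensor

/-! ### Functoriality of tensor products of completely positive maps -/

section TensorMap

open MaxTensor

variable {A A' A'' C C' C'' : Type u} [CStarAlgebra A] [CStarAlgebra A'] [CStarAlgebra A'']
  [CStarAlgebra C] [CStarAlgebra C'] [CStarAlgebra C'']

theorem tensorMap_tmul {φ : A →ₗ[ℂ] A'} {ψ : C →ₗ[ℂ] C'} (hφ : IsCP φ) (hψ : IsCP ψ) (a : A)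
    (c : C) : tensorMap φ ψ (tmul a c) = tmul (φ a) (ψ c) :=
  Classical.epsilon_spec (p := fun F : MaxTensor A C →L[ℂ] MaxTensor A' C' =>
    ∀ a c, F (tmul a c) = tmul (φ a) (ψ c))
    ((exists_tensor hφ hψ).imp fun _ h => h.1) a c

theorem tensorMap_eq {φ : A →ₗ[ℂ] A'} {ψ : C →ₗ[ℂ] C'} (hφ : IsCP φ) (hψ : IsCP ψ)
    {F : MaxTensor A C →L[ℂ] MaxTensor A' C'} (hF : ∀ a c, F (tmul a c) = tmul (φ a) (ψ c)) :
    tensorMap φ ψ = F :=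
  clm_ext fun a c => by rw [tensorMap_tmul hφ hψ, hF]

theorem isCP_tensorMap {φ : A →ₗ[ℂ] A'} {ψ : C →ₗ[ℂ] C'} (hφ : IsCP φ) (hψ : IsCP ψ) :
    IsCP (tensorMap φ ψ : MaxTensor A C →ₗ[ℂ] MaxTensor A' C') := by
  obtain ⟨F, h1, h2⟩ := exists_tensor hφ hψ
  rwa [tensorMap_eq hφ hψ h1]

theorem tensorMap_lin (f : A →⋆ₐ[ℂ] A') (g : C →⋆ₐ[ℂ] C') (x : MaxTensor A C) :
    tensorMap (lin f) (lin g) x = MaxTensor.map f g x := by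
  rw [tensorMap_eq (isCP_lin f) (isCP_lin g) (F := homL (MaxTensor.map f g)) fun a c =>
    map_tmul f g a c, homL_apply]

theorem tensorMap_lin_id (f : A →⋆ₐ[ℂ] A') (x : MaxTensor A C) :
    tensorMap (lin f) LinearMap.id x = MaxTensor.map f (StarAlgHom.id ℂ C) x :=
  tensorMap_lin f (StarAlgHom.id ℂ C) x

theorem tensorMap_id_lin (g : C →⋆ₐ[ℂ] C') (x : MaxTensor A C) :
    tensorMap LinearMap.id (lin g) x = MaxTensor.map (StarAlgHom.id ℂ A) g x :=
  tensorMap_lin (StarAlgHom.id ℂ A) g x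

theorem tensorMap_comp {φ : A →ₗ[ℂ] A'} {ψ : C →ₗ[ℂ] C'} {φ' : A' →ₗ[ℂ] A''}
    {ψ' : C' →ₗ[ℂ] C''} (hφ : IsCP φ) (hψ : IsCP ψ) (hφ' : IsCP φ') (hψ' : IsCP ψ')
    (x : MaxTensor A C) :
    tensorMap (φ' ∘ₗ φ) (ψ' ∘ₗ ψ) x = tensorMap φ' ψ' (tensorMap φ ψ x) := by
  rw [tensorMap_eq (hφ'.comp hφ) (hψ'.comp hψ) (F := tensorMap φ' ψ' ∘L tensorMap φ ψ)
    fun a c => by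
      rw [ContinuousLinearMap.comp_apply, tensorMap_tmul hφ hψ, tensorMap_tmul hφ' hψ']; rfl]
  rfl

theorem tensorMap_id (x : MaxTensor A C) :
    tensorMap (LinearMap.id : A →ₗ[ℂ] A) (LinearMap.id : C →ₗ[ℂ] C) x = x := by
  rw [tensorMap_eq isCP_id isCP_id (F := ContinuousLinearMap.id ℂ _) fun _ _ => rfl]
  rfl

end TensorMap

open scoped Classical

/-! ### Slice maps on the full group C*-algebra -/

section Slices

open MonoidAlgebra MaxTensor

/-- Grouping the indices by the value of `g` turns the double sum into the sum over `k` of the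
squares of `∑ y i` taken over `g i = k`. Positivity of the diagonal state and of the crossed product
expectation both reduce to this. -/
theorem nonneg_of_fibers {D : Type*} [CStarAlgebra D] {ι : Type*} [Fintype ι] {K : Type*}
    (g : ι → K) (y : ι → D) :
    0 ≤ ∑ i, ∑ j, if g i = g j then star (y i) * y j else 0 := by
  have e : ∑ i, ∑ j, (if g i = g j then star (y i) * y j else 0) =
      ∑ k ∈ Finset.univ.image g, star (∑ i, if g i = k then y i else 0) *
        ∑ i, if g i = k then y i else 0 := by
    simp only [star_sum, Finset.sum_mul, Finset.mul_sum]
    symm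
    rw [Finset.sum_comm, Finset.sum_congr rfl fun j _ => Finset.sum_comm, Finset.sum_comm]
    refine Finset.sum_congr rfl fun i _ => Finset.sum_congr rfl fun j _ => ?_
    have : ∀ k ∈ Finset.univ.image g,
        (star (if g i = k then y i else 0) * if g j = k then y j else 0) =
        if g i = k then (if g i = g j then star (y i) * y j else 0) else 0 := fun k _ => by
      by_cases h1 : g i = k
      · subst h1
        by_cases h2 : g i = g j
        · simp [h2]
        · simp [h2, Ne.symm h2]
      · simp [h1]
    rw [Finset.sum_congr rfl this, Finset.sum_ite_eq, if_pos (Finset.mem_image_of_mem g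
      (Finset.mem_univ i))]
  rw [e]
  exact Finset.sum_nonneg fun k _ => star_mul_self_nonneg _

variable (Γ : Type u) [Group Γ]

theorem isArch_single (γ : Γ) (c : ℂ) : IsArch (single γ c : MonoidAlgebra ℂ Γ) := by
  have h1 : IsArch (single γ 1 : MonoidAlgebra ℂ Γ) := by
    refine isArch_of_star_mul_self ?_
    rw [groupAlgebra_star_single, single_mul_single, one_def]
    simp
  have h2 : IsArch (algebraMap ℂ (MonoidAlgebra ℂ Γ) c) :=
    IsArch.map (R := ℂ) (R' := MonoidAlgebra ℂ Γ) (isArch_of_cstar c)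
      (StarAlgHom.ofId ℂ (MonoidAlgebra ℂ Γ))
  have h := h2.mul h1
  rwa [← Algebra.smul_def, smul_single, smul_eq_mul, mul_one] at h

theorem isArch_monoidAlgebra (x : MonoidAlgebra ℂ Γ) : IsArch x := by
  induction x using MonoidAlgebra.induction_linear with
  | zero => exact isArch_zero
  | add f g hf hg => exact hf.add hg
  | single γ c => exact isArch_single Γ γ c

/-- The indicator function of the diagonal as a linear functional on the group algebra of
`Γ × Γ`. -/
noncomputable def diagFunctional : MonoidAlgebra ℂ (Γ × Γ) →ₗ[ℂ] ℂ :=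
  Finsupp.linearCombination ℂ (fun p : Γ × Γ => if p.1 = p.2 then (1 : ℂ) else 0) ∘ₗ
    (coeffLinearEquiv ℂ).toLinearMap

theorem diagFunctional_single (p : Γ × Γ) (c : ℂ) :
    diagFunctional Γ (single p c) = if p.1 = p.2 then c else 0 := by
  change Finsupp.linearCombination ℂ _ (single p c : MonoidAlgebra ℂ (Γ × Γ)).coeff = _
  rw [coeff_single, Finsupp.linearCombination_single]
  split_ifs <;> simp

theorem exists_sum_single (x : MonoidAlgebra ℂ Γ) :
    ∃ (n : ℕ) (p : Fin n → Γ) (c : Fin n → ℂ), x = ∑ i, single (p i) (c i) := by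
  induction x using MonoidAlgebra.induction_linear with
  | zero => exact ⟨0, Fin.elim0, Fin.elim0, by simp⟩
  | single γ c => exact ⟨1, fun _ => γ, fun _ => c, by simp⟩
  | add f g hf hg =>
    obtain ⟨n, p, c, rfl⟩ := hf
    obtain ⟨m, q, d, rfl⟩ := hg
    exact ⟨n + m, Fin.append p q, Fin.append c d, by simp [Fin.sum_univ_add]⟩

/-- The indicator function of a subgroup is positive definite: `(p i)⁻¹ p j` is diagonal exactly
when `p i` and `p j` lie in the same left coset of the diagonal, and `p.2 * p.1⁻¹` labels the coset.
As the values are scalars, the coefficients `d i` can be absorbed into the `x i`, so positivity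
already gives complete positivity. -/
theorem isCPAlg_diagFunctional : IsCPAlg (diagFunctional Γ) := by
  have key : ∀ x, 0 ≤ diagFunctional Γ (star x * x) := fun x => by
    obtain ⟨n, p, c, rfl⟩ := exists_sum_single (Γ × Γ) x
    convert nonneg_of_fibers (fun i => (p i).2 * (p i).1⁻¹) c using 1
    simp only [star_sum, Finset.sum_mul, Finset.mul_sum, map_sum, groupAlgebra_star_single,
      single_mul_single, diagFunctional_single]
    rw [Finset.sum_comm]
    refine Finset.sum_congr rfl fun i _ => Finset.sum_congr rfl fun j _ => ?_
    refine if_congr ?_ rfl rfl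
    change (p i).1⁻¹ * (p j).1 = (p i).2⁻¹ * (p j).2 ↔ _
    constructor
    · intro h
      have : (p j).2 = (p i).2 * ((p i).1⁻¹ * (p j).1) := by rw [h]; group
      rw [this]; group
    · intro h
      have : (p j).2 = (p i).2 * (p i).1⁻¹ * (p j).1 := by rw [h]; group
      rw [this]; group
  intro n x d
  convert key (∑ i, d i • x i) using 1
  simp only [star_sum, Finset.sum_mul, Finset.mul_sum, map_sum, star_smul, smul_mul_assoc,
    mul_smul_comm, map_smul, smul_eq_mul]
  rw [Finset.sum_comm]
  refine Finset.sum_congr rfl fun i _ => Finset.sum_congr rfl fun j _ => ?_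
  ring

variable {Γ} in
/-- The canonical unitary of the full group C*-algebra. -/
noncomputable abbrev uG (γ : Γ) : GroupCStar Γ := (GroupCStar.u Γ γ : GroupCStar Γ)

theorem uG_one : uG (1 : Γ) = 1 := by rw [uG, map_one]; rfl
variable {Γ} in
theorem uG_mul (γ γ' : Γ) : uG (γ * γ') = uG γ * uG γ' := by
  rw [uG, map_mul]; rfl
variable {Γ} in
theorem star_uG (γ : Γ) : star (uG γ) = uG γ⁻¹ := by
  rw [uG, uG, map_inv]; rfl

theorem clspan_range_of {R : Type*} [Ring R] [StarRing R] [Algebra ℂ R] [StarModule ℂ R]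
    [HasEnvelopingCStar R] {S : Set R} (hS : Submodule.span ℂ S = ⊤) :
    clspan (Envelope.of R '' S) = ⊤ := by
  refine eq_top_iff.2 fun x _ => ?_
  refine (Envelope.denseRange_of R).induction_on x (isClosed_clspan (Envelope.of R '' S))
    fun y => Submodule.le_topologicalClosure _ ?_
  have hy : y ∈ Submodule.span ℂ S := hS ▸ Submodule.mem_top
  have := Submodule.mem_map_of_mem (f := (Envelope.of R).toAlgHom.toLinearMap) hy
  rwa [Submodule.map_span] at this

theorem clspan_uG : clspan (Set.range fun γ : Γ => uG γ) = ⊤ := by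
  have h : Submodule.span ℂ (Set.range fun γ : Γ => (single γ 1 : MonoidAlgebra ℂ Γ)) = ⊤ := by
    refine eq_top_iff.2 fun x _ => ?_
    obtain ⟨n, p, c, rfl⟩ := exists_sum_single Γ x
    refine Submodule.sum_mem _ fun i _ => ?_
    have : (single (p i) (c i) : MonoidAlgebra ℂ Γ) = c i • single (p i) 1 := by simp
    rw [this]
    exact Submodule.smul_mem _ _ (Submodule.subset_span ⟨p i, rfl⟩)
  have h2 := clspan_range_of h
  rwa [← Set.range_comp] at h2

variable {Γ}

theorem GroupCStar.commute_lift {D : Type*} [CStarAlgebra D] {v w : Γ →* unitary D}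
    (h : ∀ γ γ', Commute (v γ : D) (w γ')) (x y : GroupCStar Γ) :
    Commute (GroupCStar.lift v x) (GroupCStar.lift w y) := by
  have key : ∀ (w : Γ →* unitary D) (d : D), (∀ γ, Commute (w γ : D) d) →
      ∀ x : GroupCStar Γ, Commute (GroupCStar.lift w x) d := fun w d hd x => by
    have := clm_ext_of_clspan (clspan_uG Γ)
      (f := (ContinuousLinearMap.mul ℂ D).flip d ∘L homL (GroupCStar.lift w))
      (g := ContinuousLinearMap.mul ℂ D d ∘L homL (GroupCStar.lift w)) (by
        rintro _ ⟨γ, rfl⟩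
        simpa [GroupCStar.lift_u] using! (hd γ).eq)
    exact DFunLike.congr_fun this x
  exact key v _ (fun γ => (key w _ (fun γ' => (h γ γ').symm) y).symm) x

variable (Γ) in
/-- The canonical map `C*(Γ) ⊗ C*(Γ) → C*(Γ × Γ)`. -/
noncomputable def groupProd :
    MaxTensor (GroupCStar Γ) (GroupCStar Γ) →⋆ₐ[ℂ] GroupCStar (Γ × Γ) :=
  MaxTensor.lift (GroupCStar.lift ((GroupCStar.u (Γ × Γ)).comp (MonoidHom.inl Γ Γ)))
    (GroupCStar.lift ((GroupCStar.u (Γ × Γ)).comp (MonoidHom.inr Γ Γ)))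
    (GroupCStar.commute_lift fun γ γ' => by
      change uG _ * uG _ = uG _ * uG _
      rw [← uG_mul, ← uG_mul]
      simp)

theorem groupProd_tmul (γ γ' : Γ) : groupProd Γ (tmul (uG γ) (uG γ')) = uG (γ, γ') := by
  rw [groupProd, lift_tmul, GroupCStar.lift_u, GroupCStar.lift_u]
  change uG _ * uG _ = _
  rw [← uG_mul]
  simp

/-- The diagonal functional extends to `C*(Γ × Γ)` and is pulled back along `groupProd`. It is the
vector state at the neutral element of the commuting left and right regular representations on
`ℓ²(Γ)`. -/
theorem exists_diagState : ∃ F : MaxTensor (GroupCStar Γ) (GroupCStar Γ) →L[ℂ] ℂ,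
    (∀ γ γ', F (tmul (uG γ) (uG γ')) = if γ = γ' then 1 else 0) ∧
      IsCP (F : MaxTensor (GroupCStar Γ) (GroupCStar Γ) →ₗ[ℂ] ℂ) := by
  obtain ⟨E, _, j, F, hF⟩ := exists_extension (isArch_monoidAlgebra (Γ × Γ)) (diagFunctional Γ)
    (isCPAlg_diagFunctional Γ).nonneg
  have hF' : ∀ x, (F ∘L homL (Envelope.lift j)) (Envelope.of _ x) = diagFunctional Γ x := fun x => by
    simp [Envelope.lift_of, hF]
  have hcp : IsCP ((F ∘L homL (Envelope.lift j) : _ →L[ℂ] ℂ) : GroupCStar (Γ × Γ) →ₗ[ℂ] ℂ) := by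
    refine isCP_of_dense (j := Envelope.of _) (Envelope.denseRange_of _) ?_
    convert isCPAlg_diagFunctional Γ
    exact LinearMap.ext hF'
  refine ⟨F ∘L homL (Envelope.lift j) ∘L homL (groupProd Γ), fun γ γ' => ?_, ?_⟩
  · have := hF' (single (γ, γ') 1)
    rw [diagFunctional_single] at this
    simp only [ContinuousLinearMap.comp_apply, homL_apply, groupProd_tmul]
    exact this
  · exact hcp.comp (isCP_lin (groupProd Γ))

variable (X : Type u) [CStarAlgebra X]

theorem commute_ofId (c : ℂ) (x : X) :
    Commute (StarAlgHom.ofId ℂ X c) (StarAlgHom.id ℂ X x) :=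
  Algebra.commutes c x

/-- This is `ω ⊗ id` for the diagonal state `ω`, after rebracketing and identifying `ℂ ⊗ X` with
`X`. -/
theorem exists_slice : ∃ S : MaxTensor (GroupCStar Γ) (MaxTensor (GroupCStar Γ) X) →L[ℂ] X,
    (∀ γ γ' x, S (tmul (uG γ) (tmul (uG γ') x)) = if γ = γ' then x else 0) ∧
      IsCP (S : MaxTensor (GroupCStar Γ) (MaxTensor (GroupCStar Γ) X) →ₗ[ℂ] X) := by
  obtain ⟨ω, hω, hcp⟩ := exists_diagState (Γ := Γ)
  obtain ⟨T, hT, hTcp⟩ := exists_tensor hcp (isCP_id (A := X))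
  let l : MaxTensor ℂ X →⋆ₐ[ℂ] X := MaxTensor.lift (StarAlgHom.ofId ℂ X) (StarAlgHom.id ℂ X)
    (commute_ofId X)
  refine ⟨homL l ∘L T ∘L homL (assocInv _ _ _), fun γ γ' x => ?_, ?_⟩
  · simp only [ContinuousLinearMap.comp_apply, homL_apply, assocInv_tmul, hT, l, lift_tmul]
    rw [ContinuousLinearMap.coe_coe, hω]
    split_ifs
    · rw [map_one, one_mul]; rfl
    · rw [map_zero, zero_mul]
  · exact (isCP_lin l).comp (hTcp.comp (isCP_lin (assocInv _ _ _)))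

variable (Γ) in
/-- The slice map `γ ⊗ γ' ⊗ x ↦ δ_{γ,γ'} x`. -/
noncomputable def slice : MaxTensor (GroupCStar Γ) (MaxTensor (GroupCStar Γ) X) →L[ℂ] X :=
  (exists_slice X).choose

variable {X}

theorem slice_tmul (γ γ' : Γ) (x : X) :
    slice Γ X (tmul (uG γ) (tmul (uG γ') x)) = if γ = γ' then x else 0 :=
  (exists_slice X).choose_spec.1 γ γ' x

variable (X) in
theorem isCP_slice : IsCP (slice Γ X :
    MaxTensor (GroupCStar Γ) (MaxTensor (GroupCStar Γ) X) →ₗ[ℂ] X) :=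
  (exists_slice X).choose_spec.2

variable (X) in
/-- The slice map `γ' ⊗ x ↦ δ_{γ,γ'} x`. -/
noncomputable def sliceAt (γ : Γ) : MaxTensor (GroupCStar Γ) X →L[ℂ] X :=
  slice Γ X ∘L tmulLeft (uG γ)

theorem sliceAt_tmul (γ γ' : Γ) (x : X) :
    sliceAt X γ (tmul (uG γ') x) = if γ = γ' then x else 0 := by
  rw [sliceAt, ContinuousLinearMap.comp_apply, tmulLeft_apply, slice_tmul]

theorem clm_ext_group {Y : Type*} [NormedAddCommGroup Y] [NormedSpace ℂ Y]
    {f g : MaxTensor (GroupCStar Γ) X →L[ℂ] Y}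
    (h : ∀ (γ : Γ) x, f (tmul (uG γ) x) = g (tmul (uG γ) x)) : f = g :=
  clm_ext_of_clspan (clspan_image2_tmul (clspan_uG Γ) clspan_univ) (by
    rintro _ ⟨_, ⟨γ, rfl⟩, x, -, rfl⟩; exact h γ x)

theorem hom_ext_group {Y : Type*} [CStarAlgebra Y] {f g : MaxTensor (GroupCStar Γ) X →⋆ₐ[ℂ] Y}
    (h : ∀ (γ : Γ) x, f (tmul (uG γ) x) = g (tmul (uG γ) x)) (x) : f x = g x :=
  DFunLike.congr_fun (clm_ext_group (f := homL f) (g := homL g) h) x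

variable (Γ) in
/-- The counit of the full group C*-algebra. -/
noncomputable def counit : GroupCStar Γ →⋆ₐ[ℂ] ℂ := GroupCStar.lift 1

theorem counit_uG (γ : Γ) : counit Γ (uG γ) = 1 := by
  rw [counit, GroupCStar.lift_u]; rfl

variable (Γ X) in
theorem commute_counit (c : GroupCStar Γ) (x : X) :
    Commute ((StarAlgHom.ofId ℂ X).comp (counit Γ) c) (StarAlgHom.id ℂ X x) :=
  commute_ofId X (counit Γ c) x

variable (Γ X) in
/-- The map `γ ⊗ x ↦ x`. -/
noncomputable def counitLeft : MaxTensor (GroupCStar Γ) X →⋆ₐ[ℂ] X :=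
  MaxTensor.lift ((StarAlgHom.ofId ℂ X).comp (counit Γ)) (StarAlgHom.id ℂ X)
    (commute_counit Γ X)

theorem counitLeft_tmul (γ : Γ) (x : X) : counitLeft Γ X (tmul (uG γ) x) = x := by
  rw [counitLeft, lift_tmul]
  change algebraMap ℂ X (counit Γ (uG γ)) * x = x
  rw [counit_uG, map_one, one_mul]

theorem comul_uG (γ : Γ) : GroupCStar.comul Γ (uG γ) = tmul (uG γ) (uG γ) :=
  GroupCStar.lift_u _ γ

end Slices

open MaxTensor

/-! ### Coactions of the full group C*-algebra -/

section Coaction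

variable {Γ : Type u} [Group Γ] {A : Type u} [CStarAlgebra A]

/-- An injective coassociative left coaction. -/
structure IsCoaction (δ : A →⋆ₐ[ℂ] MaxTensor (GroupCStar Γ) A) : Prop where
  injective : Function.Injective δ
  coassoc : ∀ a, MaxTensor.map (StarAlgHom.id ℂ _) δ (δ a) =
    MaxTensor.assoc _ _ _ (MaxTensor.map (GroupCStar.comul Γ) (StarAlgHom.id ℂ _) (δ a))

/-- The projection onto the spectral subspace of degree `γ`. -/
noncomputable def specProj (δ : A →⋆ₐ[ℂ] MaxTensor (GroupCStar Γ) A) (γ : Γ) : A →L[ℂ] A :=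
  sliceAt A γ ∘L homL δ

/-- The map `γ ⊗ a ↦ specProj δ γ a`. -/
noncomputable def recon (δ : A →⋆ₐ[ℂ] MaxTensor (GroupCStar Γ) A) :
    MaxTensor (GroupCStar Γ) A →L[ℂ] A :=
  slice Γ A ∘L homL (MaxTensor.map (StarAlgHom.id ℂ _) δ)

variable {δ : A →⋆ₐ[ℂ] MaxTensor (GroupCStar Γ) A}

theorem specProj_apply (γ : Γ) (a : A) : specProj δ γ a = sliceAt A γ (δ a) := rfl

theorem recon_tmul (γ : Γ) (a : A) : recon δ (tmul (uG γ) a) = specProj δ γ a := by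
  simp [recon, specProj, sliceAt]

theorem isCP_recon : IsCP (recon δ : MaxTensor (GroupCStar Γ) A →ₗ[ℂ] A) :=
  (isCP_slice A).comp (isCP_lin (MaxTensor.map (StarAlgHom.id ℂ _) δ))

theorem assoc_comul_tmul {X : Type u} [CStarAlgebra X] (γ : Γ) (x : X) :
    assoc _ _ _ (MaxTensor.map (GroupCStar.comul Γ) (StarAlgHom.id ℂ _) (tmul (uG γ) x)) =
      tmul (uG γ) (tmul (uG γ) x) := by
  rw [map_tmul, comul_uG, assoc_tmul]
  rfl

/-- Counitality is not an axiom but follows from injectivity of `δ`. Applying `ε` to the first leg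
of `(id ⊗ δ) (δ a) = (Δ ⊗ id) (δ a)` gives `δ ((ε ⊗ id) (δ a))` on one side and `δ a` on the other.
-/
theorem IsCoaction.counitLeft (hδ : IsCoaction δ) (a : A) : counitLeft Γ A (δ a) = a := by
  refine hδ.injective ?_
  have h1 := hom_ext_group (f := δ.comp (DynQG.counitLeft Γ A))
    (g := (DynQG.counitLeft Γ _).comp (MaxTensor.map (StarAlgHom.id ℂ _) δ)) (fun γ x => by
      simp [counitLeft_tmul]) (δ a)
  have h2 := hom_ext_group (g := StarAlgHom.id ℂ _)
    (f := (DynQG.counitLeft Γ _).comp ((assoc (GroupCStar Γ) (GroupCStar Γ) A).comp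
      (MaxTensor.map (GroupCStar.comul Γ) (StarAlgHom.id ℂ _)))) (fun γ x => by
        rw [StarAlgHom.comp_apply, StarAlgHom.comp_apply, assoc_comul_tmul, counitLeft_tmul]
        rfl) (δ a)
  simp only [StarAlgHom.comp_apply] at h1 h2
  rw [h1, hδ.coassoc, h2]
  rfl

/-- By coassociativity `recon (δ a)` is the slice of `(Δ ⊗ id) (δ a)`. Since `Δ γ = γ ⊗ γ`, slicing
after `Δ ⊗ id` sends every `γ ⊗ x` to `x`, exactly as the counit does. So `δ` has a completely
positive left inverse. -/
theorem IsCoaction.recon (hδ : IsCoaction δ) (a : A) : recon δ (δ a) = a := by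
  have h := clm_ext_group (f := slice Γ A ∘L homL ((assoc (GroupCStar Γ) (GroupCStar Γ) A).comp
      (MaxTensor.map (GroupCStar.comul Γ) (StarAlgHom.id ℂ _))))
    (g := homL (DynQG.counitLeft Γ A)) (fun γ x => by
      rw [ContinuousLinearMap.comp_apply, homL_apply, StarAlgHom.comp_apply, assoc_comul_tmul,
        slice_tmul, if_pos rfl, homL_apply, counitLeft_tmul])
  have h' := DFunLike.congr_fun h (δ a)
  rw [homL_apply, hδ.counitLeft] at h'
  refine Eq.trans ?_ h'
  change slice Γ A (MaxTensor.map (StarAlgHom.id ℂ _) δ (δ a)) = _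
  rw [hδ.coassoc]
  rfl

theorem specProj_of_eigen {γ γ' : Γ} {a : A} (ha : δ a = tmul (uG γ') a) :
    specProj δ γ a = if γ = γ' then a else 0 := by
  rw [specProj_apply, ha, sliceAt_tmul]

theorem sliceAt_map {X Y : Type u} [CStarAlgebra X] [CStarAlgebra Y] (f : X →⋆ₐ[ℂ] Y) (γ : Γ)
    (y : MaxTensor (GroupCStar Γ) X) :
    sliceAt Y γ (MaxTensor.map (StarAlgHom.id ℂ _) f y) = f (sliceAt X γ y) := by
  have := clm_ext_group (f := sliceAt Y γ ∘L homL (MaxTensor.map (StarAlgHom.id ℂ _) f))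
    (g := homL f ∘L sliceAt X γ) fun γ' x => by
      simp only [ContinuousLinearMap.comp_apply, homL_apply, map_tmul, sliceAt_tmul]
      change sliceAt Y γ (tmul (uG γ') (f x)) = _
      rw [sliceAt_tmul]
      split_ifs <;> simp
  exact DFunLike.congr_fun this y

theorem sliceAt_assoc_comul {X : Type u} [CStarAlgebra X] (γ : Γ)
    (y : MaxTensor (GroupCStar Γ) X) :
    sliceAt (MaxTensor (GroupCStar Γ) X) γ (assoc (GroupCStar Γ) (GroupCStar Γ) X
      (MaxTensor.map (GroupCStar.comul Γ) (StarAlgHom.id ℂ X) y)) =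
        tmul (uG γ) (sliceAt X γ y) := by
  let g : MaxTensor (GroupCStar Γ) X →L[ℂ] MaxTensor (GroupCStar Γ) X :=
    (tmulLeft (uG γ) : X →L[ℂ] MaxTensor (GroupCStar Γ) X) ∘L sliceAt X γ
  let f : MaxTensor (GroupCStar Γ) X →L[ℂ] MaxTensor (GroupCStar Γ) X :=
    sliceAt (MaxTensor (GroupCStar Γ) X) γ ∘L homL ((assoc (GroupCStar Γ) (GroupCStar Γ) X).comp
      (MaxTensor.map (GroupCStar.comul Γ) (StarAlgHom.id ℂ X)))
  have : f = g := clm_ext_group fun γ' x => by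
    change sliceAt (MaxTensor (GroupCStar Γ) X) γ (assoc (GroupCStar Γ) (GroupCStar Γ) X
      (MaxTensor.map (GroupCStar.comul Γ) (StarAlgHom.id ℂ X) (tmul (uG γ') x))) =
        tmulLeft (uG γ) (sliceAt X γ (tmul (uG γ') x))
    rw [tmulLeft_apply, assoc_comul_tmul, sliceAt_tmul, sliceAt_tmul]
    split_ifs with h
    · rw [h]
    · rw [tmul_zero]
  exact (DFunLike.congr_fun this y).trans (tmulLeft_apply (uG γ) (sliceAt X γ y))

/-- Slice the first leg of `(id ⊗ δ) (δ a) = (Δ ⊗ id) (δ a)` at `γ`: the left side becomes `δ (P_γ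
a)`, the right side `γ ⊗ P_γ a`. -/
theorem IsCoaction.apply_specProj (hδ : IsCoaction δ) (γ : Γ) (a : A) :
    δ (specProj δ γ a) = tmul (uG γ) (specProj δ γ a) := by
  rw [specProj_apply, ← sliceAt_map, hδ.coassoc, sliceAt_assoc_comul]

/-- `δ a` is a limit of linear combinations of tensors `γ ⊗ x`. The bounded map `recon` carries it
back to `a` and each `γ ⊗ x` to `P_γ x`; no convergence of the series `∑ P_γ a` is claimed. -/
theorem IsCoaction.mem_clspan (hδ : IsCoaction δ) (a : A) :
    a ∈ clspan {x : A | ∃ γ y, x = specProj δ γ y} := by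
  have h : clspan (Set.image2 (tmul : GroupCStar Γ → A → _) (Set.range fun γ : Γ => uG γ)
    Set.univ) = ⊤ := clspan_image2_tmul (clspan_uG Γ) clspan_univ
  have h' : δ a ∈ clspan (Set.image2 (tmul : GroupCStar Γ → A → _)
    (Set.range fun γ : Γ => uG γ) Set.univ) := by rw [h]; exact Submodule.mem_top
  have := map_mem_clspan {x : A | ∃ γ y, x = specProj δ γ y} (DynQG.recon δ) (by
    rintro _ ⟨_, ⟨γ, rfl⟩, x, -, rfl⟩
    exact subset_clspan ⟨γ, x, recon_tmul γ x⟩) h'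
  rwa [hδ.recon] at this

end Coaction

namespace CGData

variable {Γ : Type u} [Group Γ]

/-- The right coaction of a `(ℂ,Γ)`-C*-algebra, turned into a left coaction. -/
noncomputable def δflip (A : CGData Γ) : A.carrier →⋆ₐ[ℂ] MaxTensor (GroupCStar Γ) A.carrier :=
  (MaxTensor.flip A.carrier (GroupCStar Γ)).comp A.δbar

variable {A : CGData Γ}

theorem δflip_apply (a : A.carrier) : A.δflip a = MaxTensor.flip _ _ (A.δbar a) := rfl

theorem δbar_eq_iff {a : A.carrier} {γ : Γ} :
    A.δbar a = tmul a (uG γ) ↔ A.δflip a = tmul (uG γ) a := by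
  rw [δflip_apply]
  constructor
  · intro h; rw [h, flip_tmul]
  · intro h; rw [← flip_flip (A.δbar a), h, flip_tmul]

theorem mem_comp {γ γ' : Γ} {a : A.carrier} :
    a ∈ A.comp γ γ' ↔ A.δ a = tmul (uG γ) a ∧ A.δbar a = tmul a (uG γ') := Iff.rfl

theorem mem_comp_iff {γ γ' : Γ} {a : A.carrier} :
    a ∈ A.comp γ γ' ↔ A.δ a = tmul (uG γ) a ∧ A.δflip a = tmul (uG γ') a := by
  rw [mem_comp, δbar_eq_iff]

theorem IsCG.isCoaction (hA : A.IsCG) : IsCoaction A.δ := ⟨hA.δ_injective, hA.coassoc⟩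

theorem IsCG.isCoaction_flip (hA : A.IsCG) : IsCoaction A.δflip where
  injective := (Function.LeftInverse.injective flip_flip).comp hA.δbar_injective
  coassoc a := by
    -- `p` reverses the order of the legs: `a ⊗ (g ⊗ h) ↦ h ⊗ (g ⊗ a)`. It translates right
    -- coassociativity into left coassociativity of the flipped coaction.
    let p : MaxTensor A.carrier (MaxTensor (GroupCStar Γ) (GroupCStar Γ)) →⋆ₐ[ℂ]
        MaxTensor (GroupCStar Γ) (MaxTensor (GroupCStar Γ) A.carrier) :=
      (assoc _ _ _).comp ((MaxTensor.flip _ _).comp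
        (MaxTensor.map (StarAlgHom.id ℂ _) (MaxTensor.flip _ _)))
    have hp : ∀ (y : MaxTensor A.carrier (GroupCStar Γ)) (g : GroupCStar Γ),
        p (assoc _ _ _ (tmul y g)) = tmul g (MaxTensor.flip _ _ y) := fun y g => by
      have := clm_ext (f := homL (p.comp (assoc A.carrier (GroupCStar Γ) (GroupCStar Γ))) ∘L
        tmulRight g) (g := tmulLeft g ∘L homL (MaxTensor.flip _ _)) fun a h => by
          simp [p]
      simpa using DFunLike.congr_fun this y
    have h1 : ∀ x, MaxTensor.map (StarAlgHom.id ℂ _) A.δflip (MaxTensor.flip _ _ x) =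
        p (assoc _ _ _ (MaxTensor.map A.δbar (StarAlgHom.id ℂ _) x)) := fun x => by
      refine DFunLike.congr_fun (hom_ext_tmul
        (f := (MaxTensor.map (StarAlgHom.id ℂ _) A.δflip).comp (MaxTensor.flip _ _))
        (g := p.comp ((assoc _ _ _).comp (MaxTensor.map A.δbar (StarAlgHom.id ℂ _))))
        fun a g => ?_) x
      simp only [StarAlgHom.comp_apply, flip_tmul, map_tmul, hp]
      rfl
    have h2 : ∀ x, assoc _ _ _ (MaxTensor.map (GroupCStar.comul Γ) (StarAlgHom.id ℂ _)
        (MaxTensor.flip A.carrier _ x)) =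
        p (MaxTensor.map (StarAlgHom.id ℂ _) (GroupCStar.comul Γ) x) := fun x => by
      rw [← flip_flip x]
      refine hom_ext_group
        (f := ((assoc _ _ _).comp ((MaxTensor.map (GroupCStar.comul Γ) (StarAlgHom.id ℂ _)).comp
          (MaxTensor.flip A.carrier _))).comp (MaxTensor.flip _ _))
        (g := (p.comp (MaxTensor.map (StarAlgHom.id ℂ _) (GroupCStar.comul Γ))).comp
          (MaxTensor.flip _ _)) (fun γ a => ?_) _
      simp only [StarAlgHom.comp_apply, flip_tmul, map_tmul, comul_uG, assoc_tmul, p]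
      simp
    rw [δflip_apply, h1, h2, hA.coassoc_bar]

/-- The projection onto the spectral subspace `A_{γ,γ'}`. -/
noncomputable def proj (A : CGData Γ) (γ γ' : Γ) : A.carrier →L[ℂ] A.carrier :=
  specProj A.δ γ ∘L specProj A.δflip γ'

/-- The two coactions commute, so the left spectral projection preserves the right degree; this is
what puts `proj` into the bigraded component. -/
theorem IsCG.δbar_specProj (hA : A.IsCG) {γ γ' : Γ} {a : A.carrier}
    (ha : A.δbar a = tmul a (uG γ')) :
    A.δbar (specProj A.δ γ a) = tmul (specProj A.δ γ a) (uG γ') := by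
  have key : ∀ y : MaxTensor (GroupCStar Γ) A.carrier,
      sliceAt _ γ (assoc _ _ _ (tmul y (uG γ'))) = tmul (sliceAt _ γ y) (uG γ') := fun y => by
    have := clm_ext_group (f := sliceAt _ γ ∘L homL (assoc _ _ _) ∘L tmulRight (uG γ'))
      (g := tmulRight (uG γ') ∘L sliceAt A.carrier γ) fun β x => by
        simp only [ContinuousLinearMap.comp_apply, homL_apply, tmulRight_apply, assoc_tmul,
          sliceAt_tmul]
        split_ifs
        · rfl
        · rw [zero_tmul]
    simpa using DFunLike.congr_fun this y
  rw [specProj_apply, ← sliceAt_map, ← hA.comm, ha, map_tmul]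
  exact key _

theorem IsCG.proj_mem (hA : A.IsCG) (γ γ' : Γ) (a : A.carrier) : A.proj γ γ' a ∈ A.comp γ γ' :=
  ⟨hA.isCoaction.apply_specProj γ _,
    hA.δbar_specProj (δbar_eq_iff.2 (hA.isCoaction_flip.apply_specProj γ' a))⟩

theorem proj_of_mem {β β' γ γ' : Γ} {a : A.carrier} (ha : a ∈ A.comp β β') :
    A.proj γ γ' a = if γ = β ∧ γ' = β' then a else 0 := by
  rw [mem_comp_iff] at ha
  rw [proj, ContinuousLinearMap.comp_apply, specProj_of_eigen ha.2]
  split_ifs with h1 h2 h2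
  · rw [specProj_of_eigen ha.1, if_pos h2.1]
  · rw [specProj_of_eigen ha.1, if_neg fun h => h2 ⟨h, h1⟩]
  · exact absurd h2.2 h1
  · rw [map_zero]

theorem proj_self {γ γ' : Γ} {a : A.carrier} (ha : a ∈ A.comp γ γ') : A.proj γ γ' a = a := by
  rw [proj_of_mem ha, if_pos ⟨rfl, rfl⟩]

/-- The set of homogeneous elements. -/
def homog (A : CGData Γ) : Set A.carrier := {a | ∃ γ γ', a ∈ A.comp γ γ'}

theorem IsCG.clspan_homog (hA : A.IsCG) : clspan A.homog = ⊤ := by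
  refine eq_top_iff.2 fun a _ => ?_
  refine clspan_le (isClosed_clspan A.homog) ?_ (hA.isCoaction.mem_clspan a)
  rintro _ ⟨γ, x, rfl⟩
  refine map_mem_clspan A.homog (specProj A.δ γ) ?_ (hA.isCoaction_flip.mem_clspan x)
  rintro _ ⟨γ', y, rfl⟩
  exact subset_clspan ⟨γ, γ', hA.proj_mem γ γ' y⟩

/-- The coaction identities are equalities of `*`-homomorphisms that are evident on homogeneous
elements. Injectivity is obtained in the same way, with the counit as a left inverse. -/
theorem isCG_of_clspan {S : Set A.carrier} (hS : clspan S = ⊤) (h : S ⊆ A.homog) : A.IsCG where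
  δ_injective := by
    refine Function.LeftInverse.injective (g := counitLeft Γ A.carrier) ?_
    refine hom_eq_of_clspan hS (f := (counitLeft Γ A.carrier).comp A.δ) (g := StarAlgHom.id ℂ _)
      fun s hs => ?_
    obtain ⟨γ, γ', h1, h2⟩ := h hs
    rw [StarAlgHom.comp_apply, h1, counitLeft_tmul]
    rfl
  δbar_injective := by
    refine Function.LeftInverse.injective
      (g := (counitLeft Γ A.carrier).comp (MaxTensor.flip _ _)) ?_
    refine hom_eq_of_clspan hS (f := ((counitLeft Γ A.carrier).comp (MaxTensor.flip _ _)).comp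
      A.δbar) (g := StarAlgHom.id ℂ _) fun s hs => ?_
    obtain ⟨γ, γ', h1, h2⟩ := h hs
    rw [StarAlgHom.comp_apply, h2, StarAlgHom.comp_apply, flip_tmul, counitLeft_tmul]
    rfl
  coassoc := hom_eq_of_clspan hS (f := (MaxTensor.map (StarAlgHom.id ℂ _) A.δ).comp A.δ)
    (g := ((assoc _ _ _).comp (MaxTensor.map (GroupCStar.comul Γ) (StarAlgHom.id ℂ _))).comp A.δ)
    fun s hs => by
      obtain ⟨γ, γ', h1, h2⟩ := h hs
      simp only [StarAlgHom.comp_apply, h1, map_tmul, comul_uG, assoc_tmul]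
      rfl
  coassoc_bar := hom_eq_of_clspan hS
    (f := ((assoc _ _ _).comp (MaxTensor.map A.δbar (StarAlgHom.id ℂ _))).comp A.δbar)
    (g := (MaxTensor.map (StarAlgHom.id ℂ _) (GroupCStar.comul Γ)).comp A.δbar)
    fun s hs => by
      obtain ⟨γ, γ', h1, h2⟩ := h hs
      simp only [StarAlgHom.comp_apply, h2, map_tmul, comul_uG, assoc_tmul]
      rfl
  comm := hom_eq_of_clspan hS
    (f := ((assoc _ _ _).comp (MaxTensor.map A.δ (StarAlgHom.id ℂ _))).comp A.δbar)
    (g := (MaxTensor.map (StarAlgHom.id ℂ _) A.δbar).comp A.δ)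
    fun s hs => by
      obtain ⟨γ, γ', h1, h2⟩ := h hs
      simp only [StarAlgHom.comp_apply, h1, h2, map_tmul, assoc_tmul]
      rfl

/-- The projection onto the component fixes `a`, is bounded, and sends each generator to itself or
to `0`; apply it to approximations of `a`. -/
theorem mem_clspan_comp {S : Set A.carrier} (hS : clspan S = ⊤) (h : S ⊆ A.homog) {γ γ' : Γ}
    {a : A.carrier} (ha : a ∈ A.comp γ γ') : a ∈ clspan (S ∩ A.comp γ γ') := by
  rw [← proj_self ha]
  refine map_mem_clspan _ (A.proj γ γ') (fun s hs => ?_) (hS ▸ Submodule.mem_top (x := a))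
  obtain ⟨β, β', hβ⟩ := h hs
  rw [proj_of_mem hβ]
  split_ifs with he
  · exact subset_clspan ⟨hs, by rw [he.1, he.2]; exact hβ⟩
  · exact zero_mem _

/-! #### The spectral subspaces -/

theorem one_mem_comp : (1 : A.carrier) ∈ A.comp 1 1 := by
  rw [mem_comp, map_one, map_one, uG_one, one_tmul_one, one_tmul_one]
  exact ⟨rfl, rfl⟩

theorem mul_mem_comp {β β' γ γ' : Γ} {a b : A.carrier} (ha : a ∈ A.comp β β')
    (hb : b ∈ A.comp γ γ') : a * b ∈ A.comp (β * γ) (β' * γ') := by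
  rw [mem_comp] at *
  rw [map_mul, map_mul, ha.1, hb.1, ha.2, hb.2, tmul_mul_tmul, tmul_mul_tmul, uG_mul, uG_mul]
  exact ⟨rfl, rfl⟩

/-- A linear map that preserves the spectral subspaces. -/
def IsGraded (A C : CGData Γ) (φ : A.carrier →ₗ[ℂ] C.carrier) : Prop :=
  ∀ γ γ', ∀ a ∈ A.comp γ γ', φ a ∈ C.comp γ γ'

theorem IsGraded.id : IsGraded A A LinearMap.id := fun _ _ _ h => h

variable {C : CGData Γ}

/-- For completely positive maps, preserving bidegrees is the same as intertwining the coactions: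
the two sides agree on homogeneous elements, which are dense in span. `isGraded_of_tensorMap` is the
converse. -/
theorem IsGraded.δ_apply {φ : A.carrier →ₗ[ℂ] C.carrier} (hφ : IsGraded A C φ) (hcp : IsCP φ)
    (hA : A.IsCG) (a : A.carrier) : C.δ (φ a) = tensorMap LinearMap.id φ (A.δ a) := by
  have := clm_ext_of_clspan hA.clspan_homog (f := homL C.δ ∘L ⟨φ, hcp.continuous⟩)
    (g := tensorMap LinearMap.id φ ∘L homL A.δ) (by
      rintro s ⟨γ, γ', hs⟩
      change C.δ (φ s) = tensorMap LinearMap.id φ (A.δ s)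
      rw [(hφ _ _ s hs).1, hs.1, tensorMap_tmul isCP_id hcp]
      rfl)
  exact DFunLike.congr_fun this a

theorem IsGraded.δbar_apply {φ : A.carrier →ₗ[ℂ] C.carrier} (hφ : IsGraded A C φ) (hcp : IsCP φ)
    (hA : A.IsCG) (a : A.carrier) : C.δbar (φ a) = tensorMap φ LinearMap.id (A.δbar a) := by
  have := clm_ext_of_clspan hA.clspan_homog (f := homL C.δbar ∘L ⟨φ, hcp.continuous⟩)
    (g := tensorMap φ LinearMap.id ∘L homL A.δbar) (by
      rintro s ⟨γ, γ', hs⟩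
      change C.δbar (φ s) = tensorMap φ LinearMap.id (A.δbar s)
      rw [(hφ _ _ s hs).2, hs.2, tensorMap_tmul hcp isCP_id]
      rfl)
  exact DFunLike.congr_fun this a

theorem isGraded_of_tensorMap {φ : A.carrier →ₗ[ℂ] C.carrier} (hcp : IsCP φ)
    (h1 : ∀ a, C.δ (φ a) = tensorMap LinearMap.id φ (A.δ a))
    (h2 : ∀ a, C.δbar (φ a) = tensorMap φ LinearMap.id (A.δbar a)) : IsGraded A C φ :=
  fun γ γ' a ha => by
    rw [mem_comp, h1, h2, ha.1, ha.2, tensorMap_tmul isCP_id hcp, tensorMap_tmul hcp isCP_id]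
    exact ⟨rfl, rfl⟩

end CGData

/-! ### The cotensor product -/

section LeftInverse

variable {X Y Z : Type u} [CStarAlgebra X] [CStarAlgebra Y] [CStarAlgebra Z]

/-- Maximal tensor products need not preserve injectivity; a completely positive left inverse `p` of
`f` repairs this, since `id ⊗ p` is then a left inverse of `id ⊗ f`. -/
theorem map_id_injective {f : X →⋆ₐ[ℂ] Y} {p : Y →ₗ[ℂ] X} (hp : IsCP p) (h : ∀ x, p (f x) = x) :
    Function.Injective (MaxTensor.map (StarAlgHom.id ℂ Z) f) := by
  refine Function.LeftInverse.injective (g := tensorMap LinearMap.id p) fun x => ?_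
  rw [← tensorMap_id_lin, ← tensorMap_comp isCP_id (isCP_lin f) isCP_id hp]
  rw [show p ∘ₗ lin f = LinearMap.id from LinearMap.ext h]
  exact tensorMap_id x

theorem map_injective_id {f : X →⋆ₐ[ℂ] Y} {p : Y →ₗ[ℂ] X} (hp : IsCP p) (h : ∀ x, p (f x) = x) :
    Function.Injective (MaxTensor.map f (StarAlgHom.id ℂ Z)) := by
  refine Function.LeftInverse.injective (g := tensorMap p LinearMap.id) fun x => ?_
  rw [← tensorMap_lin_id, ← tensorMap_comp (isCP_lin f) isCP_id hp isCP_id]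
  rw [show p ∘ₗ lin f = LinearMap.id from LinearMap.ext h]
  exact tensorMap_id x

end LeftInverse

namespace CGData

variable {Γ : Type u} [Group Γ]

/-- The intertwining identities are closed linear conditions, so unlike the definition of a graded
map they can be verified on a set with dense span. -/
theorem isGraded_of_clspan {A C : CGData Γ} {S : Set A.carrier} (hS : clspan S = ⊤)
    {φ : A.carrier →ₗ[ℂ] C.carrier} (hcp : IsCP φ)
    (h : ∀ s ∈ S, ∃ γ γ', s ∈ A.comp γ γ' ∧ φ s ∈ C.comp γ γ') : IsGraded A C φ := by
  refine isGraded_of_tensorMap hcp (fun a => ?_) fun a => ?_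
  · have := clm_ext_of_clspan hS (f := homL C.δ ∘L ⟨φ, hcp.continuous⟩)
      (g := tensorMap LinearMap.id φ ∘L homL A.δ) fun s hs => by
        obtain ⟨γ, γ', h1, h2⟩ := h s hs
        change C.δ (φ s) = tensorMap LinearMap.id φ (A.δ s)
        rw [h1.1, h2.1, tensorMap_tmul isCP_id hcp]
        rfl
    exact DFunLike.congr_fun this a
  · have := clm_ext_of_clspan hS (f := homL C.δbar ∘L ⟨φ, hcp.continuous⟩)
      (g := tensorMap φ LinearMap.id ∘L homL A.δbar) fun s hs => by
        obtain ⟨γ, γ', h1, h2⟩ := h s hs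
        change C.δbar (φ s) = tensorMap φ LinearMap.id (A.δbar s)
        rw [h1.2, h2.2, tensorMap_tmul hcp isCP_id]
        rfl
    exact DFunLike.congr_fun this a

variable (Γ) in
theorem group_uG_mem (γ : Γ) : uG γ ∈ (group Γ).comp γ γ := ⟨comul_uG γ, comul_uG γ⟩

variable (Γ) in
theorem isCG_group : (group Γ).IsCG :=
  isCG_of_clspan (A := group Γ) (clspan_uG Γ) (by
    rintro _ ⟨γ, rfl⟩; exact ⟨γ, γ, group_uG_mem Γ γ⟩)

variable (A C : CGData Γ)

theorem incl_injective : Function.Injective (incl A C) := Subtype.val_injective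

variable {A C}

theorem mem_range_incl {x : MaxTensor A.carrier C.carrier} :
    (∃ y, incl A C y = x) ↔ MaxTensor.assoc _ _ _ (MaxTensor.map A.δbar (StarAlgHom.id ℂ _) x) =
      MaxTensor.map (StarAlgHom.id ℂ _) C.δ x :=
  ⟨fun ⟨y, hy⟩ => hy ▸ y.2, fun h => ⟨⟨x, h⟩, rfl⟩⟩

theorem incl_spec (x : (cot A C).carrier) :
    MaxTensor.assoc _ _ _ (MaxTensor.map A.δbar (StarAlgHom.id ℂ _) (incl A C x)) =
      MaxTensor.map (StarAlgHom.id ℂ _) C.δ (incl A C x) :=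
  mem_range_incl.1 ⟨x, rfl⟩

theorem exists_incl_eq_tmul {γ : Γ} {a : A.carrier} {c : C.carrier}
    (ha : A.δbar a = tmul a (uG γ)) (hc : C.δ c = tmul (uG γ) c) :
    ∃ y, incl A C y = tmul a c := by
  rw [mem_range_incl, map_tmul, map_tmul, ha, hc]
  exact assoc_tmul a (uG γ) c

variable (A C) in
/-- The elementary tensors in the cotensor product. -/
def cotGen : Set (cot A C).carrier :=
  {x | ∃ β γ β', ∃ a ∈ A.comp β γ, ∃ c ∈ C.comp γ β', incl A C x = tmul a c}

variable (A C) in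
/-- The projection of the maximal tensor product onto the cotensor product. -/
noncomputable def cotProjAux : MaxTensor A.carrier C.carrier →L[ℂ] MaxTensor A.carrier C.carrier :=
  tensorMap LinearMap.id (recon C.δ : _ →ₗ[ℂ] C.carrier) ∘L
    homL ((MaxTensor.assoc A.carrier (GroupCStar Γ) C.carrier).comp
      (MaxTensor.map A.δbar (StarAlgHom.id ℂ C.carrier)))

theorem isCP_cotProjAux : IsCP (cotProjAux A C : MaxTensor A.carrier C.carrier →ₗ[ℂ] MaxTensor A.carrier C.carrier) :=
  (isCP_tensorMap isCP_id isCP_recon).comp (isCP_lin _)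

theorem cotProjAux_tmul {γ : Γ} {a : A.carrier} (ha : A.δbar a = tmul a (uG γ)) (c : C.carrier) :
    cotProjAux A C (tmul a c) = tmul a (specProj C.δ γ c) := by
  change tensorMap LinearMap.id (recon C.δ : _ →ₗ[ℂ] C.carrier) (MaxTensor.assoc _ _ _
    (MaxTensor.map A.δbar (StarAlgHom.id ℂ C.carrier) (tmul a c))) = _
  rw [map_tmul, ha, assoc_tmul, tensorMap_tmul isCP_id isCP_recon]
  change tmul a (recon C.δ (tmul (uG γ) c)) = _
  rw [recon_tmul]

/-- On the cotensor product `δbar ⊗ id` equals `id ⊗ δ`, and `id ⊗ recon` undoes the latter. -/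
theorem cotProjAux_incl (hC : C.IsCG) (x : (cot A C).carrier) :
    cotProjAux A C (incl A C x) = incl A C x := by
  change tensorMap LinearMap.id (recon C.δ : _ →ₗ[ℂ] C.carrier) (MaxTensor.assoc _ _ _
    (MaxTensor.map A.δbar (StarAlgHom.id ℂ C.carrier) (incl A C x))) = _
  rw [incl_spec, ← tensorMap_id_lin, ← tensorMap_comp isCP_id (isCP_lin C.δ) isCP_id isCP_recon]
  rw [show (recon C.δ : _ →ₗ[ℂ] C.carrier) ∘ₗ lin C.δ = LinearMap.id from
    LinearMap.ext hC.isCoaction.recon]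
  exact tensorMap_id _

theorem clspan_homog_tmul (hA : A.IsCG) (hC : C.IsCG) :
    clspan (Set.image2 (tmul : A.carrier → C.carrier → _) A.homog C.homog) = ⊤ :=
  clspan_image2_tmul hA.clspan_homog hC.clspan_homog

/-- For `a` of right degree `γ`, the tensor `a ⊗ c` is sent to `a ⊗ P_γ c`, whose middle degrees
match. Such tensors have dense span and the cotensor product is closed. -/
theorem cotProjAux_mem (hA : A.IsCG) (hC : C.IsCG) (x : MaxTensor A.carrier C.carrier) :
    cotProjAux A C x ∈ cotAlg A C := by
  have hx : x ∈ clspan (Set.image2 (tmul : A.carrier → C.carrier → _) A.homog C.homog) := by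
    rw [clspan_homog_tmul hA hC]; exact Submodule.mem_top
  refine map_mem_of_mem_clspan
    (K := (Subalgebra.toSubmodule (cotAlg A C).toSubalgebra)) ?_ (cotProjAux A C) ?_ hx
  · exact (inferInstance : IsClosed (cotAlg A C : Set (MaxTensor A.carrier C.carrier)))
  · rintro _ ⟨a, ⟨β, γ, ha⟩, c, -, rfl⟩
    rw [cotProjAux_tmul ha.2]
    obtain ⟨y, hy⟩ := exists_incl_eq_tmul ha.2 (hC.isCoaction.apply_specProj γ c)
    rw [← hy]
    exact y.2

/-- The projection of the maximal tensor product onto the cotensor product. -/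
noncomputable def cotProj (hA : A.IsCG) (hC : C.IsCG) :
    MaxTensor A.carrier C.carrier →L[ℂ] (cot A C).carrier where
  toFun x := (⟨cotProjAux A C x, cotProjAux_mem hA hC x⟩ : cotAlg A C)
  map_add' x y := Subtype.ext (map_add (cotProjAux A C) x y)
  map_smul' z x := Subtype.ext (map_smul (cotProjAux A C) z x)
  cont := (cotProjAux A C).continuous.subtype_mk _

variable (hA : A.IsCG) (hC : C.IsCG)

theorem isCP_cotProj : IsCP (cotProj hA hC : MaxTensor A.carrier C.carrier →ₗ[ℂ] (cot A C).carrier) :=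
  isCP_cotProjAux.of_injective (incl_injective A C) (StarAlgHom.id ℂ _) fun _ => rfl

theorem cotProj_incl (x : (cot A C).carrier) : cotProj hA hC (incl A C x) = x :=
  incl_injective A C (cotProjAux_incl hC x)

include hA hC

/-- The projection onto the cotensor product keeps `a ⊗ c` when the middle degrees agree and kills
it otherwise, so it carries spanning tensors to spanning tensors. The freedom in `S` and `T` is used
for the elements `b γ` of the crossed product, for images under surjections and for iterated
cotensor products. -/
theorem clspan_of_homog {S : Set A.carrier} {T : Set C.carrier} (hS : clspan S = ⊤)
    (hSA : S ⊆ A.homog) (hT : clspan T = ⊤) (hTC : T ⊆ C.homog) :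
    clspan {x : (cot A C).carrier | ∃ a ∈ S, ∃ c ∈ T, ∃ β γ β', a ∈ A.comp β γ ∧
      c ∈ C.comp γ β' ∧ incl A C x = tmul a c} = ⊤ := by
  refine eq_top_iff.2 fun x _ => ?_
  set G := {x : (cot A C).carrier | ∃ a ∈ S, ∃ c ∈ T, ∃ β γ β', a ∈ A.comp β γ ∧
    c ∈ C.comp γ β' ∧ incl A C x = tmul a c}
  have hx : incl A C x ∈ clspan (Set.image2 (tmul : A.carrier → C.carrier → _) S T) := by
    rw [clspan_image2_tmul hS hT]; exact Submodule.mem_top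
  rw [← cotProj_incl hA hC x]
  refine map_mem_clspan G (cotProj hA hC) ?_ hx
  rintro _ ⟨a, haS, c, hcT, rfl⟩
  obtain ⟨β, γ, ha⟩ := hSA haS
  obtain ⟨γ', β', hc⟩ := hTC hcT
  have h := cotProjAux_tmul (C := C) ha.2 c
  rw [specProj_of_eigen hc.1] at h
  split_ifs at h with he
  · exact subset_clspan ⟨a, haS, c, hcT, β, γ, β', ha, he ▸ hc, h⟩
  · rw [tmul_zero] at h
    rw [show cotProj hA hC (tmul a c) = 0 from incl_injective A C (by rw [map_zero]; exact h)]
    exact zero_mem _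

theorem clspan_cotGen : clspan (cotGen A C) = ⊤ := by
  refine top_unique ((clspan_of_homog hA hC hA.clspan_homog subset_rfl hC.clspan_homog
    subset_rfl).symm.trans_le (clspan_mono ?_))
  rintro x ⟨a, -, c, -, β, γ, β', ha, hc, h⟩
  exact ⟨β, γ, β', a, ha, c, hc, h⟩

theorem map_id_incl_injective {Z : Type u} [CStarAlgebra Z] :
    Function.Injective (MaxTensor.map (StarAlgHom.id ℂ Z) (incl A C)) :=
  map_id_injective (isCP_cotProj hA hC) (cotProj_incl hA hC)

theorem map_incl_id_injective {Z : Type u} [CStarAlgebra Z] :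
    Function.Injective (MaxTensor.map (incl A C) (StarAlgHom.id ℂ Z)) :=
  map_injective_id (isCP_cotProj hA hC) (cotProj_incl hA hC)

theorem isCotδ_unique {f g} (hf : IsCotδ A C f) (hg : IsCotδ A C g) : f = g := by
  ext x : 1
  exact map_id_incl_injective hA hC ((hf x).trans (hg x).symm)

theorem isCotδbar_unique {f g} (hf : IsCotδbar A C f) (hg : IsCotδbar A C g) : f = g := by
  ext x : 1
  exact map_incl_id_injective hA hC (assoc_injective ((hf x).trans (hg x).symm))

theorem isCotδ_cot : IsCotδ A C (cot A C).δ := by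
  refine Classical.epsilon_spec (p := IsCotδ A C) ?_
  obtain ⟨k, hk⟩ := exists_factor_of_injective_clspan
    (f := ((MaxTensor.assoc _ _ _).comp (MaxTensor.map A.δ (StarAlgHom.id ℂ _))).comp (incl A C))
    (map_id_incl_injective hA hC) (clspan_cotGen hA hC) (by
      rintro s ⟨β, γ, β', a, ha, c, hc, h⟩
      -- On a generator of left degree `β` the value of the coaction is forced to be `β ⊗ s`.
      refine ⟨tmul (uG β) s, ?_⟩
      rw [map_tmul, StarAlgHom.comp_apply, StarAlgHom.comp_apply, h, map_tmul, ha.1]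
      exact (assoc_tmul (uG β) a c).symm)
  exact ⟨k, hk⟩

theorem isCotδbar_cot : IsCotδbar A C (cot A C).δbar := by
  refine Classical.epsilon_spec (p := IsCotδbar A C) ?_
  obtain ⟨k, hk⟩ := exists_factor_of_injective_clspan
    (f := (MaxTensor.map (StarAlgHom.id ℂ _) C.δbar).comp (incl A C))
    (g := (MaxTensor.assoc _ _ _).comp (MaxTensor.map (incl A C) (StarAlgHom.id ℂ (GroupCStar Γ))))
    (assoc_injective.comp (map_incl_id_injective hA hC)) (clspan_cotGen hA hC) (by
      rintro s ⟨β, γ, β', a, ha, c, hc, h⟩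
      refine ⟨tmul s (uG β'), ?_⟩
      rw [StarAlgHom.comp_apply, StarAlgHom.comp_apply, h, map_tmul, map_tmul, hc.2, h]
      exact assoc_tmul a c (uG β'))
  exact ⟨k, hk⟩

theorem cot_δ (x : (cot A C).carrier) :
    MaxTensor.map (StarAlgHom.id ℂ _) (incl A C) ((cot A C).δ x) =
      MaxTensor.assoc _ _ _ (MaxTensor.map A.δ (StarAlgHom.id ℂ _) (incl A C x)) :=
  isCotδ_cot hA hC x

theorem cot_δbar (x : (cot A C).carrier) :
    MaxTensor.assoc _ _ _ (MaxTensor.map (incl A C) (StarAlgHom.id ℂ _) ((cot A C).δbar x)) =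
      MaxTensor.map (StarAlgHom.id ℂ _) C.δbar (incl A C x) :=
  isCotδbar_cot hA hC x

theorem mem_cot_comp {β γ γ' β' : Γ} {a : A.carrier} {c : C.carrier} (ha : a ∈ A.comp β γ)
    (hc : c ∈ C.comp γ' β') {x : (cot A C).carrier} (hx : incl A C x = tmul a c) :
    x ∈ (cot A C).comp β β' := by
  constructor
  · refine map_id_incl_injective hA hC ?_
    rw [cot_δ hA hC, map_tmul, hx, map_tmul, ha.1]
    exact assoc_tmul (uG β) a c
  · refine map_incl_id_injective hA hC (assoc_injective ?_)
    rw [cot_δbar hA hC, map_tmul, hx, map_tmul, hc.2]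
    exact (assoc_tmul a c (uG β')).symm

theorem cotGen_subset_homog : cotGen A C ⊆ (cot A C).homog := by
  rintro x ⟨β, γ, β', a, ha, c, hc, h⟩
  exact ⟨β, β', mem_cot_comp hA hC ha hc h⟩

variable {A' C' : CGData Γ} {φ : A.carrier →ₗ[ℂ] A'.carrier} {ψ : C.carrier →ₗ[ℂ] C'.carrier}

/-- The point is that `φ ⊗ ψ` maps cotensor product into cotensor product: on a generator `a ⊗ c`,
both maps preserve the common middle degree. -/
theorem cotMap_spec (hφ : IsCP φ) (hψ : IsCP ψ) (gφ : IsGraded A A' φ) (gψ : IsGraded C C' ψ)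
    (x : (cot A C).carrier) :
    incl A' C' (cotMap A A' C C' φ ψ x) = tensorMap φ ψ (incl A C x) := by
  have hmem : ∀ x, tensorMap φ ψ (incl A C x) ∈ cotAlg A' C' := fun x => by
    have hx : x ∈ clspan (cotGen A C) := by rw [clspan_cotGen hA hC]; exact Submodule.mem_top
    refine map_mem_of_mem_clspan
      (K := (Subalgebra.toSubmodule (cotAlg A' C').toSubalgebra)) ?_
      (tensorMap φ ψ ∘L homL (incl A C)) ?_ hx
    · exact (inferInstance : IsClosed (cotAlg A' C' : Set (MaxTensor A'.carrier C'.carrier)))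
    · rintro s ⟨β, γ, β', a, ha, c, hc, h⟩
      change tensorMap φ ψ (incl A C s) ∈ cotAlg A' C'
      rw [h, tensorMap_tmul hφ hψ]
      obtain ⟨y, hy⟩ := exists_incl_eq_tmul (gφ _ _ a ha).2 (gψ _ _ c hc).1
      rw [← hy]
      exact y.2
  refine Classical.epsilon_spec (p := fun F : (cot A C).carrier →ₗ[ℂ] (cot A' C').carrier =>
    ∀ x, incl A' C' (F x) = tensorMap φ ψ (incl A C x)) ?_ x
  exact ⟨{ toFun := fun x => (⟨tensorMap φ ψ (incl A C x), hmem x⟩ : cotAlg A' C')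
           map_add' := fun x y => Subtype.ext (map_add (tensorMap φ ψ ∘L homL (incl A C)) x y)
           map_smul' := fun z x => Subtype.ext
             (map_smul (tensorMap φ ψ ∘L homL (incl A C)) z x) }, fun _ => rfl⟩

theorem isCP_cotMap (hφ : IsCP φ) (hψ : IsCP ψ) (gφ : IsGraded A A' φ) (gψ : IsGraded C C' ψ) :
    IsCP (cotMap A A' C C' φ ψ) :=
  (isCP_tensorMap hφ hψ).of_injective (incl_injective A' C') (incl A C)
    (cotMap_spec hA hC hφ hψ gφ gψ)

theorem isGraded_cotMap (hA' : A'.IsCG) (hC' : C'.IsCG) (hφ : IsCP φ) (hψ : IsCP ψ)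
    (gφ : IsGraded A A' φ) (gψ : IsGraded C C' ψ) :
    IsGraded (cot A C) (cot A' C') (cotMap A A' C C' φ ψ) := by
  refine isGraded_of_clspan (clspan_cotGen hA hC) (isCP_cotMap hA hC hφ hψ gφ gψ) ?_
  rintro s ⟨β, γ, β', a, ha, c, hc, h⟩
  refine ⟨β, β', mem_cot_comp hA hC ha hc h, mem_cot_comp hA' hC' (gφ _ _ a ha) (gψ _ _ c hc) ?_⟩
  rw [cotMap_spec hA hC hφ hψ gφ gψ, h, tensorMap_tmul hφ hψ]

theorem cotMap_comp {A'' C'' : CGData Γ} (hA' : A'.IsCG) (hC' : C'.IsCG)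
    {φ' : A'.carrier →ₗ[ℂ] A''.carrier} {ψ' : C'.carrier →ₗ[ℂ] C''.carrier}
    (hφ : IsCP φ) (hψ : IsCP ψ) (gφ : IsGraded A A' φ) (gψ : IsGraded C C' ψ)
    (hφ' : IsCP φ') (hψ' : IsCP ψ') (gφ' : IsGraded A' A'' φ') (gψ' : IsGraded C' C'' ψ')
    (x : (cot A C).carrier) :
    cotMap A A'' C C'' (φ' ∘ₗ φ) (ψ' ∘ₗ ψ) x =
      cotMap A' A'' C' C'' φ' ψ' (cotMap A A' C C' φ ψ x) := by
  refine incl_injective A'' C'' ?_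
  rw [cotMap_spec hA hC (hφ'.comp hφ) (hψ'.comp hψ) (fun _ _ a ha => gφ' _ _ _ (gφ _ _ a ha))
    (fun _ _ a ha => gψ' _ _ _ (gψ _ _ a ha)), cotMap_spec hA' hC' hφ' hψ' gφ' gψ',
    cotMap_spec hA hC hφ hψ gφ gψ, tensorMap_comp hφ hψ hφ' hψ']

theorem cotMap_id (x : (cot A C).carrier) :
    cotMap A A C C LinearMap.id LinearMap.id x = x := by
  refine incl_injective A C ?_
  rw [cotMap_spec hA hC isCP_id isCP_id .id .id, tensorMap_id]

theorem exists_cotMap_hom {f : A.carrier →⋆ₐ[ℂ] A'.carrier} {g : C.carrier →⋆ₐ[ℂ] C'.carrier}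
    (gf : IsGraded A A' (lin f)) (gg : IsGraded C C' (lin g)) :
    ∃ k : (cot A C).carrier →⋆ₐ[ℂ] (cot A' C').carrier,
      (∀ x, incl A' C' (k x) = MaxTensor.map f g (incl A C x)) ∧
      lin k = cotMap A A' C C' (lin f) (lin g) := by
  have h := cotMap_spec hA hC (isCP_lin f) (isCP_lin g) gf gg
  obtain ⟨k, hk⟩ := exists_factor_of_injective (g := incl A' C') (incl_injective A' C')
    (f := (MaxTensor.map f g).comp (incl A C)) fun x => ⟨_, (h x).trans (tensorMap_lin f g _)⟩
  refine ⟨k, hk, LinearMap.ext fun x => incl_injective A' C' ?_⟩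
  exact (hk x).trans ((h x).trans (tensorMap_lin f g _)).symm

end CGData

/-! ### Products of `(B,Γ)`-C*-algebras -/

section Factor

variable {X : Type*} {Y : Type*} {Z : Type*} [CStarAlgebra X] [CStarAlgebra Y] [CStarAlgebra Z]

theorem exists_linear_factor {π : X →⋆ₐ[ℂ] Y} (hπ : Function.Surjective π) {f : X →ₗ[ℂ] Z}
    (h : ∀ x, π x = 0 → f x = 0) : ∃ g : Y →ₗ[ℂ] Z, ∀ x, g (π x) = f x := by
  have key : ∀ x y, π x = π y → f x = f y := fun x y e => by
    rw [← sub_eq_zero, ← map_sub]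
    exact h _ (by rw [map_sub, e, sub_self])
  choose σ hσ using hπ
  refine ⟨{ toFun := fun y => f (σ y)
            map_add' := fun y z => ?_
            map_smul' := fun c y => ?_ }, fun x => key _ _ (hσ _)⟩
  · rw [← map_add]; exact key _ _ (by rw [map_add, hσ, hσ, hσ])
  · rw [RingHom.id_apply, ← map_smul]; exact key _ _ (by rw [map_smul, hσ, hσ])

end Factor

namespace CGData

variable {Γ : Type u} [Group Γ] {A C : CGData Γ}

theorem comp_unique {β β' γ γ' : Γ} {a : A.carrier} (h : a ∈ A.comp β β') (h' : a ∈ A.comp γ γ')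
    (h0 : a ≠ 0) : β = γ ∧ β' = γ' := by
  have h1 := proj_self h
  rw [proj_of_mem h'] at h1
  by_contra h2
  rw [if_neg h2] at h1
  exact h0 h1.symm

theorem map_mem_comp {f : A.carrier →⋆ₐ[ℂ] C.carrier}
    (h1 : ∀ a, C.δ (f a) = MaxTensor.map (StarAlgHom.id ℂ _) f (A.δ a))
    (h2 : ∀ a, C.δbar (f a) = MaxTensor.map f (StarAlgHom.id ℂ _) (A.δbar a)) :
    IsGraded A C (lin f) := fun γ γ' a ha => by
  change C.δ (f a) = tmul _ (f a) ∧ C.δbar (f a) = tmul (f a) _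
  rw [h1, h2, ha.1, ha.2, map_tmul, map_tmul]
  exact ⟨rfl, rfl⟩

/-- `φ` and `ψ` need not be multiplicative; left linearity for the particular elements `a` and `c`
suffices for `φ ⊗ ψ` to intertwine left multiplication by `a ⊗ c` and by `a' ⊗ c'`. -/
theorem cotMap_mul (hA : A.IsCG) (hC : C.IsCG) {A' C' : CGData Γ}
    {φ : A.carrier →ₗ[ℂ] A'.carrier} {ψ : C.carrier →ₗ[ℂ] C'.carrier}
    (hφ : IsCP φ) (hψ : IsCP ψ) (gφ : IsGraded A A' φ) (gψ : IsGraded C C' ψ)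
    {y : (cot A C).carrier} {a : A.carrier} {c : C.carrier} (hy : incl A C y = tmul a c)
    {y' : (cot A' C').carrier} {a' : A'.carrier} {c' : C'.carrier}
    (hy' : incl A' C' y' = tmul a' c') (ha : ∀ x, φ (a * x) = a' * φ x)
    (hc : ∀ x, ψ (c * x) = c' * ψ x) (x : (cot A C).carrier) :
    cotMap A A' C C' φ ψ (y * x) = y' * cotMap A A' C C' φ ψ x := by
  refine incl_injective A' C' ?_
  rw [cotMap_spec hA hC hφ hψ gφ gψ, map_mul (incl A C), map_mul (incl A' C'),
    cotMap_spec hA hC hφ hψ gφ gψ, hy, hy']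
  have := clm_ext (f := tensorMap φ ψ ∘L ContinuousLinearMap.mul ℂ _ (tmul a c))
    (g := ContinuousLinearMap.mul ℂ _ (tmul a' c') ∘L tensorMap φ ψ) fun p q => by
      change tensorMap φ ψ (tmul a c * tmul p q) = tmul a' c' * tensorMap φ ψ (tmul p q)
      rw [tmul_mul_tmul, tensorMap_tmul hφ hψ, tensorMap_tmul hφ hψ, tmul_mul_tmul, ha, hc]
  exact DFunLike.congr_fun this (incl A C x)

end CGData

namespace BGData

open CGData

variable {B Γ : Type u} [CommCStarAlgebra B] [Group Γ]

section Morphisms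

variable {A C : BGData B Γ}

theorem IsMor.isGraded {f : A.carrier →⋆ₐ[ℂ] C.carrier} (hf : IsMor A C f) :
    IsGraded A.toCGData C.toCGData (lin f) := map_mem_comp hf.δ hf.δbar

theorem IsMor.isCPMor {f : A.carrier →⋆ₐ[ℂ] C.carrier} (hf : IsMor A C f) :
    IsCPMor A C (lin f) where
  cp := isCP_lin f
  δ a := by rw [tensorMap_id_lin]; exact hf.δ a
  δbar a := by rw [tensorMap_lin_id]; exact hf.δbar a
  linear := hf.linear

theorem IsCPMor.isMor {f : A.carrier →⋆ₐ[ℂ] C.carrier} (hf : IsCPMor A C (lin f)) :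
    IsMor A C f where
  δ a := by rw [← tensorMap_id_lin]; exact hf.δ a
  δbar a := by rw [← tensorMap_lin_id]; exact hf.δbar a
  linear := hf.linear

theorem IsCPMor.isGraded {φ : A.carrier →ₗ[ℂ] C.carrier} (hφ : IsCPMor A C φ) :
    IsGraded A.toCGData C.toCGData φ := isGraded_of_tensorMap hφ.cp hφ.δ hφ.δbar

theorem IsCPMor.map_r_mul {φ : A.carrier →ₗ[ℂ] C.carrier} (hφ : IsCPMor A C φ) (b : B)
    (a : A.carrier) : φ (A.r b * a) = C.r b * φ a := by
  simpa using hφ.linear b 1 a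

theorem IsCPMor.map_s_mul {φ : A.carrier →ₗ[ℂ] C.carrier} (hφ : IsCPMor A C φ) (b : B)
    (a : A.carrier) : φ (A.s b * a) = C.s b * φ a := by
  simpa using hφ.linear 1 b a

theorem IsMor.map_r {f : A.carrier →⋆ₐ[ℂ] C.carrier} (hf : IsMor A C f) (b : B) :
    f (A.r b) = C.r b := by simpa using hf.linear b 1 1

theorem IsMor.map_s {f : A.carrier →⋆ₐ[ℂ] C.carrier} (hf : IsMor A C f) (b : B) :
    f (A.s b) = C.s b := by simpa using hf.linear 1 b 1

theorem isCPMor_of_isGraded {φ : A.carrier →ₗ[ℂ] C.carrier} (hA : A.IsCG) (hcp : IsCP φ)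
    (hφ : IsGraded A.toCGData C.toCGData φ) (hr : ∀ b a, φ (A.r b * a) = C.r b * φ a)
    (hs : ∀ b a, φ (A.s b * a) = C.s b * φ a) : IsCPMor A C φ where
  cp := hcp
  δ := hφ.δ_apply hcp hA
  δbar := hφ.δbar_apply hcp hA
  linear b b' a := by rw [mul_assoc, hr, hs, mul_assoc]

theorem isMor_of_isGraded {f : A.carrier →⋆ₐ[ℂ] C.carrier} (hA : A.IsCG)
    (hf : IsGraded A.toCGData C.toCGData (lin f)) (hr : ∀ b, f (A.r b) = C.r b)
    (hs : ∀ b, f (A.s b) = C.s b) : IsMor A C f :=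
  (isCPMor_of_isGraded hA (isCP_lin f) hf
    (fun b a => (map_mul f _ _).trans (congrArg (· * f a) (hr b)))
    fun b a => (map_mul f _ _).trans (congrArg (· * f a) (hs b))).isMor

theorem IsCPMor.id : IsCPMor A A LinearMap.id where
  cp := isCP_id
  δ _ := (tensorMap_id _).symm
  δbar _ := (tensorMap_id _).symm
  linear _ _ _ := rfl

theorem IsMor.isIso {f : A.carrier →⋆ₐ[ℂ] C.carrier} (hf : IsMor A C f)
    (h1 : Function.Injective f) (h2 : Function.Surjective f) : IsIso A C f := by
  obtain ⟨g, hg⟩ := exists_factor_of_surjective h2 (f := StarAlgHom.id ℂ A.carrier)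
    fun x hx => (injective_iff_map_eq_zero f).1 h1 x hx
  have hfg : ∀ c, f (g c) = c := fun c => by obtain ⟨a, rfl⟩ := h2 c; rw [hg]; rfl
  refine ⟨hf, g, ⟨fun c => ?_, fun c => ?_, fun b b' c => h1 ?_⟩, hg, hfg⟩
  · obtain ⟨a, rfl⟩ := h2 c
    rw [hf.δ, hg]
    exact (DFunLike.congr_fun (hom_ext_tmul (f := (MaxTensor.map (StarAlgHom.id ℂ _) g).comp
      (MaxTensor.map (StarAlgHom.id ℂ _) f)) (g := StarAlgHom.id ℂ _)
      fun x y => by simp [hg]) (A.δ a)).symm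
  · obtain ⟨a, rfl⟩ := h2 c
    rw [hf.δbar, hg]
    exact (DFunLike.congr_fun (hom_ext_tmul (f := (MaxTensor.map g (StarAlgHom.id ℂ _)).comp
      (MaxTensor.map f (StarAlgHom.id ℂ _))) (g := StarAlgHom.id ℂ _)
      fun x y => by simp [hg]) (A.δbar a)).symm
  · rw [hfg, hf.linear, hfg]

end Morphisms

variable [CStarAction B Γ]

theorem isBG_of_clspan {A : BGData B Γ} {S : Set A.carrier} (hS : clspan S = ⊤)
    (r_mem : ∀ b, A.r b ∈ A.comp 1 1) (s_mem : ∀ b, A.s b ∈ A.comp 1 1)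
    (r_comm_s : ∀ b b', A.r b * A.s b' = A.s b' * A.r b)
    (h : ∀ x ∈ S, ∃ γ γ', x ∈ A.comp γ γ' ∧
      ∀ b, x * A.r b = A.r (γ • b) * x ∧ x * A.s b = A.s (γ' • b) * x) : A.IsBG := by
  have hhom : S ⊆ A.toCGData.homog := fun x hx => by
    obtain ⟨γ, γ', h1, -⟩ := h x hx
    exact ⟨γ, γ', h1⟩
  have key : ∀ γ γ', ∀ x ∈ S ∩ A.comp γ γ', ∀ b,
      x * A.r b = A.r (γ • b) * x ∧ x * A.s b = A.s (γ' • b) * x := fun γ γ' x hx b => by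
    obtain ⟨β, β', h1, h2⟩ := h x hx.1
    -- Zero has every bidegree, so the bidegree supplied by `h` is the given one only when `x ≠ 0`.
    by_cases h0 : x = 0
    · simp [h0]
    · obtain ⟨rfl, rfl⟩ := comp_unique h1 hx.2 h0
      exact h2 b
  exact {
    toIsCG := isCG_of_clspan hS hhom
    r_mem := r_mem
    s_mem := s_mem
    r_comm_s := r_comm_s
    mul_r := fun γ γ' a ha b => eqOn_clspan
      (f := (ContinuousLinearMap.mul ℂ A.carrier).flip (A.r b))
      (g := ContinuousLinearMap.mul ℂ A.carrier (A.r (γ • b)))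
      (fun x hx => (key γ γ' x hx b).1) (mem_clspan_comp hS hhom ha)
    mul_s := fun γ γ' a ha b => eqOn_clspan
      (f := (ContinuousLinearMap.mul ℂ A.carrier).flip (A.s b))
      (g := ContinuousLinearMap.mul ℂ A.carrier (A.s (γ' • b)))
      (fun x hx => (key γ γ' x hx b).2) (mem_clspan_comp hS hhom ha) }

section Incl

variable (A C : BGData B Γ)

/-- The inclusion of the cotensor product of `(B,Γ)`-C*-algebras in the maximal tensor product. -/
noncomputable def emb : (cot A C).carrier →⋆ₐ[ℂ] MaxTensor A.carrier C.carrier :=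
  incl A.toCGData C.toCGData

/-- The elementary tensors in the cotensor product. -/
def gen : Set (cot A C).carrier := cotGen A.toCGData C.toCGData

theorem emb_injective : Function.Injective (emb A C) := incl_injective _ _

variable {A C}

theorem mem_gen {x : (cot A C).carrier} : x ∈ gen A C ↔
    ∃ β γ β', ∃ a ∈ A.comp β γ, ∃ c ∈ C.comp γ β', emb A C x = tmul a c := Iff.rfl

theorem mem_tSet {x : (cot A C).carrier} :
    x ∈ tSet A C ↔ ∃ b, emb A C x = tmul (A.s b) 1 - tmul 1 (C.r b) := Iff.rfl

theorem exists_emb_eq_tmul {γ : Γ} {a : A.carrier} {c : C.carrier}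
    (ha : A.δbar a = tmul a (uG γ)) (hc : C.δ c = tmul (uG γ) c) :
    ∃ y, emb A C y = tmul a c :=
  exists_incl_eq_tmul ha hc

theorem clspan_gen (hA : A.IsCG) (hC : C.IsCG) : clspan (gen A C) = ⊤ := clspan_cotGen hA hC

theorem mem_comp_of_emb (hA : A.IsCG) (hC : C.IsCG) {β γ γ' β' : Γ} {a : A.carrier}
    {c : C.carrier} (ha : a ∈ A.comp β γ) (hc : c ∈ C.comp γ' β') {x : (cot A C).carrier}
    (hx : emb A C x = tmul a c) : x ∈ (cot A C).comp β β' :=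
  mem_cot_comp hA hC ha hc hx

theorem gen_subset_homog (hA : A.IsCG) (hC : C.IsCG) : gen A C ⊆ (cot A C).homog :=
  cotGen_subset_homog hA hC

variable {A' C' : BGData B Γ} (φ : A.carrier →ₗ[ℂ] A'.carrier) (ψ : C.carrier →ₗ[ℂ] C'.carrier)

/-- The map between cotensor products induced by `φ` and `ψ`. -/
noncomputable def mapCot : (cot A C).carrier →ₗ[ℂ] (cot A' C').carrier :=
  cotMap A.toCGData A'.toCGData C.toCGData C'.toCGData φ ψ

variable {φ ψ} (hA : A.IsCG) (hC : C.IsCG) (hφ : IsCPMor A A' φ) (hψ : IsCPMor C C' ψ)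
include hA hC hφ hψ

theorem mapCot_spec (x : (cot A C).carrier) :
    emb A' C' (mapCot φ ψ x) = tensorMap φ ψ (emb A C x) :=
  cotMap_spec hA hC hφ.cp hψ.cp hφ.isGraded hψ.isGraded x

theorem isCP_mapCot : IsCP (mapCot (A := A) (A' := A') (C := C) (C' := C') φ ψ) :=
  isCP_cotMap hA hC hφ.cp hψ.cp hφ.isGraded hψ.isGraded

theorem isGraded_mapCot (hA' : A'.IsCG) (hC' : C'.IsCG) :
    IsGraded (cot A C).toCGData (cot A' C').toCGData (mapCot φ ψ) :=
  isGraded_cotMap hA hC hA' hC' hφ.cp hψ.cp hφ.isGraded hψ.isGraded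

theorem mapCot_mul {y : (cot A C).carrier} {a : A.carrier} {c : C.carrier}
    (hy : emb A C y = tmul a c) {y' : (cot A' C').carrier} {a' : A'.carrier} {c' : C'.carrier}
    (hy' : emb A' C' y' = tmul a' c') (ha : ∀ x, φ (a * x) = a' * φ x)
    (hc : ∀ x, ψ (c * x) = c' * ψ x) (x : (cot A C).carrier) :
    mapCot (A := A) (A' := A') (C := C) (C' := C') φ ψ (y * x) = y' * mapCot φ ψ x :=
  cotMap_mul hA hC hφ.cp hψ.cp hφ.isGraded hψ.isGraded hy hy' ha hc x

theorem mapCot_comp (hA' : A'.IsCG) (hC' : C'.IsCG) {A'' C'' : BGData B Γ}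
    {φ' : A'.carrier →ₗ[ℂ] A''.carrier} {ψ' : C'.carrier →ₗ[ℂ] C''.carrier}
    (hφ' : IsCPMor A' A'' φ') (hψ' : IsCPMor C' C'' ψ') (x : (cot A C).carrier) :
    mapCot (A := A) (A' := A'') (C := C) (C' := C'') (φ' ∘ₗ φ) (ψ' ∘ₗ ψ) x =
      mapCot (A := A') (A' := A'') (C := C') (C' := C'') φ' ψ' (mapCot φ ψ x) :=
  cotMap_comp hA hC hA' hC' hφ.cp hψ.cp hφ.isGraded hψ.isGraded hφ'.cp hψ'.cp hφ'.isGraded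
    hψ'.isGraded x

omit hφ hψ

theorem mapCot_id (x : (cot A C).carrier) :
    mapCot (A := A) (A' := A) (C := C) (C' := C) LinearMap.id LinearMap.id x = x :=
  cotMap_id hA hC x

theorem exists_mapCot_hom {f : A.carrier →⋆ₐ[ℂ] A'.carrier} {g : C.carrier →⋆ₐ[ℂ] C'.carrier}
    (hf : IsMor A A' f) (hg : IsMor C C' g) :
    ∃ k : (cot A C).carrier →⋆ₐ[ℂ] (cot A' C').carrier, ∀ x, mapCot (lin f) (lin g) x = k x := by
  obtain ⟨k, -, hk⟩ := exists_cotMap_hom hA hC hf.isGraded hg.isGraded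
  exact ⟨k, fun x => (DFunLike.congr_fun hk x).symm⟩

end Incl

/-! ### Cotensor product and quotient as `(B,Γ)`-C*-algebras -/

section Cot

variable {A C : BGData B Γ} (hA : A.IsBG) (hC : C.IsBG)

include hA in
theorem cot_r (b : B) : emb A C ((cot A C).r b) = tmul (A.r b) 1 := by
  refine Classical.epsilon_spec (p := fun f : B →⋆ₐ[ℂ] (cot A C).carrier =>
    ∀ b, emb A C (f b) = tmul (A.r b) 1) ?_ b
  obtain ⟨k, hk⟩ := exists_factor_of_injective (emb_injective A C)
    (f := (inl C.carrier).comp A.r) fun b => exists_emb_eq_tmul (hA.r_mem b).2 one_mem_comp.1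
  exact ⟨k, hk⟩

include hC in
theorem cot_s (b : B) : emb A C ((cot A C).s b) = tmul 1 (C.s b) := by
  refine Classical.epsilon_spec (p := fun f : B →⋆ₐ[ℂ] (cot A C).carrier =>
    ∀ b, emb A C (f b) = tmul 1 (C.s b)) ?_ b
  obtain ⟨k, hk⟩ := exists_factor_of_injective (emb_injective A C)
    (f := (inr A.carrier).comp C.s) fun b => exists_emb_eq_tmul one_mem_comp.2 (hC.s_mem b).1
  exact ⟨k, hk⟩

include hA in
theorem exists_incl_s (b : B) : ∃ y, emb A C y = tmul (A.s b) 1 :=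
  exists_emb_eq_tmul (hA.s_mem b).2 one_mem_comp.1

include hC in
theorem exists_incl_r (b : B) : ∃ y, emb A C y = tmul 1 (C.r b) :=
  exists_emb_eq_tmul one_mem_comp.2 (hC.r_mem b).1

include hA hC

theorem isBG_cot : (cot A C).IsBG := by
  refine isBG_of_clspan (clspan_gen hA.toIsCG hC.toIsCG)
    (fun b => mem_comp_of_emb hA.toIsCG hC.toIsCG (hA.r_mem b) one_mem_comp (cot_r hA b))
    (fun b => mem_comp_of_emb hA.toIsCG hC.toIsCG one_mem_comp (hC.s_mem b) (cot_s hC b))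
    (fun b b' => emb_injective A C ?_) ?_
  · rw [map_mul, map_mul, cot_r hA, cot_s hC, tmul_mul_tmul, tmul_mul_tmul, mul_one, one_mul,
      one_mul, mul_one]
  · intro x hx
    obtain ⟨β, γ, β', a, ha, c, hc, h⟩ := mem_gen.1 hx
    refine ⟨β, β', mem_comp_of_emb hA.toIsCG hC.toIsCG ha hc h, fun b =>
      ⟨emb_injective A C ?_, emb_injective A C ?_⟩⟩
    · rw [map_mul, map_mul, cot_r hA, cot_r hA, h, tmul_mul_tmul, tmul_mul_tmul, mul_one, one_mul,
        hA.mul_r _ _ a ha]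
    · rw [map_mul, map_mul, cot_s hC, cot_s hC, h, tmul_mul_tmul, tmul_mul_tmul, mul_one, one_mul,
        hC.mul_s _ _ c hc]

theorem exists_tSet (b : B) : ∃ y, emb A C y =
    tmul (A.s b) 1 - tmul 1 (C.r b) := by
  obtain ⟨y, hy⟩ := exists_incl_s (C := C) hA b
  obtain ⟨z, hz⟩ := exists_incl_r (A := A) hC b
  exact ⟨y - z, by rw [map_sub, hy, hz]⟩

/-- The generators of the ideal are fixed by both coactions, which is why the coactions descend to
the quotient. -/
theorem tSet_subset_comp : tSet A C ⊆ (cot A C).comp 1 1 := by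
  intro x hx
  obtain ⟨b, hb⟩ := mem_tSet.1 hx
  obtain ⟨y, hy⟩ := exists_incl_s (C := C) hA b
  obtain ⟨z, hz⟩ := exists_incl_r (A := A) hC b
  have hx : x = y - z := emb_injective A C (by rw [map_sub, hb, hy, hz])
  have h1 := mem_comp_of_emb hA.toIsCG hC.toIsCG (hA.s_mem b) one_mem_comp hy
  have h2 := mem_comp_of_emb hA.toIsCG hC.toIsCG one_mem_comp (hC.r_mem b) hz
  rw [mem_comp] at *
  change x ∈ (cot A C).comp 1 1
  rw [mem_comp, hx, map_sub, map_sub, h1.1, h1.2, h2.1, h2.2, tmul_sub, sub_tmul]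
  exact ⟨rfl, rfl⟩

/-- Let `y = a ⊗ c` have middle degree `γ`. Then `a s(b) = s(γ b) a` and `c r(b) = r(γ b) c` give `y
t(b) = t(γ b) y`. So the closed right ideal generated by `t(B)` is already two-sided. Keeping `t` on
the left is what makes the ideal accessible to maps that are only left linear. -/
theorem closedIdeal_tSet_le {x : (cot A C).carrier} (hx : x ∈ closedIdeal (tSet A C)) :
    x ∈ clspan (Set.image2 (· * ·) (tSet A C) (Set.univ : Set (cot A C).carrier)) := by
  set T : Set (cot A C).carrier := Set.image2 (· * ·) (tSet A C) Set.univ with hT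
  have hleft : ∀ y z, z ∈ clspan T → y * z ∈ clspan T := fun y z hz => by
    have hy : y ∈ clspan (gen A C) := by
      rw [clspan_gen hA.toIsCG hC.toIsCG]; exact Submodule.mem_top
    refine map_mem_clspan T ((ContinuousLinearMap.mul ℂ (cot A C).carrier).flip z)
      (fun y hy => ?_) hy
    refine map_mem_clspan T (ContinuousLinearMap.mul ℂ (cot A C).carrier y) ?_ hz
    rintro _ ⟨t, ht, w, -, rfl⟩
    obtain ⟨b, hb⟩ := mem_tSet.1 ht
    obtain ⟨β, γ, β', a, ha, c, hc, h⟩ := mem_gen.1 hy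
    obtain ⟨t', ht'⟩ := exists_tSet hA hC (γ • b)
    have : y * t = t' * y := emb_injective A C (by
      rw [map_mul, map_mul, hb, ht', h, mul_sub, sub_mul]
      simp only [tmul_mul_tmul, mul_one, one_mul]
      rw [hA.mul_s _ _ a ha, hC.mul_r _ _ c hc])
    refine subset_clspan ⟨t', ⟨γ • b, ht'⟩, y * w, trivial, ?_⟩
    change t' * (y * w) = y * (t * w)
    rw [← mul_assoc, ← mul_assoc, this]
  have hright : ∀ y z, z ∈ clspan T → z * y ∈ clspan T := fun y z hz => by
    refine map_mem_clspan T ((ContinuousLinearMap.mul ℂ (cot A C).carrier).flip y) ?_ hz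
    rintro _ ⟨t, ht, w, -, rfl⟩
    exact subset_clspan ⟨t, ht, w * y, trivial, (mul_assoc t w y).symm⟩
  let I : Ideal (cot A C).carrier :=
    { carrier := clspan T
      add_mem' := fun h h' => add_mem h h'
      zero_mem' := zero_mem _
      smul_mem' := fun y z hz => hleft y z hz }
  have : I.IsTwoSided := ⟨fun {z} y hz => hright y z hz⟩
  exact closedIdeal_le (I := I) (isClosed_clspan T)
    (fun t ht => subset_clspan ⟨t, ht, 1, trivial, mul_one t⟩) hx

omit hA hC [CStarAction B Γ] in
theorem q_surjective : Function.Surjective (q A C) := quotMk_surjective _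

omit hA hC [CStarAction B Γ] in
theorem q_eq_zero {x : (cot A C).carrier} : q A C x = 0 ↔ x ∈ closedIdeal (tSet A C) :=
  quotMk_eq_zero _

omit hA hC [CStarAction B Γ] in
theorem q_tSet {x : (cot A C).carrier} (hx : x ∈ tSet A C) : q A C x = 0 :=
  q_eq_zero.2 (subset_closedIdeal hx)

theorem prod_δ (x : (cot A C).carrier) :
    (prod A C).δ (q A C x) = MaxTensor.map (StarAlgHom.id ℂ _) (q A C) ((cot A C).δ x) := by
  refine Classical.epsilon_spec (p := fun f : ProdAlg A C →⋆ₐ[ℂ] MaxTensor (GroupCStar Γ)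
    (ProdAlg A C) => ∀ x, f (prodMk A C x) =
      MaxTensor.map (StarAlgHom.id ℂ _) (prodMk A C) ((cot A C).δ x)) ?_ x
  obtain ⟨k, hk⟩ := exists_factor_of_surjective (q_surjective (A := A) (C := C))
    (f := (MaxTensor.map (StarAlgHom.id ℂ (GroupCStar Γ)) (q A C)).comp (cot A C).δ)
    fun x hx => map_eq_zero_of_mem_closedIdeal (fun t ht => by
      rw [StarAlgHom.comp_apply, (tSet_subset_comp hA hC ht).1, map_tmul, q_tSet ht, tmul_zero])
      (q_eq_zero.1 hx)
  exact ⟨k, hk⟩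

theorem prod_δbar (x : (cot A C).carrier) :
    (prod A C).δbar (q A C x) = MaxTensor.map (q A C) (StarAlgHom.id ℂ _) ((cot A C).δbar x) := by
  refine Classical.epsilon_spec (p := fun f : ProdAlg A C →⋆ₐ[ℂ] MaxTensor
    (ProdAlg A C) (GroupCStar Γ) => ∀ x, f (prodMk A C x) =
      MaxTensor.map (prodMk A C) (StarAlgHom.id ℂ _) ((cot A C).δbar x)) ?_ x
  obtain ⟨k, hk⟩ := exists_factor_of_surjective (q_surjective (A := A) (C := C))
    (f := (MaxTensor.map (q A C) (StarAlgHom.id ℂ (GroupCStar Γ))).comp (cot A C).δbar)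
    fun x hx => map_eq_zero_of_mem_closedIdeal (fun t ht => by
      rw [StarAlgHom.comp_apply, (tSet_subset_comp hA hC ht).2, map_tmul, q_tSet ht, zero_tmul])
      (q_eq_zero.1 hx)
  exact ⟨k, hk⟩

theorem isMor_q : IsMor (cot A C) (prod A C) (q A C) where
  δ := prod_δ hA hC
  δbar := prod_δbar hA hC
  linear b b' x := by rw [map_mul, map_mul]; rfl

theorem isBG_prod : (prod A C).IsBG := by
  have h := isBG_cot hA hC
  have hq := isMor_q hA hC
  refine isBG_of_clspan (A := prod A C) (clspan_image_of_surjective (q_surjective (A := A) (C := C))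
      (clspan_gen hA.toIsCG hC.toIsCG))
    (fun b => hq.isGraded _ _ _ (h.r_mem b)) (fun b => hq.isGraded _ _ _ (h.s_mem b))
    (fun b b' => ?_) ?_
  · rw [← hq.map_r, ← hq.map_s, ← map_mul, ← map_mul, h.r_comm_s]
  · rintro _ ⟨x, hx, rfl⟩
    obtain ⟨β, β', hβ⟩ := gen_subset_homog hA.toIsCG hC.toIsCG hx
    refine ⟨β, β', hq.isGraded _ _ _ hβ, fun b => ?_⟩
    rw [← hq.map_r, ← hq.map_r, ← hq.map_s, ← hq.map_s, ← map_mul, ← map_mul, ← map_mul,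
      ← map_mul, h.mul_r _ _ x hβ, h.mul_s _ _ x hβ]
    exact ⟨rfl, rfl⟩

theorem prodWellDefined : ProdWellDefined A C where
  cot_δ := isCotδ_cot hA.toIsCG hC.toIsCG
  cot_δ_unique _ hf := isCotδ_unique hA.toIsCG hC.toIsCG hf (isCotδ_cot hA.toIsCG hC.toIsCG)
  cot_δbar := isCotδbar_cot hA.toIsCG hC.toIsCG
  cot_δbar_unique _ hf :=
    isCotδbar_unique hA.toIsCG hC.toIsCG hf (isCotδbar_cot hA.toIsCG hC.toIsCG)
  cot_r := cot_r hA
  cot_s := cot_s hC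
  cot_isBG := isBG_cot hA hC
  t_mem b := by
    obtain ⟨y, hy⟩ := exists_tSet hA hC b
    rw [← hy]
    exact y.2
  prod_isBG := isBG_prod hA hC
  q_isMor := isMor_q hA hC

end Cot

/-! ### Functoriality for completely positive maps -/

section Maps

variable {A A' C C' : BGData B Γ} (hA : A.IsBG) (hA' : A'.IsBG) (hC : C.IsBG) (hC' : C'.IsBG)
  {φ : A.carrier →ₗ[ℂ] A'.carrier} {ψ : C.carrier →ₗ[ℂ] C'.carrier}
  (hφ : IsCPMor A A' φ) (hψ : IsCPMor C C' ψ)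

include hA hA' hC hC' hφ hψ

theorem isCPMor_mapCot : IsCPMor (cot A C) (cot A' C')
    (mapCot (A := A) (A' := A') (C := C) (C' := C') φ ψ) := by
  refine isCPMor_of_isGraded (isBG_cot hA hC).toIsCG
    (isCP_mapCot hA.toIsCG hC.toIsCG hφ hψ)
    (isGraded_mapCot hA.toIsCG hC.toIsCG hφ hψ hA'.toIsCG hC'.toIsCG) (fun b x => ?_) fun b x => ?_
  · exact mapCot_mul hA.toIsCG hC.toIsCG hφ hψ (cot_r hA b)
      (cot_r hA' b) (hφ.map_r_mul b) (fun x => by rw [one_mul, one_mul]) x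
  · exact mapCot_mul hA.toIsCG hC.toIsCG hφ hψ (cot_s hC b)
      (cot_s hC' b) (fun x => by rw [one_mul, one_mul]) (hψ.map_s_mul b) x

/-- The ideal is the closed span of products `t w` with `t = s b ⊗ 1 - 1 ⊗ r b` on the left. Left
linearity of `φ` over `s` and of `ψ` over `r` sends `t w` to the corresponding `t'` times the image
of `w`. -/
theorem mapCot_mem_closedIdeal {x : (cot A C).carrier} (hx : x ∈ closedIdeal (tSet A C)) :
    q A' C' (mapCot φ ψ x) = 0 := by
  have hcp := isCP_mapCot hA.toIsCG hC.toIsCG hφ hψ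
  refine eqOn_clspan (f := homL (q A' C') ∘L ⟨_, hcp.continuous⟩) (g := 0) ?_
    (closedIdeal_tSet_le hA hC hx)
  rintro _ ⟨t, ht, w, -, rfl⟩
  obtain ⟨b, hb⟩ := mem_tSet.1 ht
  change q A' C' (mapCot (A' := A') (C' := C') φ ψ (t * w)) = 0
  obtain ⟨y, hy⟩ := exists_incl_s (C := C) hA b
  obtain ⟨z, hz⟩ := exists_incl_r (A := A) hC b
  obtain ⟨y', hy'⟩ := exists_incl_s (C := C') hA' b
  obtain ⟨z', hz'⟩ := exists_incl_r (A := A') hC' b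
  have ht : t = y - z := emb_injective A C (by rw [map_sub, hb, hy, hz])
  rw [ht, sub_mul, map_sub, mapCot_mul hA.toIsCG hC.toIsCG hφ hψ hy
    hy' (hφ.map_s_mul b) (fun x => by rw [one_mul, one_mul]) w,
    mapCot_mul hA.toIsCG hC.toIsCG hφ hψ hz
    hz' (fun x => by rw [one_mul, one_mul]) (hψ.map_r_mul b) w, ← sub_mul, map_mul,
    q_tSet (mem_tSet.2 ⟨b, by rw [map_sub, hy', hz']⟩), zero_mul]

theorem prodMap_q (x : (cot A C).carrier) : prodMap A A' C C' φ ψ (q A C x) =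
    q A' C' (mapCot φ ψ x) := by
  refine Classical.epsilon_spec (p := fun F : (prod A C).carrier →ₗ[ℂ] (prod A' C').carrier =>
    ∀ x, F (q A C x) = q A' C' (mapCot φ ψ x)) ?_ x
  exact exists_linear_factor (q_surjective (A := A) (C := C))
    (f := lin (q A' C') ∘ₗ mapCot φ ψ)
    fun x hx => mapCot_mem_closedIdeal hA hA' hC hC' hφ hψ (q_eq_zero.1 hx)

theorem isCPMor_prodMap : IsCPMor (prod A C) (prod A' C') (prodMap A A' C C' φ ψ) := by
  have hcot := isCPMor_mapCot hA hA' hC hC' hφ hψ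
  have hspec := prodMap_q hA hA' hC hC' hφ hψ
  have hcp : IsCP (prodMap A A' C C' φ ψ) := hcot.cp.of_surjective q_surjective (q A' C') hspec
  have hq := isMor_q hA hC
  have hq' := isMor_q hA' hC'
  refine isCPMor_of_isGraded (isBG_prod hA hC).toIsCG hcp ?_ (fun b y => ?_) fun b y => ?_
  · refine isGraded_of_clspan (clspan_image_of_surjective (q_surjective (A := A) (C := C))
      (clspan_gen hA.toIsCG hC.toIsCG)) hcp ?_
    rintro _ ⟨x, hx, rfl⟩
    obtain ⟨β, β', hβ⟩ := gen_subset_homog hA.toIsCG hC.toIsCG hx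
    refine ⟨β, β', hq.isGraded _ _ _ hβ, ?_⟩
    rw [hspec]
    exact hq'.isGraded _ _ _ (hcot.isGraded _ _ _ hβ)
  · obtain ⟨x, rfl⟩ := q_surjective y
    rw [← hq.map_r, ← hq'.map_r, ← map_mul, hspec, hcot.map_r_mul, hspec, map_mul]
  · obtain ⟨x, rfl⟩ := q_surjective y
    rw [← hq.map_s, ← hq'.map_s, ← map_mul, hspec, hcot.map_s_mul, hspec, map_mul]

theorem mapWellDefined : MapWellDefined A A' C C' φ ψ where
  tensor_spec := tensorMap_tmul hφ.cp hψ.cp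
  cot_spec := cotMap_spec hA.toIsCG hC.toIsCG hφ.cp hψ.cp hφ.isGraded hψ.isGraded
  cot_isCPMor := isCPMor_mapCot hA hA' hC hC' hφ hψ
  prod_spec := prodMap_q hA hA' hC hC' hφ hψ
  prod_isCPMor := isCPMor_prodMap hA hA' hC hC' hφ hψ

theorem prodMap_comp {A'' C'' : BGData B Γ} (hA'' : A''.IsBG) (hC'' : C''.IsBG)
    {φ' : A'.carrier →ₗ[ℂ] A''.carrier} {ψ' : C'.carrier →ₗ[ℂ] C''.carrier}
    (hφ' : IsCPMor A' A'' φ') (hψ' : IsCPMor C' C'' ψ') :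
    prodMap A A'' C C'' (φ' ∘ₗ φ) (ψ' ∘ₗ ψ) =
      prodMap A' A'' C' C'' φ' ψ' ∘ₗ prodMap A A' C C' φ ψ := by
  have hc : ∀ {X Y Z : BGData B Γ} {f : X.carrier →ₗ[ℂ] Y.carrier} {g : Y.carrier →ₗ[ℂ] Z.carrier}
      (_ : X.IsBG) (_ : IsCPMor X Y f) (_ : IsCPMor Y Z g), IsCPMor X Z (g ∘ₗ f) :=
    fun hX hf hg => isCPMor_of_isGraded hX.toIsCG (hg.cp.comp hf.cp)
      (fun _ _ a ha => hg.isGraded _ _ _ (hf.isGraded _ _ a ha))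
      (fun b a => by rw [LinearMap.comp_apply, hf.map_r_mul, hg.map_r_mul]; rfl)
      fun b a => by rw [LinearMap.comp_apply, hf.map_s_mul, hg.map_s_mul]; rfl
  refine LinearMap.ext fun y => ?_
  obtain ⟨x, rfl⟩ := q_surjective y
  rw [LinearMap.comp_apply, prodMap_q hA hA' hC hC' hφ hψ, prodMap_q hA' hA'' hC' hC'' hφ' hψ',
    prodMap_q hA hA'' hC hC'' (hc hA hφ hφ') (hc hC hψ hψ'), mapCot_comp hA.toIsCG hC.toIsCG
      hφ hψ hA'.toIsCG hC'.toIsCG hφ' hψ']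

end Maps

theorem prodMap_id {A C : BGData B Γ} (hA : A.IsBG) (hC : C.IsBG) :
    prodMap A A C C LinearMap.id LinearMap.id = LinearMap.id := by
  refine LinearMap.ext fun y => ?_
  obtain ⟨x, rfl⟩ := q_surjective y
  rw [prodMap_q hA hA hC hC .id .id, mapCot_id hA.toIsCG hC.toIsCG]
  rfl

theorem exists_prodMap_hom {A A' C C' : BGData B Γ} (hA : A.IsBG) (hA' : A'.IsBG) (hC : C.IsBG)
    (hC' : C'.IsBG) {f : A.carrier →⋆ₐ[ℂ] A'.carrier} {g : C.carrier →⋆ₐ[ℂ] C'.carrier}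
    (hf : IsMor A A' f) (hg : IsMor C C' g) :
    ∃ θ : (prod A C).carrier →⋆ₐ[ℂ] (prod A' C').carrier,
      IsMor (prod A C) (prod A' C') θ ∧ lin θ = prodMap A A' C C' (lin f) (lin g) := by
  obtain ⟨k, hk'⟩ := exists_mapCot_hom hA.toIsCG hC.toIsCG hf hg
  obtain ⟨θ, hθ⟩ := exists_factor_of_surjective (q_surjective (A := A) (C := C))
    (f := (q A' C').comp k) fun x hx => by
      have := mapCot_mem_closedIdeal hA hA' hC hC' hf.isCPMor hg.isCPMor (q_eq_zero.1 hx)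
      rwa [hk'] at this
  have h : lin θ = prodMap A A' C C' (lin f) (lin g) := by
    refine LinearMap.ext fun y => ?_
    obtain ⟨x, rfl⟩ := q_surjective y
    rw [prodMap_q hA hA' hC hC' hf.isCPMor hg.isCPMor, hk']
    exact hθ x
  refine ⟨θ, IsCPMor.isMor ?_, h⟩
  rw [h]
  exact isCPMor_prodMap hA hA' hC hC' hf.isCPMor hg.isCPMor

end BGData

/-! ### The full crossed product -/

section Crossed

open SkewMonoidAlgebra (single single_mul_single)

variable {B Γ : Type u} [CommCStarAlgebra B] [Group Γ] [CStarAction B Γ]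

/-- The element `b γ` of the full crossed product. -/
noncomputable def cr (b : B) (γ : Γ) : FullCrossed B Γ :=
  Envelope.of (SkewMonoidAlgebra B Γ) (single γ b)

theorem incl_eq_cr (b : B) : FullCrossed.incl B Γ b = cr b 1 := rfl

theorem coe_u_eq_cr (γ : Γ) : (FullCrossed.u B Γ γ : FullCrossed B Γ) = cr 1 γ := rfl

theorem cr_mul_cr (b b' : B) (γ γ' : Γ) : cr b γ * cr b' γ' = cr (b * γ • b') (γ * γ') := by
  rw [cr, cr, cr, ← map_mul, single_mul_single]

theorem cr_eq (b : B) (γ : Γ) : cr b γ = FullCrossed.incl B Γ b * FullCrossed.u B Γ γ := by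
  rw [incl_eq_cr, coe_u_eq_cr, cr_mul_cr, smul_one, mul_one, one_mul]

variable (B Γ) in
theorem clspan_cr : clspan {x : FullCrossed B Γ | ∃ b γ, x = cr b γ} = ⊤ := by
  have h : Submodule.span ℂ {x : SkewMonoidAlgebra B Γ | ∃ b γ, x = single γ b} = ⊤ := by
    refine eq_top_iff.2 fun x _ => ?_
    induction x using SkewMonoidAlgebra.induction_on with
    | zero => exact zero_mem _
    | single γ b => exact Submodule.subset_span ⟨b, γ, rfl⟩
    | add f g hf hg => exact add_mem (hf trivial) (hg trivial)
  refine top_unique ((clspan_range_of h).symm.trans_le (clspan_mono ?_))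
  rintro _ ⟨_, ⟨b, γ, rfl⟩, rfl⟩
  exact ⟨b, γ, rfl⟩

theorem FullCrossed.lift_cr {D : Type*} [CStarAlgebra D] (π : B →⋆ₐ[ℂ] D) (w : Γ →* unitary D)
    (h : ∀ γ b, π (γ • b) * (w γ : D) = w γ * π b) (b : B) (γ : Γ) :
    FullCrossed.lift π w h (cr b γ) = π b * w γ := by
  rw [FullCrossed.lift, cr, Envelope.lift_of]
  exact SkewMonoidAlgebra.liftNC_single _ _ _ _

theorem coactL_cr (b : B) (γ : Γ) :
    FullCrossed.coactL B Γ (cr b γ) = tmul (uG γ) (cr b γ) := by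
  rw [FullCrossed.coactL, FullCrossed.lift_cr]
  change tmul 1 (FullCrossed.incl B Γ b) * tmul (uG γ) _ = _
  rw [tmul_mul_tmul, one_mul, ← cr_eq]

theorem coactR_cr (b : B) (γ : Γ) :
    FullCrossed.coactR B Γ (cr b γ) = tmul (cr b γ) (uG γ) := by
  rw [FullCrossed.coactR, FullCrossed.lift_cr]
  change tmul (FullCrossed.incl B Γ b) 1 * tmul _ (uG γ) = _
  rw [tmul_mul_tmul, one_mul, ← cr_eq]

theorem ofGroup_uG (γ : Γ) : FullCrossed.ofGroup B Γ (uG γ) = cr 1 γ :=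
  GroupCStar.lift_u _ γ

theorem cr_mem_comp (b : B) (γ : Γ) : cr b γ ∈ (unit B Γ).comp γ γ :=
  ⟨coactL_cr b γ, coactR_cr b γ⟩

theorem isBG_unit : (unit B Γ).IsBG := by
  refine isBG_of_clspan (A := unit B Γ) (clspan_cr B Γ) (fun b => cr_mem_comp b 1)
    (fun b => cr_mem_comp b 1) (fun b b' => ?_) ?_
  · change FullCrossed.incl B Γ b * FullCrossed.incl B Γ b' =
      FullCrossed.incl B Γ b' * FullCrossed.incl B Γ b
    rw [← map_mul, ← map_mul, mul_comm]
  · rintro _ ⟨b, γ, rfl⟩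
    have h : ∀ b', cr b γ * FullCrossed.incl B Γ b' = FullCrossed.incl B Γ (γ • b') * cr b γ :=
      fun b' => by
        rw [incl_eq_cr, incl_eq_cr, cr_mul_cr, cr_mul_cr, one_smul, mul_one, one_mul, mul_comm]
    exact ⟨γ, γ, cr_mem_comp b γ, fun b' => ⟨h b', h b'⟩⟩

end Crossed

/-! ### The expectation `b γ ⊗ a ↦ r b * specProj δ γ a` -/

section Expectation

open SkewMonoidAlgebra (single single_mul_single smul_single coeffLinearEquiv)

variable {B Γ : Type u} [CommCStarAlgebra B] [Group Γ] [CStarAction B Γ] {A : Type u}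
  [CStarAlgebra A]

/-- A homomorphism from `B` to the fixed points of a coaction that is compatible with the action of
`Γ` on `B`. -/
structure IsCovariant (δ : A →⋆ₐ[ℂ] MaxTensor (GroupCStar Γ) A) (r : B →⋆ₐ[ℂ] A) : Prop where
  isCoaction : IsCoaction δ
  apply : ∀ b, δ (r b) = tmul (uG 1) (r b)
  mul : ∀ (γ : Γ) a b, δ a = tmul (uG γ) a → a * r b = r (γ • b) * a

variable (δ : A →⋆ₐ[ℂ] MaxTensor (GroupCStar Γ) A) (r : B →⋆ₐ[ℂ] A)

/-- The linear map `b γ ⊗ a ↦ r b * specProj δ γ a` on the algebraic tensor product. -/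
noncomputable def crossedFunctional : SkewMonoidAlgebra B Γ ⊗[ℂ] A →ₗ[ℂ] A :=
  TensorProduct.lift ((Finsupp.lsum ℂ fun γ : Γ =>
    ((LinearMap.mul ℂ A) ∘ₗ lin r).compl₂ (specProj δ γ : A →ₗ[ℂ] A)) ∘ₗ
      (coeffLinearEquiv (k := B) (G := Γ) (S := ℂ)).toLinearMap)

theorem crossedFunctional_tmul (γ : Γ) (b : B) (a : A) :
    crossedFunctional δ r (single γ b ⊗ₜ a) = r b * specProj δ γ a := by
  rw [crossedFunctional, TensorProduct.lift.tmul, LinearMap.comp_apply]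
  have : (coeffLinearEquiv (k := B) (G := Γ) (S := ℂ)).toLinearMap (single γ b) =
      Finsupp.single γ b := rfl
  rw [this, Finsupp.lsum_single]
  rfl

theorem span_single_tmul : Submodule.span ℂ {x : SkewMonoidAlgebra B Γ ⊗[ℂ] A |
    ∃ γ b a, x = single γ b ⊗ₜ a} = ⊤ := by
  refine eq_top_iff.2 fun x _ => ?_
  induction x with
  | zero => exact zero_mem _
  | add x y hx hy => exact add_mem (hx trivial) (hy trivial)
  | tmul s a =>
    induction s using SkewMonoidAlgebra.induction_on with
    | zero => rw [TensorProduct.zero_tmul]; exact zero_mem _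
    | single γ b => exact Submodule.subset_span ⟨γ, b, a, rfl⟩
    | add f g hf hg => rw [TensorProduct.add_tmul]; exact add_mem (hf trivial) (hg trivial)

theorem smul_single_tmul (c : ℂ) (γ : Γ) (b : B) (a : A) :
    c • ((single γ b : SkewMonoidAlgebra B Γ) ⊗ₜ[ℂ] a) = single γ (c • b) ⊗ₜ a := by
  rw [TensorProduct.smul_tmul', smul_single]

theorem crossedFunctional_star_mul {n : ℕ} (γ : Fin n → Γ) (b : Fin n → B) (a : Fin n → A) :
    crossedFunctional δ r (star (∑ i, (single (γ i) (b i) : SkewMonoidAlgebra B Γ) ⊗ₜ[ℂ] a i) *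
      ∑ i, single (γ i) (b i) ⊗ₜ a i) =
    ∑ i, ∑ j, r ((γ i)⁻¹ • (star (b i) * b j)) * specProj δ ((γ i)⁻¹ * γ j) (star (a i) * a j) := by
  rw [star_sum, Finset.sum_mul (R := SkewMonoidAlgebra B Γ ⊗[ℂ] A), map_sum]
  refine Finset.sum_congr rfl fun i _ => ?_
  rw [Finset.mul_sum (R := SkewMonoidAlgebra B Γ ⊗[ℂ] A), map_sum]
  refine Finset.sum_congr rfl fun j _ => ?_
  rw [TensorProduct.star_tmul, Algebra.TensorProduct.tmul_mul_tmul, star_single,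
    single_mul_single, ← smul_mul', crossedFunctional_tmul]

variable {δ r} (h : IsCovariant δ r)
include h

/-- `a i⋆ a j` has degree `(α i)⁻¹ α j`, so the `(i, j)` term survives only if this equals `(γ i)⁻¹
γ j`, that is, if `g i = g j` for `g i = γ i (α i)⁻¹`. Moving `r` past `a i⋆` by covariance turns a
surviving term into `(y i)⋆ (y j)` with `y i = r ((g i)⁻¹ b i) a i`. -/
theorem crossedFunctional_nonneg_of_eigen {n : ℕ} (γ α : Fin n → Γ) (b : Fin n → B)
    (a : Fin n → A) (ha : ∀ i, δ (a i) = tmul (uG (α i)) (a i)) :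
    0 ≤ crossedFunctional δ r
      (star (∑ i, (single (γ i) (b i) : SkewMonoidAlgebra B Γ) ⊗ₜ[ℂ] a i) *
        ∑ i, single (γ i) (b i) ⊗ₜ a i) := by
  have hstar : ∀ i, δ (star (a i)) = tmul (uG (α i)⁻¹) (star (a i)) := fun i => by
    rw [map_star, ha, star_tmul, star_uG]
  rw [crossedFunctional_star_mul]
  convert nonneg_of_fibers (fun i => γ i * (α i)⁻¹)
    (fun i => r ((γ i * (α i)⁻¹)⁻¹ • b i) * a i) using 4 with i _ j _
  rw [specProj_of_eigen (γ' := (α i)⁻¹ * α j) (by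
    rw [map_mul, hstar, ha, tmul_mul_tmul, ← uG_mul])]
  have e : (γ i)⁻¹ * γ j = (α i)⁻¹ * α j ↔ γ i * (α i)⁻¹ = γ j * (α j)⁻¹ := by
    constructor
    · intro h
      have : γ j = γ i * ((α i)⁻¹ * α j) := by rw [← h]; group
      rw [this]; group
    · intro h
      have : γ i = γ j * (α j)⁻¹ * α i := by rw [← h]; group
      rw [this]; group
  by_cases hij : γ i * (α i)⁻¹ = γ j * (α j)⁻¹
  · rw [if_pos (e.2 hij), if_pos hij, star_mul, ← map_star, ← hij]
    have h2 := h.mul _ _ ((γ i * (α i)⁻¹)⁻¹ • (star (b i) * b j)) (hstar i)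
    rw [← mul_smul, show (α i)⁻¹ * (γ i * (α i)⁻¹)⁻¹ = (γ i)⁻¹ by group] at h2
    rw [← mul_assoc, ← h2, smul_mul', map_mul, CStarAction.smul_star]
    simp only [mul_assoc]
  · rw [if_neg fun hc => hij (e.1 hc), if_neg hij, mul_zero]

theorem clspan_eigen : clspan {a : A | ∃ γ : Γ, δ a = tmul (uG γ) a} = ⊤ := by
  refine eq_top_iff.2 fun a _ => clspan_mono ?_ (h.isCoaction.mem_clspan a)
  rintro _ ⟨γ, y, rfl⟩
  exact ⟨γ, h.isCoaction.apply_specProj γ y⟩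

/-- For fixed `γ i` and `b i` the value is continuous in the tuple `a`, so the entries may be taken
in the dense span of the eigenvectors. Expanding each of them gives a longer sum of tensors whose
second factors are single eigenvectors. -/
theorem crossedFunctional_nonneg (x : SkewMonoidAlgebra B Γ ⊗[ℂ] A) :
    0 ≤ crossedFunctional δ r (star x * x) := by
  set H := Submodule.span ℂ {a : A | ∃ γ : Γ, δ a = tmul (uG γ) a} with hH
  have hx : x ∈ Submodule.span ℂ {x : SkewMonoidAlgebra B Γ ⊗[ℂ] A |
      ∃ γ b a, x = single γ b ⊗ₜ a} := by rw [span_single_tmul]; trivial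
  obtain ⟨n, f, g, rfl⟩ := Submodule.mem_span_set'.1 hx
  choose γ b a hg using fun i => (g i).2
  simp only [hg, smul_single_tmul]
  have hd : DenseRange (Pi.map fun _ : Fin n => ((↑) : H → A)) := DenseRange.piMap fun _ =>
    (Submodule.dense_iff_topologicalClosure_eq_top.2 (clspan_eigen h)).denseRange_val
  refine hd.induction_on a ?_ fun y => ?_
  · simp only [crossedFunctional_star_mul]
    exact isClosed_le continuous_const (by fun_prop)
  · have hy : ∑ i, (single (γ i) (f i • b i) : SkewMonoidAlgebra B Γ) ⊗ₜ[ℂ] (y i : A) ∈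
        Submodule.span ℂ {x : SkewMonoidAlgebra B Γ ⊗[ℂ] A |
          ∃ γ b a, (∃ α : Γ, δ a = tmul (uG α) a) ∧ x = single γ b ⊗ₜ a} := by
      refine Submodule.sum_mem _ fun i _ => ?_
      have hi := (y i).2
      refine Submodule.span_induction (p := fun z _ => (single (γ i) (f i • b i) :
        SkewMonoidAlgebra B Γ) ⊗ₜ[ℂ] z ∈ _) (fun z hz => ?_) ?_ (fun z w _ _ hz hw => ?_)
        (fun c z _ hz => ?_) hi
      · exact Submodule.subset_span ⟨γ i, f i • b i, z, hz, rfl⟩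
      · rw [TensorProduct.tmul_zero]; exact zero_mem _
      · rw [TensorProduct.tmul_add]; exact add_mem hz hw
      · rw [TensorProduct.tmul_smul]; exact Submodule.smul_mem _ c hz
    obtain ⟨m, f', g', hfg⟩ := Submodule.mem_span_set'.1 hy
    choose γ' b' a' hα hg' using fun i => (g' i).2
    choose α hα using hα
    simp only [hg', smul_single_tmul] at hfg
    change 0 ≤ crossedFunctional δ r (star (∑ i, (single (γ i) (f i • b i) :
      SkewMonoidAlgebra B Γ) ⊗ₜ[ℂ] (y i : A)) * ∑ i, single (γ i) (f i • b i) ⊗ₜ (y i : A))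
    rw [← hfg]
    exact crossedFunctional_nonneg_of_eigen h γ' α _ a' hα

variable (B Γ A) in
omit h in
/-- The `*`-homomorphism `s ↦ s ⊗ 1` on the algebraic crossed product. -/
noncomputable def crossedInl :
    SkewMonoidAlgebra B Γ →⋆ₐ[ℂ] SkewMonoidAlgebra B Γ ⊗[ℂ] A where
  toAlgHom := Algebra.TensorProduct.includeLeft
  map_star' a := by simp [TensorProduct.star_tmul]

variable (B Γ A) in
omit h in
/-- The `*`-homomorphism `a ↦ 1 ⊗ a` into the tensor product with the algebraic crossed product. -/
noncomputable def crossedInr : A →⋆ₐ[ℂ] SkewMonoidAlgebra B Γ ⊗[ℂ] A where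
  toAlgHom := Algebra.TensorProduct.includeRight
  map_star' a := by simp [TensorProduct.star_tmul]

omit h in
theorem crossedInl_mul_crossedInr (s : SkewMonoidAlgebra B Γ) (a : A) :
    crossedInl B Γ A s * crossedInr B Γ A a = s ⊗ₜ a := by
  change (s ⊗ₜ[ℂ] (1 : A)) * ((1 : SkewMonoidAlgebra B Γ) ⊗ₜ[ℂ] a) = _
  simp

omit h in
theorem crossedInr_mul_crossedInl (s : SkewMonoidAlgebra B Γ) (a : A) :
    crossedInr B Γ A a * crossedInl B Γ A s = s ⊗ₜ a := by
  change ((1 : SkewMonoidAlgebra B Γ) ⊗ₜ[ℂ] a) * (s ⊗ₜ[ℂ] (1 : A)) = _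
  simp

omit h in
theorem isArch_crossed (s : SkewMonoidAlgebra B Γ) : IsArch s := by
  induction s using SkewMonoidAlgebra.induction_on with
  | zero => exact isArch_zero
  | add f g hf hg => exact hf.add hg
  | single γ b =>
    have h1 : IsArch (crossedIncl b : SkewMonoidAlgebra B Γ) :=
      IsArch.map (R := B) (R' := SkewMonoidAlgebra B Γ) (isArch_of_cstar b) crossedIncl
    have h2 : IsArch (single γ 1 : SkewMonoidAlgebra B Γ) := isArch_of_star_mul_self (by
      rw [star_single, single_mul_single]; simp)
    have e : single γ b = (crossedIncl b : SkewMonoidAlgebra B Γ) * single γ 1 := by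
      change _ = single 1 b * single γ 1
      simp [single_mul_single]
    rw [e]
    exact h1.mul h2

omit h in
theorem isArch_crossed_tensor (x : SkewMonoidAlgebra B Γ ⊗[ℂ] A) : IsArch x := by
  induction x with
  | zero => exact isArch_zero
  | add x y hx hy => exact hx.add hy
  | tmul s a =>
    rw [← crossedInl_mul_crossedInr]
    have h1 : IsArch (crossedInl B Γ A s) := (isArch_crossed s).map _
    have h2 : IsArch (crossedInr B Γ A a) := (isArch_of_cstar a).map _
    exact h1.mul h2

/-- The functional lives on `A` tensored with the algebraic crossed product, whose elements are
bounded too, so the extension theorem applies there. Restricting the resulting representation `j` to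
the two factors gives commuting representations of the full crossed product and of `A`, hence one of
their maximal tensor product. -/
theorem exists_crossedExp : ∃ Θ : MaxTensor (FullCrossed B Γ) A →L[ℂ] A,
    ∀ b (γ : Γ) a, Θ (tmul (cr b γ) a) = r b * specProj δ γ a := by
  obtain ⟨E, _, j, F, hF⟩ := exists_extension isArch_crossed_tensor (crossedFunctional δ r)
    (crossedFunctional_nonneg h)
  have hc : ∀ (x : FullCrossed B Γ) (a : A), Commute
      (Envelope.lift (j.comp (crossedInl B Γ A)) x) ((j.comp (crossedInr B Γ A)) a) := fun x a => by
    refine (Envelope.denseRange_of (SkewMonoidAlgebra B Γ)).induction_on x ?_ fun s => ?_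
    · have hcont := Envelope.continuous_hom (Envelope.lift (j.comp (crossedInl B Γ A)))
      exact isClosed_eq (hcont.mul continuous_const) (continuous_const.mul hcont)
    · rw [Envelope.lift_of, StarAlgHom.comp_apply, StarAlgHom.comp_apply, commute_iff_eq,
        ← map_mul, ← map_mul, crossedInl_mul_crossedInr, crossedInr_mul_crossedInl]
  refine ⟨F ∘L homL (MaxTensor.lift (Envelope.lift (j.comp (crossedInl B Γ A)))
    (j.comp (crossedInr B Γ A)) hc), fun b γ a => ?_⟩
  rw [ContinuousLinearMap.comp_apply, homL_apply, lift_tmul, cr, Envelope.lift_of,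
    StarAlgHom.comp_apply, StarAlgHom.comp_apply, ← map_mul, crossedInl_mul_crossedInr, hF,
    crossedFunctional_tmul]

/-- The map `b γ ⊗ a ↦ r b * specProj δ γ a`. -/
noncomputable def crossedExp : MaxTensor (FullCrossed B Γ) A →L[ℂ] A :=
  (exists_crossedExp h).choose

theorem crossedExp_tmul (b : B) (γ : Γ) (a : A) :
    crossedExp h (tmul (cr b γ) a) = r b * specProj δ γ a :=
  (exists_crossedExp h).choose_spec b γ a

omit h in
theorem clspan_cr_tmul : clspan (Set.image2 (tmul : FullCrossed B Γ → A → _)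
    {x : FullCrossed B Γ | ∃ b γ, x = cr b γ} Set.univ) = ⊤ :=
  clspan_image2_tmul (clspan_cr B Γ) clspan_univ

/-- On `γ ⊗ x` the composition with `ι_Γ ⊗ id` is `P_γ x`, so it is `recon`, the left inverse of
`δ`. -/
theorem crossedExp_δ (a : A) :
    crossedExp h (MaxTensor.map (FullCrossed.ofGroup B Γ) (StarAlgHom.id ℂ A) (δ a)) = a := by
  let f : MaxTensor (GroupCStar Γ) A →L[ℂ] A := crossedExp h ∘L
    homL (MaxTensor.map (FullCrossed.ofGroup B Γ) (StarAlgHom.id ℂ A))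
  have hf : f = recon δ := clm_ext_group fun γ x => by
    change crossedExp h (MaxTensor.map (FullCrossed.ofGroup B Γ) (StarAlgHom.id ℂ A)
      (tmul (uG γ) x)) = _
    rw [map_tmul, ofGroup_uG, recon_tmul]
    change crossedExp h (tmul (cr 1 γ) x) = _
    rw [crossedExp_tmul, map_one, one_mul]
  exact (DFunLike.congr_fun hf (δ a)).trans (h.isCoaction.recon a)

theorem specProj_fixed_mul {y : A} (hy : δ y = tmul (uG 1) y) (γ : Γ) (a : A) :
    specProj δ γ (y * a) = y * specProj δ γ a := by
  have := clm_ext_of_clspan (clspan_eigen h)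
    (f := specProj δ γ ∘L ContinuousLinearMap.mul ℂ A y)
    (g := ContinuousLinearMap.mul ℂ A y ∘L specProj δ γ) fun a ⟨γ', ha⟩ => by
      change specProj δ γ (y * a) = y * specProj δ γ a
      rw [specProj_of_eigen ha, specProj_of_eigen (γ' := γ') (by
        rw [map_mul, hy, ha, tmul_mul_tmul, ← uG_mul, one_mul])]
      split_ifs
      · rfl
      · rw [mul_zero]
  exact DFunLike.congr_fun this a

/-- On `b' γ ⊗ a` both terms yield `r (b b') P_γ a`: the spectral projection commutes with left
multiplication by the fixed element `r b`, and `B` is commutative. -/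
theorem crossedExp_sub_mul (b : B) (x : MaxTensor (FullCrossed B Γ) A) :
    crossedExp h ((tmul (FullCrossed.incl B Γ b) 1 - tmul 1 (r b)) * x) = 0 := by
  let t : MaxTensor (FullCrossed B Γ) A := tmul (FullCrossed.incl B Γ b) 1 - tmul 1 (r b)
  let f : MaxTensor (FullCrossed B Γ) A →L[ℂ] A :=
    crossedExp h ∘L ContinuousLinearMap.mul ℂ (MaxTensor (FullCrossed B Γ) A) t
  have hf : ∀ x ∈ Set.image2 (tmul : FullCrossed B Γ → A → _)
      {x : FullCrossed B Γ | ∃ b γ, x = cr b γ} Set.univ,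
      f x = (0 : MaxTensor (FullCrossed B Γ) A →L[ℂ] A) x := by
    rintro _ ⟨_, ⟨b', γ, rfl⟩, a, -, rfl⟩
    change crossedExp h ((tmul (FullCrossed.incl B Γ b) 1 - tmul 1 (r b)) *
      tmul (cr b' γ) a) = 0
    rw [sub_mul, tmul_mul_tmul, tmul_mul_tmul, one_mul, one_mul, incl_eq_cr, cr_mul_cr,
      one_mul, one_smul, map_sub, crossedExp_tmul, crossedExp_tmul,
      specProj_fixed_mul h (h.apply b), ← mul_assoc, ← map_mul, mul_comm b', sub_self]
  exact DFunLike.congr_fun (clm_ext_of_clspan clspan_cr_tmul hf) x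

end Expectation

/-! ### The unit isomorphisms -/

namespace BGData

open CGData

variable {B Γ : Type u} [CommCStarAlgebra B] [Group Γ] [CStarAction B Γ]

/-- The axiom `mul_r` speaks of bihomogeneous elements only. An element of left degree `γ` is fixed
by `P_γ`, hence a limit of combinations of bihomogeneous elements with the same left degree. -/
theorem IsBG.isCovariant {A : BGData B Γ} (hA : A.IsBG) : IsCovariant A.δ A.r where
  isCoaction := hA.isCoaction
  apply b := (hA.r_mem b).1
  mul γ a b ha := by
    have h1 : a ∈ clspan A.toCGData.homog := by rw [hA.clspan_homog]; exact Submodule.mem_top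
    have h2 := map_mem_clspan {x : A.carrier | ∃ γ', x ∈ A.comp γ γ'} (specProj A.δ γ) (by
      rintro s ⟨β, β', hs⟩
      rw [specProj_of_eigen hs.1]
      split_ifs with h
      · exact subset_clspan ⟨β', h ▸ hs⟩
      · exact zero_mem _) h1
    rw [specProj_of_eigen ha, if_pos rfl] at h2
    refine eqOn_clspan (f := (ContinuousLinearMap.mul ℂ A.carrier).flip (A.r b))
      (g := ContinuousLinearMap.mul ℂ A.carrier (A.r (γ • b))) ?_ h2
    rintro x ⟨γ', hx⟩
    exact hA.mul_r _ _ x hx b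

theorem IsBG.isCovariant_flip {A : BGData B Γ} (hA : A.IsBG) : IsCovariant A.δflip A.s where
  isCoaction := hA.isCoaction_flip
  apply b := (mem_comp_iff.1 (hA.s_mem b)).2
  mul γ a b ha := by
    have h1 : a ∈ clspan A.toCGData.homog := by rw [hA.clspan_homog]; exact Submodule.mem_top
    have h2 := map_mem_clspan {x : A.carrier | ∃ γ', x ∈ A.comp γ' γ} (specProj A.δflip γ) (by
      rintro s ⟨β, β', hs⟩
      rw [specProj_of_eigen (mem_comp_iff.1 hs).2]
      split_ifs with h
      · exact subset_clspan ⟨β, h ▸ hs⟩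
      · exact zero_mem _) h1
    rw [specProj_of_eigen ha, if_pos rfl] at h2
    refine eqOn_clspan (f := (ContinuousLinearMap.mul ℂ A.carrier).flip (A.s b))
      (g := ContinuousLinearMap.mul ℂ A.carrier (A.s (γ • b))) ?_ h2
    rintro x ⟨γ', hx⟩
    exact hA.mul_s _ _ x hx b

variable (B Γ) in
theorem isGraded_ofGroup :
    IsGraded (group Γ) (unit B Γ).toCGData (lin (FullCrossed.ofGroup B Γ)) := by
  refine isGraded_of_clspan (A := group Γ) (C := (unit B Γ).toCGData) (clspan_uG Γ) (isCP_lin _) ?_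
  rintro _ ⟨γ, rfl⟩
  refine ⟨γ, γ, group_uG_mem Γ γ, ?_⟩
  change FullCrossed.ofGroup B Γ (uG γ) ∈ _
  rw [ofGroup_uG]
  exact cr_mem_comp 1 γ

theorem q_eq_of_sub_mem {A C : BGData B Γ} {x y t z : (cot A C).carrier} (ht : t ∈ tSet A C)
    (h : emb A C x - emb A C y = emb A C t * emb A C z) : q A C x = q A C y := by
  have : x - y = t * z := emb_injective A C (by rw [map_sub, map_mul, h])
  rw [← sub_eq_zero, ← map_sub, this, map_mul, q_tSet ht, zero_mul]

section Aux

variable {X Y : Type v} {Z W : Type v} [CStarAlgebra X] [CStarAlgebra Y] [CStarAlgebra Z]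
  [CStarAlgebra W]

theorem tensorMap_id_map (f : X →⋆ₐ[ℂ] Y) {φ : Z →ₗ[ℂ] W} (hφ : IsCP φ) (x : MaxTensor X Z) :
    tensorMap LinearMap.id φ (MaxTensor.map f (StarAlgHom.id ℂ Z) x) =
      MaxTensor.map f (StarAlgHom.id ℂ W) (tensorMap LinearMap.id φ x) := by
  rw [← tensorMap_lin_id, ← tensorMap_lin_id]
  exact (tensorMap_comp (isCP_lin _) isCP_id isCP_id hφ _).symm.trans
    (tensorMap_comp isCP_id hφ (isCP_lin _) isCP_id _)

theorem tensorMap_map_id (f : X →⋆ₐ[ℂ] Y) {φ : Z →ₗ[ℂ] W} (hφ : IsCP φ) (x : MaxTensor Z X) :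
    tensorMap φ LinearMap.id (MaxTensor.map (StarAlgHom.id ℂ Z) f x) =
      MaxTensor.map (StarAlgHom.id ℂ W) f (tensorMap φ LinearMap.id x) := by
  rw [← tensorMap_id_lin, ← tensorMap_id_lin]
  exact (tensorMap_comp isCP_id (isCP_lin _) hφ isCP_id _).symm.trans
    (tensorMap_comp hφ isCP_id isCP_id (isCP_lin _) _)

end Aux

section AuxCr

variable {X : Type u} [CStarAlgebra X]

theorem tmul_cr_sub_left (b : B) (γ : Γ) (y a : X) :
    (tmul (cr b γ) a - tmul (cr 1 γ) (y * a) : MaxTensor (FullCrossed B Γ) X) =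
      (tmul (FullCrossed.incl B Γ b) 1 - tmul 1 y) * tmul (cr 1 γ) a := by
  rw [sub_mul, tmul_mul_tmul, tmul_mul_tmul, incl_eq_cr, cr_mul_cr, one_smul, one_mul, one_mul,
    one_mul, mul_one]

theorem tmul_cr_sub_right (b : B) (γ : Γ) (y a : X) :
    (tmul (y * a) (cr 1 γ) - tmul a (cr b γ) : MaxTensor X (FullCrossed B Γ)) =
      (tmul y 1 - tmul 1 (FullCrossed.incl B Γ b)) * tmul a (cr 1 γ) := by
  rw [sub_mul, tmul_mul_tmul, tmul_mul_tmul, incl_eq_cr, cr_mul_cr, one_smul, one_mul, one_mul,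
    one_mul, mul_one]

end AuxCr

/-! ### The left unit isomorphism -/

section Left

variable {A : BGData B Γ} (hA : A.IsBG)

theorem exists_toCot_unit_left : ∃ k : A.carrier →⋆ₐ[ℂ] (cot (unit B Γ) A).carrier,
    (∀ a, emb (unit B Γ) A (k a) =
      MaxTensor.map (FullCrossed.ofGroup B Γ) (StarAlgHom.id ℂ A.carrier) (A.δ a)) ∧
    ∀ a, L A hA a = q (unit B Γ) A (k a) := by
  obtain ⟨k, hk, hk'⟩ := exists_cotMap_hom (isCG_group Γ) hA.toIsCG (isGraded_ofGroup B Γ)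
    (C' := A.toCGData) (g := StarAlgHom.id ℂ A.carrier) IsGraded.id
  exact ⟨k.comp (toCotL A.toCGData hA.toIsCG), fun a => hk _, fun a =>
    congrArg (q (unit B Γ) A) (DFunLike.congr_fun hk' (toCotL A.toCGData hA.toIsCG a)).symm⟩

/-- The lift `A → (B ⋊ Γ) ⊗^Γ A` of the left unit isomorphism. -/
noncomputable def unitLeft : A.carrier →⋆ₐ[ℂ] (cot (unit B Γ) A).carrier :=
  (exists_toCot_unit_left hA).choose

theorem emb_unitLeft (a : A.carrier) : emb (unit B Γ) A (unitLeft hA a) =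
    MaxTensor.map (FullCrossed.ofGroup B Γ) (StarAlgHom.id ℂ A.carrier) (A.δ a) :=
  (exists_toCot_unit_left hA).choose_spec.1 a

theorem L_apply (a : A.carrier) : L A hA a = q (unit B Γ) A (unitLeft hA a) :=
  (exists_toCot_unit_left hA).choose_spec.2 a

theorem emb_unitLeft_of_mem {γ γ' : Γ} {a : A.carrier} (ha : a ∈ A.comp γ γ') :
    emb (unit B Γ) A (unitLeft hA a) = tmul (cr 1 γ) a := by
  rw [emb_unitLeft, ha.1, map_tmul]
  change tmul (FullCrossed.ofGroup B Γ (uG γ)) a = _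
  rw [ofGroup_uG]

theorem isMor_unitLeft : IsMor A (prod (unit B Γ) A) ((q (unit B Γ) A).comp (unitLeft hA)) := by
  have hq := isMor_q isBG_unit hA
  refine isMor_of_isGraded hA.toIsCG (fun γ γ' a ha => hq.isGraded _ _ _ ?_) (fun b => ?_)
    fun b => ?_
  · exact mem_comp_of_emb isBG_unit.toIsCG hA.toIsCG (cr_mem_comp 1 γ) ha
      (emb_unitLeft_of_mem hA ha)
  · rw [← hq.map_r, StarAlgHom.comp_apply]
    -- The lift sends `r_A b` to `1 ⊗ r_A b`, whereas `r` of the cotensor product is `b ⊗ 1`; the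
    -- difference is the generator `t(b)`.
    obtain ⟨t, ht⟩ := exists_tSet isBG_unit hA b
    refine (q_eq_of_sub_mem (z := 1) (mem_tSet.2 ⟨b, ht⟩) ?_).symm
    rw [emb_unitLeft_of_mem hA (hA.r_mem b), cot_r isBG_unit, ht, map_one, mul_one,
      show (cr 1 1 : FullCrossed B Γ) = 1 from map_one (Envelope.of _)]
    rfl
  · rw [← hq.map_s, StarAlgHom.comp_apply]
    congr 1
    refine emb_injective _ _ ?_
    rw [emb_unitLeft_of_mem hA (hA.s_mem b), cot_s hA,
      show (cr 1 1 : FullCrossed B Γ) = 1 from map_one (Envelope.of _)]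
    rfl

theorem crossedExp_eq_zero {x : (cot (unit B Γ) A).carrier}
    (hx : x ∈ closedIdeal (tSet (unit B Γ) A)) :
    crossedExp hA.isCovariant (emb (unit B Γ) A x) = 0 := by
  refine eqOn_clspan (f := crossedExp hA.isCovariant ∘L homL (emb (unit B Γ) A)) (g := 0) ?_
    (closedIdeal_tSet_le isBG_unit hA hx)
  rintro _ ⟨t, ht, w, -, rfl⟩
  obtain ⟨b, hb⟩ := mem_tSet.1 ht
  change crossedExp hA.isCovariant (emb (unit B Γ) A (t * w)) = 0
  rw [map_mul, hb]
  exact crossedExp_sub_mul hA.isCovariant b _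

/-- The expectation vanishes on the ideal and takes `unitLeft hA a` back to `a`, so nothing in the
image of the lift is lost in the quotient. -/
theorem unitLeft_injective : Function.Injective ((q (unit B Γ) A).comp (unitLeft hA)) := by
  refine (injective_iff_map_eq_zero _).2 fun a ha => ?_
  exact (crossedExp_δ hA.isCovariant a).symm.trans ((congrArg _ (emb_unitLeft hA a)).symm.trans
    (crossedExp_eq_zero hA (q_eq_zero.1 ha)))

/-- `b γ ⊗ a - γ ⊗ r(b) a = t(b) (γ ⊗ a)`, so the class of the generator `b γ ⊗ a` is the image of
`r(b) a`. -/
theorem unitLeft_surjective : Function.Surjective ((q (unit B Γ) A).comp (unitLeft hA)) := by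
  have hS := clspan_of_homog (A := (unit B Γ).toCGData) (C := A.toCGData) isBG_unit.toIsCG hA.toIsCG
    (clspan_cr B Γ) (by rintro _ ⟨b, γ, rfl⟩; exact ⟨γ, γ, cr_mem_comp b γ⟩) hA.clspan_homog
    subset_rfl
  refine surjective_of_clspan _
    (clspan_image_of_surjective (q_surjective (A := unit B Γ) (C := A)) hS) ?_
  rintro _ ⟨x, ⟨_, ⟨b, γ, rfl⟩, a, -, β, γ', β', h1, ha, hx⟩, rfl⟩
  by_cases h0 : x = 0
  · exact ⟨0, by rw [h0, map_zero, map_zero]⟩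
  have hc : (cr b γ : FullCrossed B Γ) ≠ 0 := fun h => h0 (emb_injective (unit B Γ) A (by
    rw [map_zero]; exact hx.trans (by rw [h]; exact zero_tmul a)))
  obtain ⟨rfl, rfl⟩ := comp_unique (A := (unit B Γ).toCGData) (cr_mem_comp b γ) h1 hc
  obtain ⟨t, ht⟩ := exists_tSet isBG_unit hA b
  refine ⟨A.r b * a, ?_⟩
  rw [StarAlgHom.comp_apply]
  refine (q_eq_of_sub_mem (z := unitLeft hA a) (mem_tSet.2 ⟨b, ht⟩) ?_).symm
  have hb : A.r b * a ∈ A.comp γ β' := by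
    simpa only [one_mul] using mul_mem_comp (hA.r_mem b) ha
  rw [emb_unitLeft_of_mem hA hb, emb_unitLeft_of_mem hA ha, ht]
  exact (congrArg (· - (tmul (cr 1 γ) (A.r b * a) : MaxTensor (FullCrossed B Γ) A.carrier))
    hx).trans (tmul_cr_sub_left b γ (A.r b) a)

theorem exists_isIso_L : ∃ Λ : A.carrier →⋆ₐ[ℂ] (prod (unit B Γ) A).carrier,
    IsIso A (prod (unit B Γ) A) Λ ∧ lin Λ = L A hA :=
  ⟨(q (unit B Γ) A).comp (unitLeft hA),
    (isMor_unitLeft hA).isIso (unitLeft_injective hA) (unitLeft_surjective hA), by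
      ext a
      exact (L_apply hA a).symm⟩

theorem L_natural {A' : BGData B Γ} (hA' : A'.IsBG) {φ : A.carrier →ₗ[ℂ] A'.carrier}
    (hφ : IsCPMor A A' φ) :
    prodMap (unit B Γ) (unit B Γ) A A' LinearMap.id φ ∘ₗ L A hA = L A' hA' ∘ₗ φ := by
  refine LinearMap.ext fun a => ?_
  rw [LinearMap.comp_apply, LinearMap.comp_apply, L_apply, L_apply,
    prodMap_q isBG_unit isBG_unit hA hA' .id hφ]
  congr 1
  refine emb_injective _ _ ?_
  rw [mapCot_spec isBG_unit.toIsCG hA.toIsCG .id hφ, emb_unitLeft, emb_unitLeft, hφ.δ]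
  exact tensorMap_id_map (FullCrossed.ofGroup B Γ) hφ.cp (A.δ a)

end Left

/-! ### The right unit isomorphism, reduced to the left expectation by the flip -/

section Right

variable {A : BGData B Γ} (hA : A.IsBG)

theorem exists_toCot_unit_right : ∃ k : A.carrier →⋆ₐ[ℂ] (cot A (unit B Γ)).carrier,
    (∀ a, emb A (unit B Γ) (k a) =
      MaxTensor.map (StarAlgHom.id ℂ A.carrier) (FullCrossed.ofGroup B Γ) (A.δbar a)) ∧
    ∀ a, R A hA a = q A (unit B Γ) (k a) := by
  obtain ⟨k, hk, hk'⟩ := exists_cotMap_hom hA.toIsCG (isCG_group Γ) (A' := A.toCGData)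
    (f := StarAlgHom.id ℂ A.carrier) IsGraded.id (isGraded_ofGroup B Γ)
  exact ⟨k.comp (toCotR A.toCGData hA.toIsCG), fun a => hk _, fun a =>
    congrArg (q A (unit B Γ)) (DFunLike.congr_fun hk' (toCotR A.toCGData hA.toIsCG a)).symm⟩

/-- The lift `A → A ⊗^Γ (B ⋊ Γ)` of the right unit isomorphism. -/
noncomputable def unitRight : A.carrier →⋆ₐ[ℂ] (cot A (unit B Γ)).carrier :=
  (exists_toCot_unit_right hA).choose

theorem emb_unitRight (a : A.carrier) : emb A (unit B Γ) (unitRight hA a) =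
    MaxTensor.map (StarAlgHom.id ℂ A.carrier) (FullCrossed.ofGroup B Γ) (A.δbar a) :=
  (exists_toCot_unit_right hA).choose_spec.1 a

theorem R_apply (a : A.carrier) : R A hA a = q A (unit B Γ) (unitRight hA a) :=
  (exists_toCot_unit_right hA).choose_spec.2 a

theorem emb_unitRight_of_mem {γ γ' : Γ} {a : A.carrier} (ha : a ∈ A.comp γ γ') :
    emb A (unit B Γ) (unitRight hA a) = tmul a (cr 1 γ') := by
  rw [emb_unitRight, ha.2, map_tmul]
  change tmul a (FullCrossed.ofGroup B Γ (uG γ')) = _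
  rw [ofGroup_uG]

theorem isMor_unitRight : IsMor A (prod A (unit B Γ)) ((q A (unit B Γ)).comp (unitRight hA)) := by
  have hq := isMor_q hA isBG_unit
  refine isMor_of_isGraded hA.toIsCG (fun γ γ' a ha => hq.isGraded _ _ _ ?_) (fun b => ?_)
    fun b => ?_
  · exact mem_comp_of_emb hA.toIsCG isBG_unit.toIsCG ha (cr_mem_comp 1 γ')
      (emb_unitRight_of_mem hA ha)
  · rw [← hq.map_r, StarAlgHom.comp_apply]
    congr 1
    refine emb_injective _ _ ?_
    rw [emb_unitRight_of_mem hA (hA.r_mem b), cot_r hA,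
      show (cr 1 1 : FullCrossed B Γ) = 1 from map_one (Envelope.of _)]
    rfl
  · rw [← hq.map_s, StarAlgHom.comp_apply]
    obtain ⟨t, ht⟩ := exists_tSet hA isBG_unit b
    refine q_eq_of_sub_mem (z := 1) (mem_tSet.2 ⟨b, ht⟩) ?_
    rw [emb_unitRight_of_mem hA (hA.s_mem b), cot_s isBG_unit, ht, map_one, mul_one,
      show (cr 1 1 : FullCrossed B Γ) = 1 from map_one (Envelope.of _)]
    rfl

/-- The flip turns `s_A b ⊗ 1 - 1 ⊗ b` into the negative of the element handled by
`crossedExp_sub_mul`, with the flipped coaction and `s_A` in place of `δ` and `r`. -/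
theorem crossedExp_flip_eq_zero {x : (cot A (unit B Γ)).carrier}
    (hx : x ∈ closedIdeal (tSet A (unit B Γ))) :
    crossedExp hA.isCovariant_flip (MaxTensor.flip A.carrier (FullCrossed B Γ)
      (emb A (unit B Γ) x)) = 0 := by
  refine eqOn_clspan (f := crossedExp hA.isCovariant_flip ∘L
    homL ((MaxTensor.flip A.carrier (FullCrossed B Γ)).comp (emb A (unit B Γ)))) (g := 0) ?_
    (closedIdeal_tSet_le hA isBG_unit hx)
  rintro _ ⟨t, ht, w, -, rfl⟩
  obtain ⟨b, hb⟩ := mem_tSet.1 ht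
  change crossedExp hA.isCovariant_flip (MaxTensor.flip A.carrier (FullCrossed B Γ)
    (emb A (unit B Γ) (t * w))) = 0
  have h1 : MaxTensor.flip A.carrier (FullCrossed B Γ) (emb A (unit B Γ) t) =
      -(tmul (FullCrossed.incl B Γ b) 1 - tmul 1 (A.s b)) := by
    rw [hb, neg_sub]
    refine (map_sub (MaxTensor.flip A.carrier (FullCrossed B Γ)) _ _).trans ?_
    exact congrArg₂ (· - ·) (flip_tmul _ _) (flip_tmul _ _)
  have h2 : MaxTensor.flip A.carrier (FullCrossed B Γ) (emb A (unit B Γ) (t * w)) =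
      -((tmul (FullCrossed.incl B Γ b) 1 - tmul 1 (A.s b)) *
        MaxTensor.flip A.carrier (FullCrossed B Γ) (emb A (unit B Γ) w)) := by
    rw [map_mul]
    refine (map_mul (MaxTensor.flip A.carrier (FullCrossed B Γ)) _ _).trans ?_
    rw [h1, neg_mul]
  rw [h2, map_neg, crossedExp_sub_mul hA.isCovariant_flip, neg_zero]

theorem crossedExp_flip_unitRight (a : A.carrier) :
    crossedExp hA.isCovariant_flip (MaxTensor.flip A.carrier (FullCrossed B Γ)
      (emb A (unit B Γ) (unitRight hA a))) = a := by
  refine Eq.trans ?_ (crossedExp_δ hA.isCovariant_flip a)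
  rw [emb_unitRight, δflip_apply]
  exact congrArg _ (DFunLike.congr_fun (hom_ext_tmul
    (f := (MaxTensor.flip A.carrier (FullCrossed B Γ)).comp
      (MaxTensor.map (StarAlgHom.id ℂ A.carrier) (FullCrossed.ofGroup B Γ)))
    (g := (MaxTensor.map (FullCrossed.ofGroup B Γ) (StarAlgHom.id ℂ A.carrier)).comp
      (MaxTensor.flip A.carrier (GroupCStar Γ))) fun x g => by simp) (A.δbar a))

theorem unitRight_injective : Function.Injective ((q A (unit B Γ)).comp (unitRight hA)) := by
  refine (injective_iff_map_eq_zero _).2 fun a ha => ?_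
  exact (crossedExp_flip_unitRight hA a).symm.trans
    (crossedExp_flip_eq_zero hA (q_eq_zero.1 ha))

theorem unitRight_surjective : Function.Surjective ((q A (unit B Γ)).comp (unitRight hA)) := by
  have hS := clspan_of_homog (A := A.toCGData) (C := (unit B Γ).toCGData) hA.toIsCG isBG_unit.toIsCG
    hA.clspan_homog subset_rfl
    (clspan_cr B Γ) (by rintro _ ⟨b, γ, rfl⟩; exact ⟨γ, γ, cr_mem_comp b γ⟩)
  refine surjective_of_clspan _
    (clspan_image_of_surjective (q_surjective (A := A) (C := unit B Γ)) hS) ?_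
  rintro _ ⟨x, ⟨a, -, _, ⟨b, γ, rfl⟩, β, γ', β', ha, h1, hx⟩, rfl⟩
  by_cases h0 : x = 0
  · exact ⟨0, by rw [h0, map_zero, map_zero]⟩
  have hc : (cr b γ : FullCrossed B Γ) ≠ 0 := fun h => h0 (emb_injective A (unit B Γ) (by
    rw [map_zero]; exact hx.trans (by rw [h]; exact tmul_zero a)))
  obtain ⟨rfl, rfl⟩ := comp_unique (A := (unit B Γ).toCGData) (cr_mem_comp b γ) h1 hc
  obtain ⟨t, ht⟩ := exists_tSet hA isBG_unit b
  refine ⟨A.s b * a, ?_⟩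
  rw [StarAlgHom.comp_apply]
  refine q_eq_of_sub_mem (z := unitRight hA a) (mem_tSet.2 ⟨b, ht⟩) ?_
  have hb : A.s b * a ∈ A.comp β γ := by
    simpa only [one_mul] using mul_mem_comp (hA.s_mem b) ha
  rw [emb_unitRight_of_mem hA hb, emb_unitRight_of_mem hA ha, ht]
  exact (congrArg ((tmul (A.s b * a) (cr 1 γ) : MaxTensor A.carrier (FullCrossed B Γ)) - ·)
    hx).trans (tmul_cr_sub_right b γ (A.s b) a)

theorem exists_isIso_R : ∃ P : A.carrier →⋆ₐ[ℂ] (prod A (unit B Γ)).carrier,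
    IsIso A (prod A (unit B Γ)) P ∧ lin P = R A hA :=
  ⟨(q A (unit B Γ)).comp (unitRight hA),
    (isMor_unitRight hA).isIso (unitRight_injective hA) (unitRight_surjective hA), by
      ext a
      exact (R_apply hA a).symm⟩

theorem R_natural {A' : BGData B Γ} (hA' : A'.IsBG) {φ : A.carrier →ₗ[ℂ] A'.carrier}
    (hφ : IsCPMor A A' φ) :
    prodMap A A' (unit B Γ) (unit B Γ) φ LinearMap.id ∘ₗ R A hA = R A' hA' ∘ₗ φ := by
  refine LinearMap.ext fun a => ?_
  rw [LinearMap.comp_apply, LinearMap.comp_apply, R_apply, R_apply,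
    prodMap_q hA hA' isBG_unit isBG_unit hφ .id]
  congr 1
  refine emb_injective _ _ ?_
  rw [mapCot_spec hA.toIsCG isBG_unit.toIsCG hφ .id, emb_unitRight, emb_unitRight, hφ.δbar]
  exact tensorMap_map_id (FullCrossed.ofGroup B Γ) hφ.cp (A.δbar a)

end Right

end BGData

/-! ### Kernels of maps between maximal tensor products -/

namespace MaxTensor

variable {A A' C C' : Type u} [CStarAlgebra A] [CStarAlgebra A'] [CStarAlgebra C]
  [CStarAlgebra C']

/-- Exactness of the maximal tensor product. The closed span `I` of `ker f ⊗ C` is an ideal, and `a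
↦ a ⊗ 1` modulo `I` descends to `A'`. Together with `c ↦ 1 ⊗ c` it induces a homomorphism from `A' ⊗
C` to the quotient by `I` through which the quotient map factors; so the kernel of `f ⊗ id` lies in
`I`. -/
theorem mem_clspan_of_map_id_eq_zero {f : A →⋆ₐ[ℂ] A'} (hf : Function.Surjective f)
    {x : MaxTensor A C} (hx : map f (StarAlgHom.id ℂ C) x = 0) :
    x ∈ clspan (Set.image2 (tmul : A → C → MaxTensor A C) {a | f a = 0} Set.univ) := by
  set T : Set (MaxTensor A C) := Set.image2 tmul {a | f a = 0} Set.univ with hT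
  have htop : ∀ y : MaxTensor A C, y ∈ clspan (Set.image2 (tmul : A → C → MaxTensor A C)
      Set.univ Set.univ) := fun y => by
    rw [clspan_image2_tmul clspan_univ clspan_univ]; exact Submodule.mem_top
  have hleft : ∀ y z, z ∈ clspan T → y * z ∈ clspan T := fun y z hz => by
    refine map_mem_clspan T ((ContinuousLinearMap.mul ℂ (MaxTensor A C)).flip z) ?_ (htop y)
    rintro _ ⟨a', -, c', -, rfl⟩
    refine map_mem_clspan T (ContinuousLinearMap.mul ℂ (MaxTensor A C) (tmul a' c')) ?_ hz
    rintro _ ⟨a, ha, c, -, rfl⟩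
    refine subset_clspan ⟨a' * a, ?_, c' * c, trivial, (tmul_mul_tmul _ _ _ _).symm⟩
    exact (map_mul f a' a).trans (by rw [show f a = 0 from ha, mul_zero])
  have hright : ∀ y z, z ∈ clspan T → z * y ∈ clspan T := fun y z hz => by
    refine map_mem_clspan T (ContinuousLinearMap.mul ℂ (MaxTensor A C) z) ?_ (htop y)
    rintro _ ⟨a', -, c', -, rfl⟩
    refine map_mem_clspan T ((ContinuousLinearMap.mul ℂ (MaxTensor A C)).flip (tmul a' c')) ?_ hz
    rintro _ ⟨a, ha, c, -, rfl⟩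
    refine subset_clspan ⟨a * a', ?_, c * c', trivial, (tmul_mul_tmul _ _ _ _).symm⟩
    exact (map_mul f a a').trans (by rw [show f a = 0 from ha, zero_mul])
  let I : Ideal (MaxTensor A C) :=
    { carrier := clspan T
      add_mem' := fun h h' => add_mem h h'
      zero_mem' := zero_mem _
      smul_mem' := fun y z hz => hleft y z hz }
  have h1 : I.IsTwoSided := ⟨fun {z} y hz => hright y z hz⟩
  have h2 : IsClosed (I : Set (MaxTensor A C)) := isClosed_clspan T
  obtain ⟨k, hk⟩ := exists_factor_of_surjective hf (f := (quotMk I).comp (inl C)) fun a ha =>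
    (quotMk_eq_zero I).2 (subset_clspan ⟨a, ha, 1, trivial, rfl⟩)
  have hcomm : ∀ a' c, Commute (k a') ((quotMk I).comp (inr A) c) := fun a' c => by
    obtain ⟨a, rfl⟩ := hf a'
    rw [hk]
    exact (commute_inl_inr a c).map (quotMk I)
  have key := DFunLike.congr_fun (hom_ext_tmul (f := (lift k _ hcomm).comp
    (map f (StarAlgHom.id ℂ C))) (g := quotMk I) fun a c => by
      rw [StarAlgHom.comp_apply, map_tmul, lift_tmul, hk, tmul_eq, map_mul]
      rfl) x
  rw [StarAlgHom.comp_apply, hx, map_zero] at key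
  exact (quotMk_eq_zero I).1 key.symm

theorem mem_clspan_of_id_map_eq_zero {f : C →⋆ₐ[ℂ] C'} (hf : Function.Surjective f)
    {x : MaxTensor A C} (hx : map (StarAlgHom.id ℂ A) f x = 0) :
    x ∈ clspan (Set.image2 (tmul : A → C → MaxTensor A C) Set.univ {c | f c = 0}) := by
  have h : map f (StarAlgHom.id ℂ A) (flip A C x) = 0 := by
    have := DFunLike.congr_fun (hom_ext_tmul (f := (map f (StarAlgHom.id ℂ A)).comp (flip A C))
      (g := (flip A C').comp (map (StarAlgHom.id ℂ A) f)) fun a c => by simp) x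
    rw [StarAlgHom.comp_apply, StarAlgHom.comp_apply, hx, map_zero] at this
    exact this
  rw [← flip_flip x]
  refine map_mem_clspan (Set.image2 (tmul : A → C → MaxTensor A C) Set.univ {c | f c = 0})
    (homL (flip C A)) ?_ (mem_clspan_of_map_id_eq_zero hf h)
  rintro _ ⟨c, hc, a, -, rfl⟩
  exact subset_clspan ⟨a, trivial, c, hc, (flip_tmul c a).symm⟩

end MaxTensor

namespace BGData

open CGData

variable {B Γ : Type u} [CommCStarAlgebra B] [Group Γ] [CStarAction B Γ]

section Kernels

variable {A A' C C' : BGData B Γ} (hA : A.IsCG) (hC : C.IsCG)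

/-- The projection of the maximal tensor product onto the cotensor product. -/
noncomputable def projCot : MaxTensor A.carrier C.carrier →L[ℂ] (cot A C).carrier :=
  cotProj hA hC

theorem projCot_emb (x : (cot A C).carrier) : projCot hA hC (emb A C x) = x :=
  cotProj_incl hA hC x

theorem emb_projCot_tmul {β γ γ' β' : Γ} {a : A.carrier} {c : C.carrier} (ha : a ∈ A.comp β γ)
    (hc : c ∈ C.comp γ' β') : emb A C (projCot hA hC (tmul a c)) =
      if γ = γ' then tmul a c else 0 := by
  have h := cotProjAux_tmul (C := C.toCGData) ha.2 c
  rw [specProj_of_eigen hc.1] at h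
  refine Eq.trans h ?_
  split_ifs
  exacts [rfl, tmul_zero a]

variable {K : Ideal (cot A C).carrier} [K.IsTwoSided] (hK : IsClosed (K : Set (cot A C).carrier))

include hA hC hK in
-- Exactness places `x` in the closed span of the tensors `t w ⊗ c` with `t ∈ T`. The projection
-- onto the cotensor product fixes `x` and sends such a tensor to `0` or to `(t ⊗ 1) (w ⊗ c)`. Both
-- factors lie in the cotensor product because `t` has trivial bidegree, and the first lies in `K`.
theorem mem_of_map_id_eq_zero {f : A.carrier →⋆ₐ[ℂ] A'.carrier} (hf : Function.Surjective f)
    {T : Set A.carrier} (hT : T ⊆ A.comp 1 1)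
    (hker : ∀ a, f a = 0 → a ∈ clspan (Set.image2 (· * ·) T (Set.univ : Set A.carrier)))
    (hTK : ∀ t ∈ T, ∀ x, emb A C x = tmul t 1 → x ∈ K) {x : (cot A C).carrier}
    (hx : MaxTensor.map f (StarAlgHom.id ℂ C.carrier) (emb A C x) = 0) : x ∈ K := by
  set S : Set A.carrier := Set.image2 (· * ·) T A.homog with hS
  have h1 : ∀ a, f a = 0 → a ∈ clspan S := fun a ha => by
    refine clspan_le (isClosed_clspan S) ?_ (hker a ha)
    rintro _ ⟨t, ht, w, -, rfl⟩
    exact map_mem_clspan S (ContinuousLinearMap.mul ℂ A.carrier t)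
      (fun w hw => subset_clspan ⟨t, ht, w, hw, rfl⟩)
      (hA.clspan_homog ▸ Submodule.mem_top (x := w))
  have h2 : emb A C x ∈ clspan (Set.image2 (tmul : A.carrier → C.carrier → _) S C.homog) := by
    refine clspan_le (isClosed_clspan _) ?_ (mem_clspan_of_map_id_eq_zero hf hx)
    rintro _ ⟨a, ha, c, -, rfl⟩
    exact tmul_mem_clspan (h1 a ha) (hC.clspan_homog ▸ Submodule.mem_top (x := c))
  rw [← projCot_emb hA hC x]
  refine map_mem_of_mem_clspan (K := K.restrictScalars ℂ) hK (projCot hA hC) ?_ h2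
  rintro _ ⟨_, ⟨t, ht, w, ⟨β, γ, hw⟩, rfl⟩, c, ⟨γ', β', hc⟩, rfl⟩
  have htw : t * w ∈ A.comp β γ := by simpa only [one_mul] using mul_mem_comp (hT ht) hw
  have h3 := emb_projCot_tmul hA hC htw hc
  split_ifs at h3 with he
  · obtain ⟨y, hy⟩ := exists_emb_eq_tmul (A := A) (C := C) (hT ht).2 one_mem_comp.1
    obtain ⟨z, hz⟩ := exists_emb_eq_tmul (A := A) (C := C) hw.2 (he ▸ hc).1
    have : projCot hA hC (tmul (t * w) c) = y * z := emb_injective A C (by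
      rw [h3, map_mul, hy, hz, tmul_mul_tmul, one_mul])
    rw [this]
    exact K.mul_mem_right z (hTK t ht y hy)
  · have : projCot hA hC (tmul (t * w) c) = 0 := emb_injective A C (by rw [h3, map_zero])
    rw [this]
    exact zero_mem _

include hA hC hK in
theorem mem_of_id_map_eq_zero {f : C.carrier →⋆ₐ[ℂ] C'.carrier} (hf : Function.Surjective f)
    {T : Set C.carrier} (hT : T ⊆ C.comp 1 1)
    (hker : ∀ c, f c = 0 → c ∈ clspan (Set.image2 (· * ·) T (Set.univ : Set C.carrier)))
    (hTK : ∀ t ∈ T, ∀ x, emb A C x = tmul 1 t → x ∈ K) {x : (cot A C).carrier}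
    (hx : MaxTensor.map (StarAlgHom.id ℂ A.carrier) f (emb A C x) = 0) : x ∈ K := by
  set S : Set C.carrier := Set.image2 (· * ·) T C.homog with hS
  have h1 : ∀ c, f c = 0 → c ∈ clspan S := fun c hc => by
    refine clspan_le (isClosed_clspan S) ?_ (hker c hc)
    rintro _ ⟨t, ht, w, -, rfl⟩
    exact map_mem_clspan S (ContinuousLinearMap.mul ℂ C.carrier t)
      (fun w hw => subset_clspan ⟨t, ht, w, hw, rfl⟩)
      (hC.clspan_homog ▸ Submodule.mem_top (x := w))
  have h2 : emb A C x ∈ clspan (Set.image2 (tmul : A.carrier → C.carrier → _) A.homog S) := by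
    refine clspan_le (isClosed_clspan _) ?_ (mem_clspan_of_id_map_eq_zero hf hx)
    rintro _ ⟨a, -, c, hc, rfl⟩
    exact tmul_mem_clspan (hA.clspan_homog ▸ Submodule.mem_top (x := a)) (h1 c hc)
  rw [← projCot_emb hA hC x]
  refine map_mem_of_mem_clspan (K := K.restrictScalars ℂ) hK (projCot hA hC) ?_ h2
  rintro _ ⟨a, ⟨β, γ, ha⟩, _, ⟨t, ht, w, ⟨γ', β', hw⟩, rfl⟩, rfl⟩
  have htw : t * w ∈ C.comp γ' β' := by simpa only [one_mul] using mul_mem_comp (hT ht) hw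
  have h3 := emb_projCot_tmul hA hC ha htw
  split_ifs at h3 with he
  · obtain ⟨y, hy⟩ := exists_emb_eq_tmul (A := A) (C := C) one_mem_comp.2 (hT ht).1
    obtain ⟨z, hz⟩ := exists_emb_eq_tmul (A := A) (C := C) ha.2 (he ▸ hw).1
    have : projCot hA hC (tmul a (t * w)) = y * z := emb_injective A C (by
      rw [h3, map_mul, hy, hz, tmul_mul_tmul, one_mul])
    rw [this]
    exact K.mul_mem_right z (hTK t ht y hy)
  · have : projCot hA hC (tmul a (t * w)) = 0 := emb_injective A C (by rw [h3, map_zero])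
    rw [this]
    exact zero_mem _

end Kernels

section Surjective

variable {A A' C C' : BGData B Γ}

/-- A version of `exists_mapCot_hom` recording the properties of the induced morphism. -/
theorem exists_mapCot_mor (hA : A.IsBG) (hA' : A'.IsBG) (hC : C.IsBG)
    (hC' : C'.IsBG) {f : A.carrier →⋆ₐ[ℂ] A'.carrier} {g : C.carrier →⋆ₐ[ℂ] C'.carrier}
    (hf : IsMor A A' f) (hg : IsMor C C' g) :
    ∃ k : (cot A C).carrier →⋆ₐ[ℂ] (cot A' C').carrier,
      (∀ x, mapCot (lin f) (lin g) x = k x) ∧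
      (∀ x, emb A' C' (k x) = MaxTensor.map f g (emb A C x)) ∧ IsMor (cot A C) (cot A' C') k := by
  obtain ⟨k, hk⟩ := exists_mapCot_hom hA.toIsCG hC.toIsCG hf hg
  have h : lin k = mapCot (lin f) (lin g) := LinearMap.ext fun x => (hk x).symm
  refine ⟨k, hk, fun x => ?_, IsCPMor.isMor ?_⟩
  · rw [← hk, mapCot_spec hA.toIsCG hC.toIsCG hf.isCPMor hg.isCPMor, tensorMap_lin]
  · rw [h]
    exact isCPMor_mapCot hA hA' hC hC' hf.isCPMor hg.isCPMor

/-- The target is spanned by tensors `f a ⊗ g c` with matching middle degrees. If neither factor is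
zero, their degrees are those of `a` and `c`, so `a ⊗ c` already belongs to the source. -/
theorem surjective_of_emb_eq (hA' : A'.IsCG) (hC' : C'.IsCG) (hA : A.IsCG) (hC : C.IsCG)
    {f : A.carrier →⋆ₐ[ℂ] A'.carrier} {g : C.carrier →⋆ₐ[ℂ] C'.carrier}
    (gf : IsGraded A.toCGData A'.toCGData (lin f)) (gg : IsGraded C.toCGData C'.toCGData (lin g))
    (hf : Function.Surjective f) (hg : Function.Surjective g)
    {k : (cot A C).carrier →⋆ₐ[ℂ] (cot A' C').carrier}
    (hk : ∀ x, emb A' C' (k x) = MaxTensor.map f g (emb A C x)) : Function.Surjective k := by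
  have hS := clspan_of_homog hA' hC'
    (clspan_image_of_surjective hf hA.clspan_homog)
    (by rintro _ ⟨a, ⟨β, γ, ha⟩, rfl⟩; exact ⟨β, γ, gf _ _ _ ha⟩)
    (clspan_image_of_surjective hg hC.clspan_homog)
    (by rintro _ ⟨a, ⟨β, γ, ha⟩, rfl⟩; exact ⟨β, γ, gg _ _ _ ha⟩)
  refine surjective_of_clspan k hS ?_
  rintro y ⟨_, ⟨a, ⟨β, γ, ha⟩, rfl⟩, _, ⟨c, ⟨γ', β', hc⟩, rfl⟩, β₁, γ₁, β₂, h1, h2, hy⟩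
  by_cases h0 : y = 0
  · exact ⟨0, by rw [h0, map_zero]⟩
  have hfa : f a ≠ 0 := fun h => h0 (emb_injective A' C' (by
    rw [map_zero]; exact hy.trans (by rw [h]; exact zero_tmul _)))
  have hgc : g c ≠ 0 := fun h => h0 (emb_injective A' C' (by
    rw [map_zero]; exact hy.trans (by rw [h]; exact tmul_zero _)))
  obtain ⟨-, e⟩ := comp_unique (A := A'.toCGData) (gf _ _ _ ha) h1 hfa
  obtain ⟨e', -⟩ := comp_unique (A := C'.toCGData) (gg _ _ _ hc) h2 hgc
  obtain ⟨x, hx⟩ := exists_emb_eq_tmul (A := A) (C := C) ha.2 ((e'.trans e.symm) ▸ hc.1)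
  exact ⟨x, emb_injective A' C' (by rw [hk, hx, map_tmul]; exact hy.symm)⟩

theorem IsCPMor.comp {φ : A.carrier →ₗ[ℂ] A'.carrier} {ψ : A'.carrier →ₗ[ℂ] C.carrier}
    (hψ : IsCPMor A' C ψ) (hφ : IsCPMor A A' φ) (hA : A.IsCG) : IsCPMor A C (ψ ∘ₗ φ) :=
  isCPMor_of_isGraded hA (hψ.cp.comp hφ.cp)
    (fun _ _ a ha => hψ.isGraded _ _ _ (hφ.isGraded _ _ a ha))
    (fun b a => by rw [LinearMap.comp_apply, hφ.map_r_mul, hψ.map_r_mul]; rfl)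
    fun b a => by rw [LinearMap.comp_apply, hφ.map_s_mul, hψ.map_s_mul]; rfl

theorem IsMor.comp {f : A.carrier →⋆ₐ[ℂ] A'.carrier} {g : A'.carrier →⋆ₐ[ℂ] C.carrier}
    (hg : IsMor A' C g) (hf : IsMor A A' f) (hA : A.IsCG) : IsMor A C (g.comp f) :=
  IsCPMor.isMor (hg.isCPMor.comp hf.isCPMor hA)

theorem IsMor.of_surjective {π : A.carrier →⋆ₐ[ℂ] A'.carrier} (hπ : IsMor A A' π)
    (hs : Function.Surjective π) {f : A'.carrier →⋆ₐ[ℂ] C.carrier} (hf : IsMor A C (f.comp π)) :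
    IsMor A' C f where
  δ y := by
    obtain ⟨x, rfl⟩ := hs y
    rw [hπ.δ]
    refine (hf.δ x).trans ?_
    exact DFunLike.congr_fun (hom_ext_tmul (f := MaxTensor.map (StarAlgHom.id ℂ _) (f.comp π))
      (g := (MaxTensor.map (StarAlgHom.id ℂ _) f).comp (MaxTensor.map (StarAlgHom.id ℂ _) π))
      fun x y => by simp) (A.δ x)
  δbar y := by
    obtain ⟨x, rfl⟩ := hs y
    rw [hπ.δbar]
    refine (hf.δbar x).trans ?_
    exact DFunLike.congr_fun (hom_ext_tmul (f := MaxTensor.map (f.comp π) (StarAlgHom.id ℂ _))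
      (g := (MaxTensor.map f (StarAlgHom.id ℂ _)).comp (MaxTensor.map π (StarAlgHom.id ℂ _)))
      fun x y => by simp) (A.δbar x)
  linear b b' y := by
    obtain ⟨x, rfl⟩ := hs y
    rw [← hπ.linear]
    exact hf.linear b b' x

end Surjective

end BGData

/-! ### Associativity -/

namespace BGData

open CGData

variable {B Γ : Type u} [CommCStarAlgebra B] [Group Γ] [CStarAction B Γ]

theorem clspan_emb_tmul {A C : BGData B Γ} (hA : A.IsCG) (hC : C.IsCG) {S : Set A.carrier}
    {T : Set C.carrier} (hS : clspan S = ⊤) (hSA : S ⊆ A.homog) (hT : clspan T = ⊤)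
    (hTC : T ⊆ C.homog) :
    clspan {x : (cot A C).carrier | ∃ a ∈ S, ∃ c ∈ T, ∃ β γ β', a ∈ A.comp β γ ∧
      c ∈ C.comp γ β' ∧ emb A C x = tmul a c} = ⊤ :=
  clspan_of_homog hA hC hS hSA hT hTC

section Triple

variable (A C D : BGData B Γ)

/-- The embedding of `(A ⊗^Γ C) ⊗^Γ D` in the triple maximal tensor product. -/
noncomputable def embL :
    (cot (cot A C) D).carrier →⋆ₐ[ℂ] MaxTensor A.carrier (MaxTensor C.carrier D.carrier) :=
  ((MaxTensor.assoc A.carrier C.carrier D.carrier).comp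
    (MaxTensor.map (emb A C) (StarAlgHom.id ℂ D.carrier))).comp (emb (cot A C) D)

/-- The embedding of `A ⊗^Γ (C ⊗^Γ D)` in the triple maximal tensor product. -/
noncomputable def embR :
    (cot A (cot C D)).carrier →⋆ₐ[ℂ] MaxTensor A.carrier (MaxTensor C.carrier D.carrier) :=
  (MaxTensor.map (StarAlgHom.id ℂ A.carrier) (emb C D)).comp (emb A (cot C D))

variable {A C D}

theorem embL_apply (x : (cot (cot A C) D).carrier) : embL A C D x =
    MaxTensor.assoc _ _ _ (MaxTensor.map (emb A C) (StarAlgHom.id ℂ D.carrier)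
      (emb (cot A C) D x)) := rfl

theorem embR_apply (x : (cot A (cot C D)).carrier) : embR A C D x =
    MaxTensor.map (StarAlgHom.id ℂ A.carrier) (emb C D) (emb A (cot C D) x) := rfl

theorem embL_tmul {x : (cot (cot A C) D).carrier} {w : (cot A C).carrier} {d : D.carrier}
    {a : A.carrier} {c : C.carrier} (hx : emb (cot A C) D x = tmul w d)
    (hw : emb A C w = tmul a c) : embL A C D x = tmul a (tmul c d) := by
  rw [embL_apply, hx, map_tmul, hw]
  exact assoc_tmul a c d

theorem embR_tmul {x : (cot A (cot C D)).carrier} {w : (cot C D).carrier} {d : D.carrier}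
    {a : A.carrier} {c : C.carrier} (hx : emb A (cot C D) x = tmul a w)
    (hw : emb C D w = tmul c d) : embR A C D x = tmul a (tmul c d) := by
  rw [embR_apply, hx, map_tmul, hw]
  rfl

variable (hA : A.IsBG) (hC : C.IsBG) (hD : D.IsBG)

include hA hC in
-- The inclusion of `A ⊗^Γ C` in `A ⊗ C` stays injective after tensoring with `D`, thanks to its
-- completely positive left inverse.
theorem embL_injective : Function.Injective (embL A C D) := fun _ _ h =>
  emb_injective _ _ (map_incl_id_injective hA.toIsCG hC.toIsCG (assoc_injective h))

include hC hD in
theorem embR_injective : Function.Injective (embR A C D) := fun _ _ h =>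
  emb_injective _ _ (map_id_incl_injective hC.toIsCG hD.toIsCG h)

include hA hC hD

theorem exists_embL_eq_tmul {β γ γ' β' : Γ} {a : A.carrier} {c : C.carrier} {d : D.carrier}
    (ha : a ∈ A.comp β γ) (hc : c ∈ C.comp γ γ') (hd : d ∈ D.comp γ' β') :
    ∃ x ∈ (cot (cot A C) D).comp β β', embL A C D x = tmul a (tmul c d) := by
  obtain ⟨w, hw⟩ := exists_emb_eq_tmul (A := A) (C := C) ha.2 hc.1
  have hw' := mem_comp_of_emb hA.toIsCG hC.toIsCG ha hc hw
  obtain ⟨x, hx⟩ := exists_emb_eq_tmul (A := cot A C) (C := D) hw'.2 hd.1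
  exact ⟨x, mem_comp_of_emb (isBG_cot hA hC).toIsCG hD.toIsCG hw' hd hx, embL_tmul hx hw⟩

theorem exists_embR_eq_tmul {β γ γ' β' : Γ} {a : A.carrier} {c : C.carrier} {d : D.carrier}
    (ha : a ∈ A.comp β γ) (hc : c ∈ C.comp γ γ') (hd : d ∈ D.comp γ' β') :
    ∃ x ∈ (cot A (cot C D)).comp β β', embR A C D x = tmul a (tmul c d) := by
  obtain ⟨w, hw⟩ := exists_emb_eq_tmul (A := C) (C := D) hc.2 hd.1
  have hw' := mem_comp_of_emb hC.toIsCG hD.toIsCG hc hd hw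
  obtain ⟨x, hx⟩ := exists_emb_eq_tmul (A := A) (C := cot C D) ha.2 hw'.1
  exact ⟨x, mem_comp_of_emb hA.toIsCG (isBG_cot hC hD).toIsCG ha hw' hx, embR_tmul hx hw⟩

omit hA hC hD in
variable (A C D) in
/-- The elementary tensors of homogeneous elements of matching degrees in `(A ⊗^Γ C) ⊗^Γ D`. -/
def genL : Set (cot (cot A C) D).carrier :=
  {x | ∃ β γ γ' β', ∃ a ∈ A.comp β γ, ∃ c ∈ C.comp γ γ', ∃ d ∈ D.comp γ' β',
    embL A C D x = tmul a (tmul c d)}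

omit hA hC hD in
variable (A C D) in
/-- The elementary tensors of homogeneous elements of matching degrees in `A ⊗^Γ (C ⊗^Γ D)`. -/
def genR : Set (cot A (cot C D)).carrier :=
  {x | ∃ β γ γ' β', ∃ a ∈ A.comp β γ, ∃ c ∈ C.comp γ γ', ∃ d ∈ D.comp γ' β',
    embR A C D x = tmul a (tmul c d)}

theorem clspan_genL : clspan (genL A C D) = ⊤ := by
  have hS := clspan_emb_tmul (isBG_cot hA hC).toIsCG hD.toIsCG (clspan_gen hA.toIsCG hC.toIsCG)
    (gen_subset_homog hA.toIsCG hC.toIsCG) hD.clspan_homog subset_rfl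
  refine top_unique (hS.symm.trans_le (clspan_le (isClosed_clspan (genL A C D)) ?_))
  rintro x ⟨w, ⟨β, γ, γ', a, ha, c, hc, hw⟩, d, -, β₁, γ₁, β', hw', hd, hx⟩
  -- The right degree of `w` is tied to that of `c` only when `w ≠ 0`.
  by_cases h0 : x = 0
  · rw [h0]; exact zero_mem _
  have hw0 : w ≠ 0 := fun h => h0 (emb_injective (cot A C) D (by
    rw [map_zero]; exact hx.trans (by rw [h]; exact zero_tmul _)))
  obtain ⟨-, rfl⟩ := comp_unique (A := (cot A C).toCGData)
    (mem_comp_of_emb hA.toIsCG hC.toIsCG ha hc hw) hw' hw0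
  exact subset_clspan ⟨β, γ, γ', β', a, ha, c, hc, d, hd, embL_tmul hx hw⟩

theorem clspan_genR : clspan (genR A C D) = ⊤ := by
  have hS := clspan_emb_tmul hA.toIsCG (isBG_cot hC hD).toIsCG hA.clspan_homog subset_rfl
    (clspan_gen hC.toIsCG hD.toIsCG) (gen_subset_homog hC.toIsCG hD.toIsCG)
  refine top_unique (hS.symm.trans_le (clspan_le (isClosed_clspan (genR A C D)) ?_))
  rintro x ⟨a, -, w, ⟨γ, γ', β', c, hc, d, hd, hw⟩, β, γ₁, β₁, ha, hw', hx⟩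
  by_cases h0 : x = 0
  · rw [h0]; exact zero_mem _
  have hw0 : w ≠ 0 := fun h => h0 (emb_injective A (cot C D) (by
    rw [map_zero]; exact hx.trans (by rw [h]; exact tmul_zero _)))
  obtain ⟨rfl, -⟩ := comp_unique (A := (cot C D).toCGData)
    (mem_comp_of_emb hC.toIsCG hD.toIsCG hc hd hw) hw' hw0
  exact subset_clspan ⟨β, γ, γ', β', a, ha, c, hc, d, hd, embR_tmul hx hw⟩

/-- Both iterated cotensor products are closed spans of the tensors `a ⊗ (c ⊗ d)` with matching
degrees, seen inside the triple tensor product. -/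
theorem exists_assocHom : ∃ α : (cot (cot A C) D).carrier →⋆ₐ[ℂ] (cot A (cot C D)).carrier,
    ∀ x, embR A C D (α x) = embL A C D x :=
  exists_factor_of_injective_clspan (embR_injective hC hD) (clspan_genL hA hC hD) (by
    rintro x ⟨β, γ, γ', β', a, ha, c, hc, d, hd, hx⟩
    obtain ⟨y, -, hy⟩ := exists_embR_eq_tmul hA hC hD ha hc hd
    exact ⟨y, hy.trans hx.symm⟩)

/-- The associativity isomorphism of cotensor products. -/
noncomputable def assocHom : (cot (cot A C) D).carrier →⋆ₐ[ℂ] (cot A (cot C D)).carrier :=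
  (exists_assocHom hA hC hD).choose

theorem embR_assocHom (x : (cot (cot A C) D).carrier) :
    embR A C D (assocHom hA hC hD x) = embL A C D x :=
  (exists_assocHom hA hC hD).choose_spec x

theorem assocHom_injective : Function.Injective (assocHom hA hC hD) := fun x y h =>
  embL_injective hA hC (by rw [← embR_assocHom hA hC hD, h, embR_assocHom])

theorem assocHom_surjective : Function.Surjective (assocHom hA hC hD) := by
  refine surjective_of_clspan _ (clspan_genR hA hC hD) ?_
  rintro y ⟨β, γ, γ', β', a, ha, c, hc, d, hd, hy⟩
  obtain ⟨x, -, hx⟩ := exists_embL_eq_tmul hA hC hD ha hc hd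
  exact ⟨x, embR_injective hC hD (by rw [embR_assocHom, hx, hy])⟩

theorem embL_r (b : B) : embL A C D ((cot (cot A C) D).r b) = tmul (A.r b) 1 :=
  embL_tmul (cot_r (isBG_cot hA hC) b) (cot_r hA b)

theorem embR_r (b : B) : embR A C D ((cot A (cot C D)).r b) = tmul (A.r b) 1 :=
  embR_tmul (cot_r hA b) (map_one (emb C D))

theorem embL_s (b : B) : embL A C D ((cot (cot A C) D).s b) = tmul 1 (tmul 1 (D.s b)) :=
  embL_tmul (cot_s hD b) (map_one (emb A C))

theorem embR_s (b : B) : embR A C D ((cot A (cot C D)).s b) = tmul 1 (tmul 1 (D.s b)) :=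
  embR_tmul (cot_s (isBG_cot hC hD) b) (cot_s hD b)

theorem isMor_assocHom : IsMor (cot (cot A C) D) (cot A (cot C D)) (assocHom hA hC hD) := by
  refine isMor_of_isGraded (isBG_cot (isBG_cot hA hC) hD).toIsCG
    (isGraded_of_clspan (clspan_genL hA hC hD) (isCP_lin _) ?_) (fun b => ?_) fun b => ?_
  · rintro x ⟨β, γ, γ', β', a, ha, c, hc, d, hd, hx⟩
    obtain ⟨y, hy, hy'⟩ := exists_embR_eq_tmul hA hC hD ha hc hd
    obtain ⟨z, hz, hz'⟩ := exists_embL_eq_tmul hA hC hD ha hc hd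
    obtain rfl : x = z := embL_injective hA hC (hx.trans hz'.symm)
    refine ⟨β, β', hz, ?_⟩
    change assocHom hA hC hD x ∈ (cot A (cot C D)).comp β β'
    rwa [show assocHom hA hC hD x = y from
      embR_injective hC hD (by rw [embR_assocHom, hx, hy'])]
  · exact embR_injective hC hD (by rw [embR_assocHom, embL_r hA hC hD, embR_r hA hC hD])
  · exact embR_injective hC hD (by rw [embR_assocHom, embL_s hA hC hD, embR_s hA hC hD])

theorem lin_assocHom : lin (assocHom hA hC hD) = a A C D := by
  have h : ∀ x, embR A C D (a A C D x) = embL A C D x :=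
    Classical.epsilon_spec (p := fun F : (cot (cot A C) D).carrier →ₗ[ℂ]
      (cot A (cot C D)).carrier => ∀ x, embR A C D (F x) = embL A C D x)
      ⟨lin (assocHom hA hC hD), embR_assocHom hA hC hD⟩
  exact LinearMap.ext fun x => embR_injective hC hD ((embR_assocHom hA hC hD x).trans (h x).symm)

/-- In the triple tensor product the generators become `t_{A,C}(b) ⊗ 1 + 1 ⊗ t_{C,D}(b')`, a
description that does not depend on the bracketing; `mem_genΨ` has the same right-hand side. -/
theorem mem_genΦ {x : (cot (cot A C) D).carrier} : x ∈ genΦ A C D ↔ ∃ b b',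
    embL A C D x = tmul (A.s b) 1 - tmul 1 (tmul (C.r b) 1) +
      (tmul 1 (tmul (C.s b') 1) - tmul 1 (tmul 1 (D.r b'))) := by
  have key : ∀ {x : (cot (cot A C) D).carrier} {y z b b'},
      emb A C y = tmul (A.s b) 1 - tmul 1 (C.r b) →
      emb (cot A C) D z = tmul ((cot A C).s b') 1 - tmul 1 (D.r b') →
      emb (cot A C) D x = tmul y 1 + emb (cot A C) D z →
      embL A C D x = tmul (A.s b) 1 - tmul 1 (tmul (C.r b) 1) +
        (tmul 1 (tmul (C.s b') 1) - tmul 1 (tmul 1 (D.r b'))) := fun hy hz hx => by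
    rw [embL_apply, hx, hz, map_add, map_sub, map_tmul, map_tmul, map_tmul, hy, cot_s hC,
      map_one, sub_tmul, map_add, map_sub, map_sub, assoc_tmul, assoc_tmul]
    congr 2
    · exact assoc_tmul _ _ _
    · exact assoc_tmul _ _ _
  constructor
  · rintro ⟨y, ⟨b, hy⟩, z, ⟨b', hz⟩, hx⟩
    exact ⟨b, b', key hy hz hx⟩
  · rintro ⟨b, b', hx⟩
    obtain ⟨y, hy⟩ := exists_tSet hA hC b
    obtain ⟨z, hz⟩ := exists_tSet (isBG_cot hA hC) hD b'
    obtain ⟨w, hw⟩ := exists_emb_eq_tmul (A := cot A C) (C := D)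
      (tSet_subset_comp hA hC (mem_tSet.2 ⟨b, hy⟩)).2 one_mem_comp.1
    have h : emb (cot A C) D (w + z) = tmul y 1 + emb (cot A C) D z := by rw [map_add, hw]
    obtain rfl : x = w + z := embL_injective hA hC (hx.trans (key hy hz h).symm)
    exact ⟨y, ⟨b, hy⟩, z, ⟨b', hz⟩, h⟩

theorem mem_genΨ {x : (cot A (cot C D)).carrier} : x ∈ genΨ A C D ↔ ∃ b b',
    embR A C D x = tmul (A.s b) 1 - tmul 1 (tmul (C.r b) 1) +
      (tmul 1 (tmul (C.s b') 1) - tmul 1 (tmul 1 (D.r b'))) := by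
  have key : ∀ {x : (cot A (cot C D)).carrier} {y z b b'},
      emb C D y = tmul (C.s b') 1 - tmul 1 (D.r b') →
      emb A (cot C D) z = tmul (A.s b) 1 - tmul 1 ((cot C D).r b) →
      emb A (cot C D) x = tmul 1 y + emb A (cot C D) z →
      embR A C D x = tmul (A.s b) 1 - tmul 1 (tmul (C.r b) 1) +
        (tmul 1 (tmul (C.s b') 1) - tmul 1 (tmul 1 (D.r b'))) := fun hy hz hx => by
    rw [embR_apply, hx, hz, map_add, map_sub, map_tmul, map_tmul, map_tmul, hy, cot_r hC,
      map_one, tmul_sub, add_comm]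
    rfl
  constructor
  · rintro ⟨y, ⟨b', hy⟩, z, ⟨b, hz⟩, hx⟩
    exact ⟨b, b', key hy hz hx⟩
  · rintro ⟨b, b', hx⟩
    obtain ⟨y, hy⟩ := exists_tSet hC hD b'
    obtain ⟨z, hz⟩ := exists_tSet hA (isBG_cot hC hD) b
    obtain ⟨w, hw⟩ := exists_emb_eq_tmul (A := A) (C := cot C D)
      one_mem_comp.2 (tSet_subset_comp hC hD (mem_tSet.2 ⟨b', hy⟩)).1
    have h : emb A (cot C D) (w + z) = tmul 1 y + emb A (cot C D) z := by rw [map_add, hw]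
    obtain rfl : x = w + z := embR_injective hC hD (hx.trans (key hy hz h).symm)
    exact ⟨y, ⟨b', hy⟩, z, ⟨b, hz⟩, h⟩

theorem assocHom_mem_genΨ {x : (cot (cot A C) D).carrier} :
    assocHom hA hC hD x ∈ genΨ A C D ↔ x ∈ genΦ A C D := by
  rw [mem_genΦ hA hC hD, mem_genΨ hA hC hD, embR_assocHom]

end Triple

end BGData

/-! ### The associativity isomorphism of the products -/

namespace BGData

open CGData

variable {B Γ : Type u} [CommCStarAlgebra B] [Group Γ] [CStarAction B Γ]

theorem isMor_id {A : BGData B Γ} : IsMor A A (StarAlgHom.id ℂ A.carrier) :=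
  IsCPMor.isMor IsCPMor.id

theorem mem_clspan_of_q_eq_zero {A C : BGData B Γ} (hA : A.IsBG) (hC : C.IsBG)
    {x : (cot A C).carrier} (hx : q A C x = 0) :
    x ∈ clspan (Set.image2 (· * ·) (tSet A C) (Set.univ : Set (cot A C).carrier)) :=
  closedIdeal_tSet_le hA hC (q_eq_zero.1 hx)

section Kernel

variable {A C A' C' : BGData B Γ}

/-- As `K` contains `ker k`, the quotient map by `K` factors through the surjection `k`. The
factored map kills `t_{A',C'}(B)`, hence the whole ideal. -/
theorem mem_of_q_eq_zero {k : (cot A C).carrier →⋆ₐ[ℂ] (cot A' C').carrier}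
    (hk : Function.Surjective k) (K : Ideal (cot A C).carrier) [K.IsTwoSided]
    [IsClosed (K : Set (cot A C).carrier)] (hker : ∀ x, k x = 0 → x ∈ K)
    (hT : ∀ t ∈ tSet A' C', ∃ x ∈ K, k x = t) {x : (cot A C).carrier}
    (hx : q A' C' (k x) = 0) : x ∈ K := by
  obtain ⟨g, hg⟩ := exists_factor_of_surjective hk (f := quotMk K) fun x hx =>
    (quotMk_eq_zero K).2 (hker x hx)
  rw [← quotMk_eq_zero K, ← hg]
  refine map_eq_zero_of_mem_closedIdeal (fun t ht => ?_) (q_eq_zero.1 hx)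
  obtain ⟨y, hy, rfl⟩ := hT t ht
  rw [hg]
  exact (quotMk_eq_zero K).2 hy

end Kernel

section Assoc

variable {A C D : BGData B Γ} (hA : A.IsBG) (hC : C.IsBG) (hD : D.IsBG)

include hA hC hD

/-- `genΦ` consists of sums of two generators with independent parameters; the parameter `0` makes
one summand vanish, so each of the two sets is contained in it. -/
theorem tSet_subset_genΦ : tSet (cot A C) D ⊆ genΦ A C D := fun z hz => by
  obtain ⟨y, hy⟩ := exists_tSet hA hC 0
  refine ⟨y, ⟨0, hy⟩, z, hz, ?_⟩
  have : y = 0 := emb_injective A C (by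
    rw [hy, map_zero, map_zero, map_zero, zero_tmul, tmul_zero, sub_zero])
  rw [this, zero_tmul, zero_add]

theorem tmul_tSet_mem_genΦ {t : (cot A C).carrier} (ht : t ∈ tSet A C)
    {x : (cot (cot A C) D).carrier} (hx : emb (cot A C) D x = tmul t 1) : x ∈ genΦ A C D := by
  obtain ⟨z, hz⟩ := exists_tSet (isBG_cot hA hC) hD 0
  refine ⟨t, ht, z, ⟨0, hz⟩, ?_⟩
  change emb (cot A C) D x = tmul t 1 + emb (cot A C) D z
  rw [hx, hz, map_zero, map_zero, zero_tmul, tmul_zero, sub_zero, add_zero]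

theorem tSet_subset_genΨ : tSet A (cot C D) ⊆ genΨ A C D := fun z hz => by
  obtain ⟨y, hy⟩ := exists_tSet hC hD 0
  refine ⟨y, ⟨0, hy⟩, z, hz, ?_⟩
  have : y = 0 := emb_injective C D (by
    rw [hy, map_zero, map_zero, map_zero, zero_tmul, tmul_zero, sub_zero])
  rw [this, tmul_zero, zero_add]

theorem tmul_tSet_mem_genΨ {t : (cot C D).carrier} (ht : t ∈ tSet C D)
    {x : (cot A (cot C D)).carrier} (hx : emb A (cot C D) x = tmul 1 t) : x ∈ genΨ A C D := by
  obtain ⟨z, hz⟩ := exists_tSet hA (isBG_cot hC hD) 0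
  refine ⟨t, ht, z, ⟨0, hz⟩, ?_⟩
  change emb A (cot C D) x = tmul 1 t + emb A (cot C D) z
  rw [hx, hz, map_zero, map_zero, zero_tmul, tmul_zero, sub_zero, add_zero]

/-- The kernel is found in two stages. Elements killed by `k = q ⊗^Γ id` lie in the ideal generated
by `t_{A,C}(B) ⊗ 1`, by exactness. The outer quotient kills the ideal generated by `t_{A ⊗~ C,
D}(B)`, whose generators lift along `k` to `t_{A ⊗^Γ C, D}(B)` because `q` respects `s`. -/
theorem exists_homΦ : ∃ F : (cot (cot A C) D).carrier →⋆ₐ[ℂ] (prod (prod A C) D).carrier,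
    lin F = Φ A C D ∧ IsMor _ _ F ∧ Function.Surjective F ∧
      ∀ x, F x = 0 ↔ x ∈ closedIdeal (genΦ A C D) := by
  have hAC := isBG_cot hA hC
  have hAC' := isBG_prod hA hC
  have hq := isMor_q hA hC
  obtain ⟨k, hk, hemb, hmor⟩ := exists_mapCot_mor hAC hAC' hD hD hq isMor_id
  have hsurj : Function.Surjective k := surjective_of_emb_eq hAC'.toIsCG hD.toIsCG hAC.toIsCG
    hD.toIsCG hq.isGraded isMor_id.isGraded q_surjective Function.surjective_id hemb
  have hT : ∀ z ∈ tSet (cot A C) D, k z ∈ tSet (prod A C) D := fun z ⟨b, hz⟩ => by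
    refine mem_tSet.2 ⟨b, ?_⟩
    rw [hemb, show emb (cot A C) D z = _ from hz, map_sub, map_tmul, map_tmul, map_one, map_one,
      hq.map_s]
    rfl
  refine ⟨(q (prod A C) D).comp k, LinearMap.ext fun x => congrArg (q (prod A C) D) (hk x).symm,
    (isMor_q hAC' hD).comp hmor (isBG_cot hAC hD).toIsCG, q_surjective.comp hsurj, fun x =>
    ⟨fun hx => ?_, fun hx => ?_⟩⟩
  · refine mem_of_q_eq_zero hsurj (closedIdeal (genΦ A C D)) (fun y hy => ?_) (fun t ht => ?_) hx
    · exact mem_of_map_id_eq_zero hAC.toIsCG hD.toIsCG inferInstance q_surjective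
        (tSet_subset_comp hA hC) (fun a => mem_clspan_of_q_eq_zero hA hC)
        (fun t ht x hx => subset_closedIdeal (tmul_tSet_mem_genΦ hA hC hD ht hx))
        (by rw [← hemb, hy, map_zero])
    · obtain ⟨b, hb⟩ := mem_tSet.1 ht
      obtain ⟨z, hz⟩ := exists_tSet hAC hD b
      refine ⟨z, subset_closedIdeal (tSet_subset_genΦ hA hC hD (mem_tSet.2 ⟨b, hz⟩)),
        emb_injective _ _ ?_⟩
      rw [hemb, hz, hb, map_sub, map_tmul, map_tmul, map_one, map_one, hq.map_s]
      rfl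
  · refine map_eq_zero_of_mem_closedIdeal ?_ hx
    rintro x ⟨y, hy, z, hz, hx⟩
    obtain ⟨w, hw⟩ := exists_emb_eq_tmul (A := cot A C) (C := D)
      (tSet_subset_comp hA hC hy).2 one_mem_comp.1
    obtain rfl : x = w + z := emb_injective _ _ (by rw [map_add, hw]; exact hx)
    -- The summand `w = y ⊗ 1` dies under `k`, the summand `z` only under the outer quotient.
    have hkw : k w = 0 := emb_injective _ _ (by
      rw [hemb, hw, map_tmul, q_tSet hy, zero_tmul, map_zero])
    rw [map_add, StarAlgHom.comp_apply, StarAlgHom.comp_apply, hkw, map_zero, zero_add,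
      q_tSet (hT z hz)]

theorem exists_homΨ : ∃ F : (cot A (cot C D)).carrier →⋆ₐ[ℂ] (prod A (prod C D)).carrier,
    lin F = Ψ A C D ∧ IsMor _ _ F ∧ Function.Surjective F ∧
      ∀ x, F x = 0 ↔ x ∈ closedIdeal (genΨ A C D) := by
  have hCD := isBG_cot hC hD
  have hCD' := isBG_prod hC hD
  have hq := isMor_q hC hD
  obtain ⟨k, hk, hemb, hmor⟩ := exists_mapCot_mor hA hA hCD hCD' isMor_id hq
  have hsurj : Function.Surjective k := surjective_of_emb_eq hA.toIsCG hCD'.toIsCG hA.toIsCG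
    hCD.toIsCG isMor_id.isGraded hq.isGraded Function.surjective_id q_surjective hemb
  have hT : ∀ z ∈ tSet A (cot C D), k z ∈ tSet A (prod C D) := fun z ⟨b, hz⟩ => by
    refine mem_tSet.2 ⟨b, ?_⟩
    rw [hemb, show emb A (cot C D) z = _ from hz, map_sub, map_tmul, map_tmul, map_one, map_one,
      hq.map_r]
    rfl
  refine ⟨(q A (prod C D)).comp k, LinearMap.ext fun x => congrArg (q A (prod C D)) (hk x).symm,
    (isMor_q hA hCD').comp hmor (isBG_cot hA hCD).toIsCG, q_surjective.comp hsurj, fun x =>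
    ⟨fun hx => ?_, fun hx => ?_⟩⟩
  · refine mem_of_q_eq_zero hsurj (closedIdeal (genΨ A C D)) (fun y hy => ?_) (fun t ht => ?_) hx
    · exact mem_of_id_map_eq_zero hA.toIsCG hCD.toIsCG inferInstance q_surjective
        (tSet_subset_comp hC hD) (fun a => mem_clspan_of_q_eq_zero hC hD)
        (fun t ht x hx => subset_closedIdeal (tmul_tSet_mem_genΨ hA hC hD ht hx))
        (by rw [← hemb, hy, map_zero])
    · obtain ⟨b, hb⟩ := mem_tSet.1 ht
      obtain ⟨z, hz⟩ := exists_tSet hA hCD b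
      refine ⟨z, subset_closedIdeal (tSet_subset_genΨ hA hC hD (mem_tSet.2 ⟨b, hz⟩)),
        emb_injective _ _ ?_⟩
      rw [hemb, hz, hb, map_sub, map_tmul, map_tmul, map_one, map_one, hq.map_r]
      rfl
  · refine map_eq_zero_of_mem_closedIdeal ?_ hx
    rintro x ⟨y, hy, z, hz, hx⟩
    obtain ⟨w, hw⟩ := exists_emb_eq_tmul (A := A) (C := cot C D)
      one_mem_comp.2 (tSet_subset_comp hC hD hy).1
    obtain rfl : x = w + z := emb_injective _ _ (by rw [map_add, hw]; exact hx)
    have hkw : k w = 0 := emb_injective _ _ (by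
      rw [hemb, hw, map_tmul, q_tSet hy, tmul_zero, map_zero])
    rw [map_add, StarAlgHom.comp_apply, StarAlgHom.comp_apply, hkw, map_zero, zero_add,
      q_tSet (hT z hz)]

theorem kerΦ : {x | Φ A C D x = 0} = (closedIdeal (genΦ A C D) : Set _) := by
  obtain ⟨F, hF, -, -, hker⟩ := exists_homΦ hA hC hD
  ext x
  rw [Set.mem_ofPred_eq, ← hF]
  exact hker x

theorem kerΨ : {x | Ψ A C D x = 0} = (closedIdeal (genΨ A C D) : Set _) := by
  obtain ⟨F, hF, -, -, hker⟩ := exists_homΨ hA hC hD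
  ext x
  rw [Set.mem_ofPred_eq, ← hF]
  exact hker x

theorem Φ_surjective : Function.Surjective (Φ A C D) := by
  obtain ⟨F, hF, -, hs, -⟩ := exists_homΦ hA hC hD
  rw [← hF]
  exact hs

theorem exists_prodAssoc : ∃ α : (prod (prod A C) D).carrier →⋆ₐ[ℂ] (prod A (prod C D)).carrier,
    IsIso (prod (prod A C) D) (prod A (prod C D)) α ∧ lin α ∘ₗ Φ A C D = Ψ A C D ∘ₗ a A C D := by
  obtain ⟨F, hF, mF, sF, kF⟩ := exists_homΦ hA hC hD
  obtain ⟨G, hG, mG, sG, kG⟩ := exists_homΨ hA hC hD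
  -- `g` is `F` transported along the inverse of the associativity isomorphism. It kills `genΨ`, so
  -- its kernel contains that of `G`, which makes `α` injective.
  obtain ⟨g, hg⟩ := exists_factor_of_surjective (assocHom_surjective hA hC hD)
    (f := F) fun x hx => by
      rw [(injective_iff_map_eq_zero _).1 (assocHom_injective hA hC hD) x hx, map_zero]
  obtain ⟨α, hα⟩ := exists_factor_of_surjective sF (f := G.comp (assocHom hA hC hD)) fun x hx =>
    map_eq_zero_of_mem_closedIdeal (S := genΦ A C D) (fun y hy => (kG _).2
      (subset_closedIdeal ((assocHom_mem_genΨ hA hC hD (x := y)).2 hy))) ((kF x).1 hx)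
  refine ⟨α, IsMor.isIso (mF.of_surjective sF ?_) ((injective_iff_map_eq_zero α).2 fun y hy => ?_)
    fun z => ?_, ?_⟩
  · rw [show α.comp F = G.comp (assocHom hA hC hD) from StarAlgHom.ext hα]
    exact mG.comp (isMor_assocHom hA hC hD) (isBG_cot (isBG_cot hA hC) hD).toIsCG
  · obtain ⟨x, rfl⟩ := sF y
    rw [hα] at hy
    rw [← hg]
    refine map_eq_zero_of_mem_closedIdeal (fun w hw => ?_) ((kG _).1 hy)
    obtain ⟨v, rfl⟩ := assocHom_surjective hA hC hD w
    rw [hg]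
    exact (kF v).2 (subset_closedIdeal ((assocHom_mem_genΨ hA hC hD).1 hw))
  · obtain ⟨w, rfl⟩ := sG z
    obtain ⟨v, rfl⟩ := assocHom_surjective hA hC hD w
    exact ⟨F v, hα v⟩
  · rw [← hF, ← hG, ← lin_assocHom hA hC hD]
    exact LinearMap.ext hα

end Assoc

/-! ### Naturality of the associativity isomorphism -/

section Naturality

variable {A A' C C' D D' : BGData B Γ} (hA : A.IsBG) (hA' : A'.IsBG) (hC : C.IsBG)
  (hC' : C'.IsBG) (hD : D.IsBG) (hD' : D'.IsBG) {φ : A.carrier →ₗ[ℂ] A'.carrier}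
  {ψ : C.carrier →ₗ[ℂ] C'.carrier} {χ : D.carrier →ₗ[ℂ] D'.carrier} (hφ : IsCPMor A A' φ)
  (hψ : IsCPMor C C' ψ) (hχ : IsCPMor D D' χ)

include hA hA' hC hC' hD hD' hφ hψ hχ

/-- In the triple tensor product both bracketings of the induced map become `φ ⊗ (ψ ⊗ χ)`. Compared
with `embR_mapCot`, this gives naturality on the level of cotensor products. -/
theorem embL_mapCot (x : (cot (cot A C) D).carrier) :
    embL A' C' D' (mapCot (A := cot A C) (A' := cot A' C') (C := D) (C' := D')
      (mapCot (A := A) (A' := A') (C := C) (C' := C') φ ψ) χ x) =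
    tensorMap φ (tensorMap ψ χ : MaxTensor C.carrier D.carrier →ₗ[ℂ]
      MaxTensor C'.carrier D'.carrier) (embL A C D x) := by
  have hm := isCPMor_mapCot hA hA' hC hC' hφ hψ
  have h1 := fun y => DFunLike.congr_fun (clm_ext₃
    (f := homL (MaxTensor.assoc A'.carrier C'.carrier D'.carrier) ∘L
      tensorMap (tensorMap φ ψ : MaxTensor A.carrier C.carrier →ₗ[ℂ]
        MaxTensor A'.carrier C'.carrier) χ)
    (g := tensorMap φ (tensorMap ψ χ : MaxTensor C.carrier D.carrier →ₗ[ℂ]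
      MaxTensor C'.carrier D'.carrier) ∘L homL (MaxTensor.assoc A.carrier C.carrier D.carrier))
    fun a c d => by
      change MaxTensor.assoc _ _ _ (tensorMap (tensorMap φ ψ : MaxTensor A.carrier C.carrier →ₗ[ℂ]
        MaxTensor A'.carrier C'.carrier) χ (tmul (tmul a c) d)) = tensorMap φ (tensorMap ψ χ :
        MaxTensor C.carrier D.carrier →ₗ[ℂ] MaxTensor C'.carrier D'.carrier)
        (MaxTensor.assoc _ _ _ (tmul (tmul a c) d))
      rw [assoc_tmul, tensorMap_tmul (isCP_tensorMap hφ.cp hψ.cp) hχ.cp,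
        tensorMap_tmul hφ.cp (isCP_tensorMap hψ.cp hχ.cp)]
      change MaxTensor.assoc _ _ _ (tmul (tensorMap φ ψ (tmul a c)) _) =
        tmul _ (tensorMap ψ χ (tmul c d))
      rw [tensorMap_tmul hφ.cp hψ.cp, tensorMap_tmul hψ.cp hχ.cp, assoc_tmul]) y
  rw [embL_apply, mapCot_spec (isBG_cot hA hC).toIsCG hD.toIsCG hm hχ, ← tensorMap_lin_id,
    ← tensorMap_comp hm.cp hχ.cp (isCP_lin _) isCP_id,
    show lin (emb A' C') ∘ₗ mapCot (A := A) (A' := A') (C := C) (C' := C') φ ψ =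
      (tensorMap φ ψ : MaxTensor A.carrier C.carrier →ₗ[ℂ] MaxTensor A'.carrier C'.carrier) ∘ₗ
        lin (emb A C) from LinearMap.ext (mapCot_spec hA.toIsCG hC.toIsCG hφ hψ),
    show (LinearMap.id : D'.carrier →ₗ[ℂ] D'.carrier) ∘ₗ χ = χ ∘ₗ LinearMap.id from rfl,
    tensorMap_comp (isCP_lin _) isCP_id (isCP_tensorMap hφ.cp hψ.cp) hχ.cp, tensorMap_lin_id]
  exact h1 _

theorem embR_mapCot (x : (cot A (cot C D)).carrier) :
    embR A' C' D' (mapCot (A := A) (A' := A') (C := cot C D) (C' := cot C' D') φ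
      (mapCot (A := C) (A' := C') (C := D) (C' := D') ψ χ) x) =
    tensorMap φ (tensorMap ψ χ : MaxTensor C.carrier D.carrier →ₗ[ℂ]
      MaxTensor C'.carrier D'.carrier) (embR A C D x) := by
  have hm := isCPMor_mapCot hC hC' hD hD' hψ hχ
  rw [embR_apply, mapCot_spec hA.toIsCG (isBG_cot hC hD).toIsCG hφ hm, ← tensorMap_id_lin,
    ← tensorMap_comp hφ.cp hm.cp isCP_id (isCP_lin _),
    show lin (emb C' D') ∘ₗ mapCot (A := C) (A' := C') (C := D) (C' := D') ψ χ =
      (tensorMap ψ χ : MaxTensor C.carrier D.carrier →ₗ[ℂ] MaxTensor C'.carrier D'.carrier) ∘ₗ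
        lin (emb C D) from LinearMap.ext (mapCot_spec hC.toIsCG hD.toIsCG hψ hχ),
    show (LinearMap.id : A'.carrier →ₗ[ℂ] A'.carrier) ∘ₗ φ = φ ∘ₗ LinearMap.id from rfl,
    tensorMap_comp isCP_id (isCP_lin _) hφ.cp (isCP_tensorMap hψ.cp hχ.cp), tensorMap_id_lin]
  rfl

theorem a_mapCot (x : (cot (cot A C) D).carrier) :
    a A' C' D' (mapCot (A := cot A C) (A' := cot A' C') (C := D) (C' := D')
      (mapCot (A := A) (A' := A') (C := C) (C' := C') φ ψ) χ x) =
    mapCot (A := A) (A' := A') (C := cot C D) (C' := cot C' D') φ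
      (mapCot (A := C) (A' := C') (C := D) (C' := D') ψ χ) (a A C D x) := by
  rw [← lin_assocHom hA hC hD, ← lin_assocHom hA' hC' hD']
  refine embR_injective hC' hD' ((embR_assocHom hA' hC' hD' _).trans ?_)
  rw [embL_mapCot hA hA' hC hC' hD hD' hφ hψ hχ, embR_mapCot hA hA' hC hC' hD hD' hφ hψ hχ]
  exact congrArg _ (embR_assocHom hA hC hD x).symm

/-- Naturality of the inner quotient map, `(φ ⊗~ ψ) q = q' (φ ⊗^Γ ψ)`, is pushed through the outer
bracket by functoriality of the cotensor product. -/
theorem prodMap_Φ (x : (cot (cot A C) D).carrier) :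
    prodMap (prod A C) (prod A' C') D D' (prodMap A A' C C' φ ψ) χ (Φ A C D x) =
      Φ A' C' D' (mapCot (A := cot A C) (A' := cot A' C') (C := D) (C' := D')
        (mapCot (A := A) (A' := A') (C := C) (C' := C') φ ψ) χ x) := by
  have hm := isCPMor_mapCot hA hA' hC hC' hφ hψ
  have hp := isCPMor_prodMap hA hA' hC hC' hφ hψ
  have hq := (isMor_q hA hC).isCPMor
  have hq' := (isMor_q hA' hC').isCPMor
  have hc := (isBG_cot hA hC).toIsCG
  have hc' := (isBG_cot hA' hC').toIsCG
  have hP := isBG_prod hA hC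
  have hP' := isBG_prod hA' hC'
  refine (prodMap_q hP hP' hD hD' hp hχ (mapCot (A := cot A C) (A' := prod A C) (C := D)
    (C' := D) (lin (q A C)) LinearMap.id x)).trans (congrArg (q (prod A' C') D') ?_)
  refine (mapCot_comp hc hD.toIsCG hq .id hP.toIsCG hD.toIsCG hp hχ x).symm.trans
    (Eq.trans ?_ (mapCot_comp hc hD.toIsCG hm hχ hc' hD'.toIsCG hq' .id x))
  rw [show prodMap A A' C C' φ ψ ∘ₗ lin (q A C) = lin (q A' C') ∘ₗ mapCot φ ψ from
    LinearMap.ext (prodMap_q hA hA' hC hC' hφ hψ)]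
  rfl

theorem prodMap_Ψ (x : (cot A (cot C D)).carrier) :
    prodMap A A' (prod C D) (prod C' D') φ (prodMap C C' D D' ψ χ) (Ψ A C D x) =
      Ψ A' C' D' (mapCot (A := A) (A' := A') (C := cot C D) (C' := cot C' D') φ
        (mapCot (A := C) (A' := C') (C := D) (C' := D') ψ χ) x) := by
  have hm := isCPMor_mapCot hC hC' hD hD' hψ hχ
  have hp := isCPMor_prodMap hC hC' hD hD' hψ hχ
  have hq := (isMor_q hC hD).isCPMor
  have hq' := (isMor_q hC' hD').isCPMor
  have hc := (isBG_cot hC hD).toIsCG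
  have hc' := (isBG_cot hC' hD').toIsCG
  have hP := isBG_prod hC hD
  have hP' := isBG_prod hC' hD'
  refine (prodMap_q hA hA' hP hP' hφ hp (mapCot (A := A) (A' := A) (C := cot C D)
    (C' := prod C D) LinearMap.id (lin (q C D)) x)).trans (congrArg (q A' (prod C' D')) ?_)
  refine (mapCot_comp hA.toIsCG hc .id hq hA.toIsCG hP.toIsCG hφ hp x).symm.trans
    (Eq.trans ?_ (mapCot_comp hA.toIsCG hc hφ hm hA'.toIsCG hc' .id hq' x))
  rw [show prodMap C C' D D' ψ χ ∘ₗ lin (q C D) = lin (q C' D') ∘ₗ mapCot ψ χ from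
    LinearMap.ext (prodMap_q hC hC' hD hD' hψ hχ)]
  rfl

end Naturality

end BGData

end DynQG

/-! ### The theorem -/

theorem mainTheorem8 {B Γ : Type u} [CommCStarAlgebra B] [Group Γ] [CStarAction B Γ] :
    -- the product of `(B,Γ)`-C*-algebras is well defined
    (∀ A C : BGData B Γ, A.IsBG → C.IsBG → ProdWellDefined A C) ∧
    -- it is functorial on completely positive maps, in particular on morphisms
    ((∀ (A A' : BGData B Γ), A.IsBG → A'.IsBG → ∀ φ : A.carrier →⋆ₐ[ℂ] A'.carrier,
        IsMor A A' φ → IsCPMor A A' (lin φ)) ∧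
      (∀ (A A' C C' : BGData B Γ), A.IsBG → A'.IsBG → C.IsBG → C'.IsBG →
        ∀ (φ : A.carrier →ₗ[ℂ] A'.carrier) (ψ : C.carrier →ₗ[ℂ] C'.carrier),
          IsCPMor A A' φ → IsCPMor C C' ψ → MapWellDefined A A' C C' φ ψ) ∧
      (∀ (A A' C C' : BGData B Γ), A.IsBG → A'.IsBG → C.IsBG → C'.IsBG →
        ∀ (φ : A.carrier →⋆ₐ[ℂ] A'.carrier) (ψ : C.carrier →⋆ₐ[ℂ] C'.carrier),
          IsMor A A' φ → IsMor C C' ψ → ∃ θ : (prod A C).carrier →⋆ₐ[ℂ] (prod A' C').carrier,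
            IsMor (prod A C) (prod A' C') θ ∧ lin θ = prodMap A A' C C' (lin φ) (lin ψ)) ∧
      (∀ (A C : BGData B Γ), A.IsBG → C.IsBG →
        prodMap A A C C LinearMap.id LinearMap.id =
          LinearMap.id) ∧
      (∀ (A A' A'' C C' C'' : BGData B Γ), A.IsBG → A'.IsBG → A''.IsBG → C.IsBG → C'.IsBG →
        C''.IsBG → ∀ (φ : A.carrier →ₗ[ℂ] A'.carrier) (φ' : A'.carrier →ₗ[ℂ] A''.carrier)
          (ψ : C.carrier →ₗ[ℂ] C'.carrier) (ψ' : C'.carrier →ₗ[ℂ] C''.carrier),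
          IsCPMor A A' φ → IsCPMor A' A'' φ' → IsCPMor C C' ψ → IsCPMor C' C'' ψ' →
            prodMap A A'' C C'' (φ' ∘ₗ φ) (ψ' ∘ₗ ψ) =
              prodMap A' A'' C' C'' φ' ψ' ∘ₗ prodMap A A' C C' φ ψ)) ∧
    -- the full crossed product is a unit
    ((unit B Γ).IsBG ∧
      (∀ (A : BGData B Γ) (hA : A.IsBG),
        (∃ Λ : A.carrier →⋆ₐ[ℂ] (prod (unit B Γ) A).carrier,
          IsIso A (prod (unit B Γ) A) Λ ∧ lin Λ = L A hA) ∧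
        (∃ P : A.carrier →⋆ₐ[ℂ] (prod A (unit B Γ)).carrier,
          IsIso A (prod A (unit B Γ)) P ∧ lin P = R A hA)) ∧
      (∀ (A A' : BGData B Γ) (hA : A.IsBG) (hA' : A'.IsBG) (φ : A.carrier →ₗ[ℂ] A'.carrier),
        IsCPMor A A' φ →
          prodMap (unit B Γ) (unit B Γ) A A' LinearMap.id φ ∘ₗ L A hA = L A' hA' ∘ₗ φ ∧
          prodMap A A' (unit B Γ) (unit B Γ) φ LinearMap.id ∘ₗ R A hA = R A' hA' ∘ₗ φ)) ∧
    -- the kernels of `Φ` and `Ψ`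
    (∀ A C D : BGData B Γ, A.IsBG → C.IsBG → D.IsBG →
      {x | Φ A C D x = 0} = closedIdeal (genΦ A C D) ∧
      {x | Ψ A C D x = 0} = closedIdeal (genΨ A C D)) ∧
    -- the associativity isomorphisms and their naturality
    ((∀ A C D : BGData B Γ, A.IsBG → C.IsBG → D.IsBG →
        ∃ α : (cot (cot A C) D).carrier →⋆ₐ[ℂ] (cot A (cot C D)).carrier,
          IsIso (cot (cot A C) D) (cot A (cot C D)) α ∧ lin α = a A C D ∧
          ∀ x, MaxTensor.map (StarAlgHom.id ℂ _) (CGData.incl C.toCGData D.toCGData)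
              (CGData.incl A.toCGData (cot C D).toCGData (α x)) =
            MaxTensor.assoc _ _ _ (MaxTensor.map (CGData.incl A.toCGData C.toCGData)
              (StarAlgHom.id ℂ _) (CGData.incl (cot A C).toCGData D.toCGData x))) ∧
      ∃ ã : ∀ A C D : BGData B Γ,
          (prod (prod A C) D).carrier →ₗ[ℂ] (prod A (prod C D)).carrier,
        (∀ A C D : BGData B Γ, A.IsBG → C.IsBG → D.IsBG →
          ã A C D ∘ₗ Φ A C D = Ψ A C D ∘ₗ a A C D ∧
          (∃ α : (prod (prod A C) D).carrier →⋆ₐ[ℂ] (prod A (prod C D)).carrier,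
            IsIso (prod (prod A C) D) (prod A (prod C D)) α ∧ lin α = ã A C D) ∧
          ∀ α : (prod (prod A C) D).carrier →⋆ₐ[ℂ] (prod A (prod C D)).carrier,
            IsIso (prod (prod A C) D) (prod A (prod C D)) α →
              lin α ∘ₗ Φ A C D = Ψ A C D ∘ₗ a A C D → lin α = ã A C D) ∧
        ∀ (A A' C C' D D' : BGData B Γ), A.IsBG → A'.IsBG → C.IsBG → C'.IsBG → D.IsBG →
          D'.IsBG → ∀ (φ : A.carrier →ₗ[ℂ] A'.carrier) (ψ : C.carrier →ₗ[ℂ] C'.carrier)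
            (χ : D.carrier →ₗ[ℂ] D'.carrier),
            IsCPMor A A' φ → IsCPMor C C' ψ → IsCPMor D D' χ →
              prodMap A A' (prod C D) (prod C' D') φ (prodMap C C' D D' ψ χ) ∘ₗ ã A C D =
                ã A' C' D' ∘ₗ
                  prodMap (prod A C) (prod A' C') D D' (prodMap A A' C C' φ ψ) χ) := by
  refine ⟨fun A C hA hC => prodWellDefined hA hC,
    ⟨fun A A' _ _ φ hφ => hφ.isCPMor,
      fun A A' C C' hA hA' hC hC' φ ψ hφ hψ => mapWellDefined hA hA' hC hC' hφ hψ,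
      fun A A' C C' hA hA' hC hC' φ ψ hφ hψ => exists_prodMap_hom hA hA' hC hC' hφ hψ,
      fun A C hA hC => prodMap_id hA hC,
      fun A A' A'' C C' C'' hA hA' hA'' hC hC' hC'' φ φ' ψ ψ' hφ hφ' hψ hψ' =>
        prodMap_comp hA hA' hC hC' hφ hψ hA'' hC'' hφ' hψ'⟩,
    ⟨isBG_unit, fun A hA => ⟨exists_isIso_L hA, exists_isIso_R hA⟩,
      fun A A' hA hA' φ hφ => ⟨L_natural hA hA' hφ, R_natural hA hA' hφ⟩⟩,
    fun A C D hA hC hD => ⟨kerΦ hA hC hD, kerΨ hA hC hD⟩,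
    fun A C D hA hC hD => ⟨assocHom hA hC hD, (isMor_assocHom hA hC hD).isIso
      (assocHom_injective hA hC hD) (assocHom_surjective hA hC hD), lin_assocHom hA hC hD,
      embR_assocHom hA hC hD⟩, ?_⟩
  classical
  -- The family is indexed by raw data without axioms; where the axioms fail, the value `0` is
  -- arbitrary and never used.
  let ã : ∀ A C D : BGData B Γ,
      (prod (prod A C) D).carrier →ₗ[ℂ] (prod A (prod C D)).carrier := fun A C D =>
    if h : A.IsBG ∧ C.IsBG ∧ D.IsBG then lin (exists_prodAssoc h.1 h.2.1 h.2.2).choose else 0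
  have spec : ∀ A C D : BGData B Γ, A.IsBG → C.IsBG → D.IsBG →
      ∃ α : (prod (prod A C) D).carrier →⋆ₐ[ℂ] (prod A (prod C D)).carrier,
        IsIso (prod (prod A C) D) (prod A (prod C D)) α ∧
          lin α ∘ₗ Φ A C D = Ψ A C D ∘ₗ a A C D ∧ lin α = ã A C D := fun A C D hA hC hD => by
    have h := (exists_prodAssoc hA hC hD).choose_spec
    refine ⟨_, h.1, h.2, ?_⟩
    simp only [ã]
    rw [dif_pos ⟨hA, hC, hD⟩]
  refine ⟨ã, fun A C D hA hC hD => ?_,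
    fun A A' C C' D D' hA hA' hC hC' hD hD' φ ψ χ hφ hψ hχ => ?_⟩
  · obtain ⟨α, h1, h2, h3⟩ := spec A C D hA hC hD
    refine ⟨h3 ▸ h2, ⟨α, h1, h3⟩, fun α' _ h => LinearMap.ext fun y => ?_⟩
    -- `Φ` is surjective, so a map out of the product is determined by its composition with `Φ`.
    obtain ⟨x, rfl⟩ := Φ_surjective hA hC hD y
    rw [← h3]
    exact (LinearMap.congr_fun h x).trans (LinearMap.congr_fun h2 x).symm
  · obtain ⟨α, -, h2, h3⟩ := spec A C D hA hC hD
    obtain ⟨α', -, h2', h3'⟩ := spec A' C' D' hA' hC' hD'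
    rw [h3] at h2
    rw [h3'] at h2'
    refine LinearMap.ext fun y => ?_
    obtain ⟨x, rfl⟩ := Φ_surjective hA hC hD y
    refine (congrArg _ (LinearMap.congr_fun h2 x)).trans ?_
    refine (prodMap_Ψ hA hA' hC hC' hD hD' hφ hψ hχ (a A C D x)).trans ?_
    refine Eq.trans ?_
      (congrArg (ã A' C' D') (prodMap_Φ hA hA' hC hC' hD hD' hφ hψ hχ x)).symm
    refine Eq.trans ?_ (LinearMap.congr_fun h2' _).symm
    exact congrArg (Ψ A' C' D') (a_mapCot hA hA' hC hC' hD hD' hφ hψ hχ x).symm
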